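/- **Conventions.** Let $d\ge 1$ and $\varepsilon\ge 0$. On $\mathbb R^n$ put $D=-\sum_i\partial_i^2+\varepsilon$, with symbol $|\xi|^2+\varepsilon$, and $\hat f(\xi)=(2\pi)^{-n/2}\int f(x)e^{-ix\cdot\xi}\,dx$ (extended to $L_2$); $\|\cdot\|$ is the $L_2(\mathbb R^d)$ norm. A *knot set* $X(\lambda)\subset\mathbb R^n$, $\lambda>0$, is a uniformly separated set (distances of distinct points are $\ge\delta$ for some $\delta>0$, which may depend on the set) for which there are pairwise disjoint open sets $Q_x$, $x\in X(\lambda)$, each of diameter $\le\lambda$, with $Q_x\cap X(\lambda)=\{x\}$, with $\overline{Q_x}$ homeomorphic to a closed ball, and with $\bigcup_x\overline{Q_x}=\mathbb R^n$. For an integer $k>n/2$ and a knot $x$, the *Lagrangian spline* $L^k_x$ is the continuous function $u\in L_2(\mathbb R^n)$ such that $D^k u=\sum_{y\in X(\lambda)}\alpha_y\delta_y$ (as tempered distributions) for some $\alpha\in\ell_2$, $u(x)=1$, and $u(y)=0$ for all other knots $y$. For a unit vector $\theta\in\mathbb R^d$, $R\varphi(\theta,s)=\int_{\theta^\perp}\varphi(s\theta+y)\,dy$,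 and $\widehat{R\varphi}(\theta,\tau)$ is its one-dimensional Fourier transform in $s$. The norm $\|R\varphi\|$ is the $L_2(\mathbb R^d)$ norm of the function $\theta\tau\mapsto\widehat{R\varphi}(\theta,\tau)$ ($|\theta|=1$, $\tau>0$): $$\|R\varphi\|^2=\int_{S^{d-1}}\int_0^\infty|\widehat{R\varphi}(\theta,\tau)|^2\tau^{d-1}\,d\tau\,d\theta .$$ **Theorem 3.4.** There is a constant $c=c(d,\varepsilon)>0$ such that the following holds for every $\sigma>0$, every integer $r\ge[d/2]+1$, every $\lambda$ with $0<\lambda<(c(d,\varepsilon)(\sigma+\varepsilon))^{-1}$, and every knot set $\Xi(\lambda)\subset\mathbb R^d$ whose points are written in polar coordinates, $\xi=\tau_\mu\theta_\nu$ with $|\theta_\nu|=1$, $\tau_\mu\ge0$. 1. For each $l=0,1,2,\dots$ and each knot $\xi=\tau_\mu\theta_\nu$, with $k=2^lr$, the Lagrangian spline $L^{k}_{\nu,\mu}=L^k_\xi$ on $\Xi(\lambda)$ exists and is unique. Its inverse $L_2$ Fourier transform $\Lambda^k_{\nu,\mu}$ is of the form $$\Lambda^k_{\nu,\mu}(x)=(|x|^2+\varepsilon)^{-k}\sum_{\eta\in\Xi(\lambda)}a_\eta\,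 e^{i\eta\cdot x},\qquad (a_\eta)\in\ell_2,$$ where the series, equal to $(|x|^2+\varepsilon)^k\Lambda^k_{\nu,\mu}(x)$, converges unconditionally in $L_2$ on every ball. 2. For every $\varphi\in C_0^\infty(\mathbb R^d)$ vanishing outside the ball $\{|x|\le\sigma\}$, $$\varphi=\lim_{l\to\infty}(2\pi)^{(1-d)/2}\sum_{\nu,\mu}\widehat{R\varphi}(\theta_\nu,\tau_\mu)\,\Lambda^{2^lr}_{\nu,\mu}$$ in $L_2(\mathbb R^d)$, where each sum converges unconditionally in $L_2(\mathbb R^d)$, and for every $l\ge0$ $$\Big\|\varphi-(2\pi)^{(1-d)/2}\sum_{\nu,\mu}\widehat{R\varphi}(\theta_\nu,\tau_\mu)\Lambda^{2^lr}_{\nu,\mu}\Big\|\le 2\big(c(d,\varepsilon)\lambda(\sigma+\varepsilon)\big)^{2^{l+1}r}\|R\varphi\| .$$ 3. Let $\varphi$ be as in 2, let $\varepsilon_1\ge0$ and let $m\ge0$ be an integer. Let $\mu_j>0$, $\mu_j\to0$, let $Y(\mu_j)\subset\mathbb R$ be knot sets, and let $U^{2^m}_{\gamma,j}$ be the Lagrangian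 spline of $Y(\mu_j)$ at the knot $s_\gamma$, for $n=1$, $k=2^m$ and $D=-d^2/ds^2+\varepsilon_1$. These splines exist, are unique and are integrable, and with $V^{2^m}_{\gamma,j}=\widehat{U^{2^m}_{\gamma,j}}$ one has, for every knot $\tau_\mu\theta_\nu\in\Xi(\lambda)$, $$\widehat{R\varphi}(\theta_\nu,\tau_\mu)=\lim_{j\to\infty}\sum_{s_\gamma\in Y(\mu_j)}R\varphi(\theta_\nu,s_\gamma)\,V^{2^m}_{\gamma,j}(\tau_\mu).$$ -/

import Mathlib

open MeasureTheory Filter Topology Set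
open scoped ContDiff ENNReal RealInnerProductSpace SchwartzMap FourierTransform Laplacian

noncomputable section

section Splines

variable {E : Type*} [NormedAddCommGroup E] [InnerProductSpace ℝ E] [FiniteDimensional ℝ E]
  [MeasurableSpace E] [BorelSpace E]

/-- A knot set of mesh `lam`: every knot `x` has an open cell `Q x` which contains no other knot,
whose closure is a topological closed ball and whose diameter is at most `lam`; the cells are
pairwise disjoint and their closures cover the space. The knots are uniformly separated. -/
structure IsKnotSet (lam : ℝ) (X : Set E) : Prop where
  exists_cells : ∃ Q : E → Set E,
    (∀ x ∈ X, IsOpen (Q x)) ∧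
    (∀ x ∈ X, Q x ∩ X = {x}) ∧
    (∀ x ∈ X, Nonempty (closure (Q x) ≃ₜ Metric.closedBall (0 : E) 1)) ∧
    (∀ x ∈ X, ∀ y ∈ Q x, ∀ z ∈ Q x, dist y z ≤ lam) ∧
    X.PairwiseDisjoint Q ∧
    (⋃ x ∈ X, closure (Q x)) = univ
  separated : ∃ δ : ℝ, 0 < δ ∧ ∀ x ∈ X, ∀ y ∈ X, x ≠ y → δ ≤ dist x y

/-- The operator `D ψ = -∑ ∂ᵢ² ψ + ε ψ` on Schwartz functions; its symbol is `|ξ|² + ε`. -/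
def dOp (ε : ℝ) (ψ : 𝓢(E, ℂ)) : 𝓢(E, ℂ) := -(Δ ψ) + (ε : ℂ) • ψ

/-- The spline space of order `k` on `X`: the (continuous representatives of) functions
`u ∈ L²` with `D^k u = ∑ a_x δ_x` as tempered distributions, for some coefficients
`a ∈ ℓ²(X)`; that is, the `ℓ²` combinations of translates of the fundamental solution of `D^k`. -/
def IsSpline (ε : ℝ) (k : ℕ) (X : Set E) (u : E → ℂ) : Prop :=
  Continuous u ∧ MemLp u 2 (volume : Measure E) ∧
    ∃ a : X → ℂ, Summable (fun x => ‖a x‖ ^ 2) ∧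
      ∀ ψ : 𝓢(E, ℂ), ∫ y, u y * ((dOp ε)^[k] ψ) y = ∑' x : X, a x * ψ x

/-- `u` is the Lagrangian spline of order `k` on `X` at the knot `x`. -/
def IsLagrangeSpline (ε : ℝ) (k : ℕ) (X : Set E) (x : X) (u : E → ℂ) : Prop :=
  IsSpline ε k X u ∧ u x = 1 ∧ ∀ y : X, y ≠ x → u y = 0

open Classical in
/-- The inverse Fourier transform on `L²`, with the normalization which for integrable `f` reads
`(2π)^(-n/2) ∫ f(ξ) exp(i⟨ξ, x⟩) dξ`, where `n` is the dimension. It is obtained by scaling from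
the `L²` transform of Mathlib, whose kernel is `exp(2πi⟨ξ, x⟩)`. -/
def invFourierL2 (f : E → ℂ) : E → ℂ :=
  if hf : MemLp f 2 (volume : Measure E) then
    fun x => (((2 * Real.pi) ^ (-(Module.finrank ℝ E : ℝ) / 2) : ℝ) : ℂ) *
      (𝓕⁻ (hf.toLp f) : Lp ℂ 2 (volume : Measure E)) ((2 * Real.pi)⁻¹ • x)
  else 0

/-- Unconditional convergence of `∑ᵢ fᵢ` to `S` in `L²`. -/
def HasL2Sum {ι : Type*} (f : ι → E → ℂ) (S : E → ℂ) : Prop :=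
  (∀ i, MemLp (f i) 2 (volume : Measure E)) ∧ MemLp S 2 (volume : Measure E) ∧
    Tendsto (fun F : Finset ι => eLpNorm (fun x => S x - ∑ i ∈ F, f i x) 2 (volume : Measure E))
      atTop (𝓝 0)

/-- `Λ(x) = (|x|² + ε)^(-k) ∑_μ a_μ exp(i⟨ξ_μ, x⟩)`, the sum over the knots `ξ_μ ∈ X`, with
coefficients `a ∈ ℓ²(X)`. The series, which is `(|x|² + ε)^k Λ(x)`, converges in `L²` on every
ball. -/
def HasExpForm (ε : ℝ) (k : ℕ) (X : Set E) (Λ : E → ℂ) : Prop :=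
  ∃ a : X → ℂ, Summable (fun μ => ‖a μ‖ ^ 2) ∧
    ∀ R : ℝ, Tendsto
      (fun F : Finset X => eLpNorm
        (fun x => ((‖x‖ ^ 2 + ε : ℝ) : ℂ) ^ k * Λ x
          - ∑ μ ∈ F, a μ * Complex.exp (Complex.I * ((⟪(μ : E), x⟫ : ℝ) : ℂ)))
        2 ((volume : Measure E).restrict (Metric.ball 0 R)))
      atTop (𝓝 0)

/-- The Radon transform `Rφ(θ, s) = ∫_{θ^⊥} φ(s θ + y) dy`, `|θ| = 1`. -/
def radon (φ : E → ℂ) (θ : E) (s : ℝ) : ℂ :=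
  ∫ y : (ℝ ∙ θ)ᗮ, φ (s • θ + (y : E))

/-- The Fourier transform on the line, `(2π)^(-1/2) ∫ g(s) exp(-isτ) ds`. -/
def fourierLine (g : ℝ → ℂ) (τ : ℝ) : ℂ :=
  (((2 * Real.pi) ^ (-(1 : ℝ) / 2) : ℝ) : ℂ) *
    ∫ s : ℝ, g s * Complex.exp (-Complex.I * ((s * τ : ℝ) : ℂ))

/-- The Fourier transform of the Radon transform in its second variable. -/
def radonHat (φ : E → ℂ) (θ : E) (τ : ℝ) : ℂ := fourierLine (radon φ θ) τ

/-- The norm `‖Rφ‖`: the `L²` norm, on the space of the dual variable `ξ = τ θ`, of the Fourier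
transform of `Rφ` read in polar coordinates. -/
def radonNorm (φ : E → ℂ) : ℝ≥0∞ :=
  eLpNorm (fun ξ : E => radonHat φ (‖ξ‖⁻¹ • ξ) ‖ξ‖) 2 (volume : Measure E)

end Splines

end

/-!
On the Fourier side everything becomes Hilbert space geometry in `L²`. An element of the Sobolev
space `H^k`, `2k > n`, is parametrized by `g ∈ L²` through its Fourier transform
`(1 + |2πξ|²)^(-k/2) g` (`sobolevRep`); evaluation at a point is the inner product with a vector
`evalVec`, and `D^k` is a bounded operator `energyOp`. Since the knots are separated, the
evaluations form a Bessel family (`exists_bessel_bound`) and give the bounded sampling operator `S`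
into `ℓ²` of `exists_sampling`; translates of a small bump are orthogonal and give `S` a bounded
right inverse (`exists_sampling_right_inverse`). A function is a spline exactly when `D^k u` lies in
the range of `S†` (`isSpline_of_energyOp_eq`, `IsSpline.exists_energyOp_eq`).

The analytic core is a Poincaré inequality (`exists_poincare`): if `u` vanishes on an `h`-dense set,
then `‖u‖² ≤ (C h)^(2k) ∫ |ξ|^(2k) |û|²`, with `C` independent of `k`. Such a `u` is bounded
pointwise by its oscillation over balls of radius `h`. After rescaling to `h = 1`, the square
integral of the oscillation is at most `∫ K |û|²`, where the multiplier `K` (`oscMultiplier`) tends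
to `0` at the origin and has polynomial growth of a fixed order; so near the origin `K |û|²` is
absorbed on the left, and elsewhere `K` is dominated by `|ξ / ρ|^(2k)`. Consequently the energy
`⟨D^k u, u⟩` is coercive on `ker S`, even for `ε = 0`, and every datum in `ℓ²` has a unique spline
interpolant (`exists_spline_interpolation`, `eq_zero_of_energyOp_eq`). The Lagrangian splines are
the interpolants of the unit data (`isLagrangeSpline_iff`), and the exponential form of their
inverse Fourier transforms is the expansion of `D^k u = S† b`.

For the reconstruction, let `v = f - I S f` be the interpolation error of a function `f` whose
Fourier transform is carried by the ball of radius `σ`. As `v ∈ ker S`, the spline part is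
orthogonal: `⟨D^k v, v⟩ = ⟨D^k f, v⟩ ≤ (σ² + ε)^k ‖f‖ ‖v‖`. With the Poincaré inequality,
`‖v‖ ≤ (C λ)^(2k) (σ² + ε)^k ‖f‖` (`eLpNorm_interpolation_error_le`): the order is twice that of the
spline. By the Fourier slice theorem (`integral_radon_mul_exp`, `fourierInv_unflipScale`) the
transformed Radon transform of `φ` is, up to a constant, the Fourier transform `f` of `φ` in polar
coordinates, and Plancherel's theorem turns the bound into one by `‖Rφ‖`.

On the line, convergence of the Fourier transforms at a single point requires `L¹` estimates, which
follow from `L²` estimates of `u` and of `x u`. The first moment is obtained without any decay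
estimate for splines: `u` is compared with its modulation `exp(2πiη(x - γ)) u`. The difference
vanishes on all the knots, so coercivity bounds it by `O(|η|)` through the commutator of `D^k` with
the modulation (`exists_translate_sub_bound`); divide by `η` and let `η → 0`
(`exists_moment_bound`). This gives the integrability of Lagrangian splines, and an interpolation
error of order `√h` in `L¹` (`exists_integral_interpolation_error_le`).
-/

set_option linter.unusedSectionVars false

/-! ### Interpolation in Hilbert spaces -/

section Hilbert

variable {ι H : Type*} [NormedAddCommGroup H] [InnerProductSpace ℂ H]

theorem memℓp_two_of_summable {a : ι → ℂ} (ha : Summable fun i => ‖a i‖ ^ 2) : Memℓp a 2 := by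
  refine memℓp_gen ?_
  simpa using ha

theorem summable_norm_sq_lp (a : lp (fun _ : ι => ℂ) 2) : Summable fun i => ‖a i‖ ^ 2 := by
  have := (lp.memℓp a).summable (by norm_num)
  simpa using this

/-- The analysis operator `g ↦ (⟪eᵢ, g⟫)ᵢ` of a Bessel family. -/
theorem exists_analysis_operator (e : ι → H) {C : ℝ}
    (hC : ∀ g (F : Finset ι), ∑ i ∈ F, ‖inner ℂ (e i) g‖ ^ 2 ≤ C * ‖g‖ ^ 2) :
    ∃ S : H →L[ℂ] lp (fun _ : ι => ℂ) 2, ∀ g i, S g i = inner ℂ (e i) g := by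
  have hsum : ∀ g, Summable fun i => ‖inner ℂ (e i) g‖ ^ 2 := fun g =>
    summable_of_sum_le (fun i => by positivity) (hC g)
  let L : H →ₗ[ℂ] lp (fun _ : ι => ℂ) 2 :=
    { toFun := fun g => ⟨fun i => inner ℂ (e i) g, memℓp_two_of_summable (hsum g)⟩
      map_add' := fun g g' => by
        ext i
        exact inner_add_right _ _ _
      map_smul' := fun c g => by
        ext i
        exact inner_smul_right _ _ _ }
  refine ⟨L.mkContinuous (√C) fun g => ?_, fun g i => rfl⟩
  have hC0 : 0 ≤ C ∨ ‖g‖ = 0 := by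
    by_contra! h
    have := hC g ∅
    simp only [Finset.sum_empty] at this
    have h2 : 0 < ‖g‖ ^ 2 := pow_pos (lt_of_le_of_ne (norm_nonneg g) h.2.symm) 2
    nlinarith [h.1]
  have h1 : ‖L g‖ ^ 2 ≤ C * ‖g‖ ^ 2 := by
    have := lp.norm_rpow_eq_tsum (p := 2) (by norm_num) (L g)
    simp only [ENNReal.toReal_ofNat, Real.rpow_ofNat] at this
    rw [this]
    exact (hsum g).tsum_le_of_sum_le (hC g)
  rcases hC0 with h | h
  · rw [← Real.sqrt_sq (norm_nonneg g), ← Real.sqrt_mul h]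
    exact Real.le_sqrt_of_sq_le h1
  · rw [h] at h1 ⊢
    nlinarith [norm_nonneg (L g)]

variable [CompleteSpace H]

open Classical in
/-- The adjoint of the analysis operator is the synthesis operator `a ↦ ∑ᵢ aᵢ eᵢ`. -/
theorem hasSum_adjoint_analysis {e : ι → H} {S : H →L[ℂ] lp (fun _ : ι => ℂ) 2}
    (hS : ∀ g i, S g i = inner ℂ (e i) g) (a : lp (fun _ : ι => ℂ) 2) :
    HasSum (fun i => a i • e i) (ContinuousLinearMap.adjoint S a) := by
  have h := (lp.hasSum_single (p := 2) (by norm_num) a).mapL (ContinuousLinearMap.adjoint S)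
  convert h using 2 with i
  refine ext_inner_right ℂ fun v => ?_
  rw [ContinuousLinearMap.adjoint_inner_left, lp.inner_single_left, hS, inner_smul_left]
  simp [mul_comm]

/-- Interpolation in a Hilbert space. If `S` has a bounded right inverse `R` and `Q` is coercive on
`ker S`, then the data `α` have a solution `I α` of `S (I α) = α` with `Q (I α) ⟂ ker S`, depending
linearly and continuously on `α`; that `Q (I α)` lies in the range of `S†` then follows from the
existence of `R`. -/
theorem exists_interpolation_operator {K : Type*} [NormedAddCommGroup K] [InnerProductSpace ℂ K]
    [CompleteSpace K] (S : H →L[ℂ] K) (R : K →L[ℂ] H) (Q : H →L[ℂ] H) (hSR : ∀ α, S (R α) = α)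
    {c : ℝ} (hc : 0 < c) (hQ : ∀ v, S v = 0 → c * ‖v‖ ^ 2 ≤ ‖inner ℂ (Q v) v‖) :
    ∃ I : K →L[ℂ] H, (∀ α, S (I α) = α) ∧
      ∀ α, ∃ b, Q (I α) = ContinuousLinearMap.adjoint S b := by
  let N : Submodule ℂ H := LinearMap.ker (S : H →ₗ[ℂ] K)
  have hN : IsClosed (N : Set H) := S.isClosed_ker
  have : CompleteSpace N := hN.completeSpace_coe
  have hmem : ∀ v : N, S v = 0 := fun v => v.2
  let j : N →L[ℂ] H := N.subtypeL
  let T : N →L[ℂ] N := ContinuousLinearMap.adjoint j ∘L Q ∘L j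
  have hT : IsUnit T := by
    refine ContinuousLinearMap.isUnit_of_forall_le_norm_inner_map T (c := c.toNNReal)
      (by simpa using hc) fun v => ?_
    have h := hQ v (hmem v)
    rw [Real.coe_toNNReal _ hc.le, mul_comm]
    have h2 : inner ℂ (T v) v = inner ℂ (Q (v : H)) (v : H) := by
      simp only [T, ContinuousLinearMap.comp_apply, ContinuousLinearMap.adjoint_inner_left]
      rfl
    rw [h2]
    exact h
  obtain ⟨U, hU⟩ := hT
  let I : K →L[ℂ] H := R - j ∘L (↑U⁻¹ : N →L[ℂ] N) ∘L ContinuousLinearMap.adjoint j ∘L Q ∘L R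
  have hI : ∀ α, I α = R α - j ((↑U⁻¹ : N →L[ℂ] N) (ContinuousLinearMap.adjoint j (Q (R α)))) :=
    fun α => rfl
  have hperp : ∀ α, ∀ v : H, S v = 0 → inner ℂ (Q (I α)) v = 0 := by
    intro α v hv
    have h1 : ContinuousLinearMap.adjoint j (Q (I α)) = 0 := by
      rw [hI, map_sub, map_sub, sub_eq_zero]
      have h2 : ∀ y : N, T ((↑U⁻¹ : N →L[ℂ] N) y) = y := fun y => by
        rw [← hU]
        change ((↑U : N →L[ℂ] N) * (↑U⁻¹ : N →L[ℂ] N)) y = y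
        rw [Units.mul_inv]
        rfl
      exact (h2 _).symm
    have h3 := ContinuousLinearMap.adjoint_inner_left j (⟨v, hv⟩ : N) (Q (I α))
    rw [h1, inner_zero_left] at h3
    exact h3.symm
  have hSI : ∀ α, S (I α) = α := fun α => by
    rw [hI, map_sub, hSR]
    simp only [j, Submodule.subtypeL_apply, hmem, sub_zero]
  refine ⟨I, hSI, fun α => ⟨ContinuousLinearMap.adjoint R (Q (I α)), ?_⟩⟩
  refine ext_inner_right ℂ fun v => ?_
  rw [ContinuousLinearMap.adjoint_inner_left, ContinuousLinearMap.adjoint_inner_left]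
  have h := hperp α (v - R (S v)) (by rw [map_sub, hSR, sub_self])
  rwa [inner_sub_right, sub_eq_zero] at h

end Hilbert

/-! ### The Fourier transform on `L¹ ∩ L²` -/

section FourierL2

variable {E : Type*} [NormedAddCommGroup E] [InnerProductSpace ℝ E] [FiniteDimensional ℝ E]
  [MeasurableSpace E] [BorelSpace E]

theorem continuous_fourierInv {Φ : E → ℂ} (h : Integrable Φ) : Continuous (𝓕⁻ Φ) :=
  VectorFourier.fourierIntegral_continuous (e := Real.fourierChar) (L := -innerₗ E)
    Real.continuous_fourierChar (by
      have : Continuous fun p : E × E => -(⟪p.1, p.2⟫ : ℝ) := by fun_prop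
      exact this) h

theorem integral_fourierInv_mul {f g : E → ℂ} (hf : Integrable f) (hg : Integrable g) :
    ∫ ξ, 𝓕⁻ f ξ * g ξ = ∫ x, f x * 𝓕⁻ g x := by
  have h := VectorFourier.integral_fourierIntegral_smul_eq_flip (e := Real.fourierChar)
    (L := -innerₗ E) (μ := volume) (ν := volume) Real.continuous_fourierChar (by
      have : Continuous fun p : E × E => -(⟪p.1, p.2⟫ : ℝ) := by fun_prop
      exact this) hf hg
  have hflip : (-innerₗ E).flip = -innerₗ E := by
    ext x y
    simp [real_inner_comm]
  rw [hflip] at h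
  exact h

theorem integral_schwartz_mul_fourier (ψ : 𝓢(E, ℂ)) (u : Lp ℂ 2 (volume : Measure E)) :
    ∫ x, ψ x * (𝓕 u : Lp ℂ 2 (volume : Measure E)) x = ∫ x, (𝓕 ψ) x * u x := by
  have h := DFunLike.congr_fun (Lp.fourier_toTemperedDistribution_eq u) ψ
  simpa [TemperedDistribution.fourier_apply, Lp.toTemperedDistribution_apply] using h.symm

theorem integral_schwartz_mul_fourierInv (ψ : 𝓢(E, ℂ)) (u : Lp ℂ 2 (volume : Measure E)) :
    ∫ x, ψ x * (𝓕⁻ u : Lp ℂ 2 (volume : Measure E)) x = ∫ x, (𝓕⁻ ψ) x * u x := by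
  have h := DFunLike.congr_fun (Lp.fourierInv_toTemperedDistribution_eq u) ψ
  simpa [TemperedDistribution.fourierInv_apply, Lp.toTemperedDistribution_apply] using h.symm

theorem ae_eq_of_integral_schwartz_mul_eq {f f' : E → ℂ} (hf : LocallyIntegrable f)
    (hf' : LocallyIntegrable f') (h : ∀ ψ : 𝓢(E, ℂ), ∫ x, ψ x * f x = ∫ x, ψ x * f' x) :
    f =ᵐ[volume] f' := by
  refine ae_eq_of_integral_contDiff_smul_eq hf hf' fun g hg hc => ?_
  have hc' : HasCompactSupport fun x => (g x : ℂ) := hc.comp_left (g := ((↑) : ℝ → ℂ)) rfl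
  have := h (hc'.toSchwartzMap (Complex.ofRealCLM.contDiff.comp hg))
  simp only [Complex.real_smul]
  exact this

/-- On `L¹ ∩ L²` the inverse Fourier transform of `L²` is given by the integral. -/
theorem fourierInv_toLp_ae_eq {Φ : E → ℂ} (h1 : Integrable Φ) (h2 : MemLp Φ 2) :
    (𝓕⁻ (h2.toLp Φ) : Lp ℂ 2 (volume : Measure E)) =ᵐ[volume] 𝓕⁻ Φ := by
  refine ae_eq_of_integral_schwartz_mul_eq ?_ (continuous_fourierInv h1).locallyIntegrable
    fun ψ => ?_
  · exact (Lp.memLp _).locallyIntegrable (by norm_num)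
  · rw [integral_schwartz_mul_fourierInv, SchwartzMap.fourierInv_coe]
    rw [← integral_fourierInv_mul ψ.integrable h1]
    refine integral_congr_ae ?_
    filter_upwards [h2.coeFn_toLp] with x hx
    rw [hx]

theorem memLp_fourierInv {Φ : E → ℂ} (h1 : Integrable Φ) (h2 : MemLp Φ 2) :
    MemLp (𝓕⁻ Φ) 2 :=
  (memLp_congr_ae (fourierInv_toLp_ae_eq h1 h2)).1 (Lp.memLp _)

/-- Plancherel's theorem on `L¹ ∩ L²`. -/
theorem eLpNorm_fourierInv {Φ : E → ℂ} (h1 : Integrable Φ) (h2 : MemLp Φ 2) :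
    eLpNorm (𝓕⁻ Φ) 2 volume = eLpNorm Φ 2 volume := by
  rw [← eLpNorm_congr_ae (fourierInv_toLp_ae_eq h1 h2), ← eLpNorm_congr_ae h2.coeFn_toLp]
  have h : ‖(𝓕⁻ (h2.toLp Φ) : Lp ℂ 2 (volume : Measure E))‖ = ‖h2.toLp Φ‖ := by
    rw [← Lp.norm_fourier_eq, FourierTransform.fourier_fourierInv_eq]
  rw [Lp.norm_def, Lp.norm_def] at h
  exact (ENNReal.toReal_eq_toReal_iff' (Lp.eLpNorm_ne_top _) (Lp.eLpNorm_ne_top _)).1 h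

theorem lintegral_enorm_sq_eq {f : E → ℂ} : ∫⁻ x, ‖f x‖ₑ ^ 2 = eLpNorm f 2 volume ^ 2 := by
  rw [eLpNorm_eq_lintegral_rpow_enorm_toReal (by norm_num) (by norm_num)]
  simp only [ENNReal.toReal_ofNat, ENNReal.rpow_ofNat]
  rw [← ENNReal.rpow_natCast, ← ENNReal.rpow_mul]
  norm_num

theorem lintegral_enorm_sq_fourierInv {Φ : E → ℂ} (h1 : Integrable Φ) (h2 : MemLp Φ 2) :
    ∫⁻ x, ‖𝓕⁻ Φ x‖ₑ ^ 2 = ∫⁻ x, ‖Φ x‖ₑ ^ 2 := by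
  rw [lintegral_enorm_sq_eq, lintegral_enorm_sq_eq, eLpNorm_fourierInv h1 h2]

theorem ofReal_integral_norm_sq {f : E → ℂ} (hf : MemLp f 2) :
    ENNReal.ofReal (∫ x, ‖f x‖ ^ 2) = ∫⁻ x, ‖f x‖ₑ ^ 2 := by
  rw [ofReal_integral_eq_lintegral_ofReal]
  · simp only [ENNReal.ofReal_pow (norm_nonneg _), ofReal_norm]
  · exact (memLp_two_iff_integrable_sq_norm hf.1).1 hf
  · exact Eventually.of_forall fun x => by positivity

end FourierL2

/-! ### The symbol of `D` -/

section Symbol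

variable {E : Type*} [NormedAddCommGroup E]

/-- The symbol `|2πξ|² + ε` of the operator `D`, in the frequency variable of Mathlib's Fourier
transform. The symbol with `ε = 1` serves as the Sobolev weight. -/
noncomputable def symbol (ε : ℝ) (ξ : E) : ℝ := (2 * Real.pi * ‖ξ‖) ^ 2 + ε

theorem one_le_symbol_one (ξ : E) : 1 ≤ symbol 1 ξ := by
  unfold symbol
  nlinarith [sq_nonneg (2 * Real.pi * ‖ξ‖)]

theorem symbol_one_pos (ξ : E) : 0 < symbol 1 ξ := zero_lt_one.trans_le (one_le_symbol_one ξ)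

theorem symbol_nonneg {ε : ℝ} (hε : 0 ≤ ε) (ξ : E) : 0 ≤ symbol ε ξ := by
  unfold symbol
  positivity

@[fun_prop]
theorem continuous_symbol (ε : ℝ) : Continuous (symbol ε : E → ℝ) := by
  unfold symbol
  fun_prop

/-- Peetre's inequality. -/
theorem symbol_one_le_mul (ξ η : E) : symbol 1 ξ ≤ 2 * symbol 1 (ξ - η) * symbol 1 η := by
  unfold symbol
  have h : ‖ξ‖ ≤ ‖ξ - η‖ + ‖η‖ := by simpa using norm_add_le (ξ - η) η
  have h2 : (2 * Real.pi * ‖ξ‖) ^ 2 ≤ (2 * Real.pi * ‖ξ - η‖ + 2 * Real.pi * ‖η‖) ^ 2 := by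
    have : 2 * Real.pi * ‖ξ‖ ≤ 2 * Real.pi * ‖ξ - η‖ + 2 * Real.pi * ‖η‖ := by
      rw [← mul_add]
      gcongr
    gcongr
  set x := 2 * Real.pi * ‖ξ - η‖
  set y := 2 * Real.pi * ‖η‖
  nlinarith [sq_nonneg (x - y), sq_nonneg (x * y)]

theorem symbol_one_neg (ξ : E) : symbol 1 (-ξ) = symbol 1 ξ := by simp [symbol]

theorem symbol_one_sub_le_mul (ξ η : E) : symbol 1 (ξ - η) ≤ 2 * symbol 1 ξ * symbol 1 η := by
  have := symbol_one_le_mul (ξ - η) (-η)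
  simpa [symbol_one_neg] using this

theorem symbol_one_le_of_norm_le_one {η : E} (hη : ‖η‖ ≤ 1) :
    symbol 1 η ≤ (2 * Real.pi) ^ 2 + 1 := by
  unfold symbol
  have := norm_nonneg η
  have : (2 * Real.pi * ‖η‖) ^ 2 ≤ (2 * Real.pi * 1) ^ 2 := by gcongr
  linarith

end Symbol

/-! ### The oscillation multiplier -/

section LocalSobolev

variable {E : Type*} [NormedAddCommGroup E] [InnerProductSpace ℝ E] [FiniteDimensional ℝ E]
  [MeasurableSpace E] [BorelSpace E]

theorem integrable_symbol_one_pow_inv {s : ℕ} (hs : Module.finrank ℝ E < 2 * s) :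
    Integrable fun ξ : E => (symbol 1 ξ ^ s)⁻¹ := by
  have h := integrable_rpow_neg_one_add_norm_sq (E := E) (μ := volume) (r := 2 * s)
    (by exact_mod_cast hs)
  refine h.mono' ?_ (Eventually.of_forall fun ξ => ?_)
  · refine (Continuous.inv₀ (by fun_prop) fun ξ => ?_).aestronglyMeasurable
    exact (pow_pos (symbol_one_pos ξ) s).ne'
  · have h1 : (1 + ‖ξ‖ ^ 2) ^ (-(2 * s : ℝ) / 2) = ((1 + ‖ξ‖ ^ 2) ^ s)⁻¹ := by
      rw [neg_div, mul_div_cancel_left₀ _ (by norm_num : (2 : ℝ) ≠ 0),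
        Real.rpow_neg (by positivity),
        Real.rpow_natCast]
    rw [h1, Real.norm_of_nonneg (inv_nonneg.2 (pow_nonneg (symbol_one_pos ξ).le _))]
    refine inv_anti₀ (by positivity) (pow_le_pow_left₀ (by positivity) ?_ _)
    unfold symbol
    have : 1 ≤ 2 * Real.pi := by linarith [Real.pi_gt_three]
    have h2 : ‖ξ‖ ≤ 2 * Real.pi * ‖ξ‖ := le_mul_of_one_le_left (norm_nonneg _) this
    nlinarith [norm_nonneg ξ]

theorem exists_schwartz_le_symbol_pow_inv (X : 𝓢(E, ℂ)) (N : ℕ) :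
    ∃ C, 0 ≤ C ∧ ∀ ξ, ‖X ξ‖ ≤ C * (symbol 1 ξ ^ N)⁻¹ := by
  let C₀ := 2 ^ (2 * N) * (Finset.Iic (2 * N, 0)).sup (fun m => SchwartzMap.seminorm ℂ m.1 m.2) X
  refine ⟨((2 * Real.pi) ^ 2) ^ N * C₀, by positivity, fun ξ => ?_⟩
  have h := SchwartzMap.one_add_le_sup_seminorm_apply (𝕜 := ℂ) (m := (2 * N, 0)) le_rfl le_rfl X ξ
  rw [norm_iteratedFDeriv_zero] at h
  have hpos : 0 < symbol 1 ξ ^ N := pow_pos (symbol_one_pos ξ) N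
  rw [← div_eq_mul_inv, le_div_iff₀ hpos]
  have h1 : symbol 1 ξ ≤ (2 * Real.pi) ^ 2 * (1 + ‖ξ‖) ^ 2 := by
    unfold symbol
    have : 1 ≤ 2 * Real.pi := by linarith [Real.pi_gt_three]
    nlinarith [norm_nonneg ξ, mul_nonneg (sq_nonneg (2 * Real.pi)) (norm_nonneg ξ)]
  calc ‖X ξ‖ * symbol 1 ξ ^ N ≤ ‖X ξ‖ * ((2 * Real.pi) ^ 2 * (1 + ‖ξ‖) ^ 2) ^ N := by
        gcongr
        exact (symbol_one_pos ξ).le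
    _ = ((2 * Real.pi) ^ 2) ^ N * ((1 + ‖ξ‖) ^ (2 * N) * ‖X ξ‖) := by
        rw [mul_pow, ← pow_mul (1 + ‖ξ‖)]
        ring
    _ ≤ _ := by
        gcongr

/-- The multiplier by which `∫ sup_{|z| ≤ 1} |f(a + z) - f(a)|² da` is controlled in terms of
`|𝓕 f|²`. Here `X` is to be the Fourier transform of a cutoff function. -/
noncomputable def oscMultiplier (X : E → ℂ) (s : ℕ) (η : E) : ℝ≥0∞ :=
  ∫⁻ ζ, ENNReal.ofReal (symbol 1 ζ ^ s) * ‖X (ζ - η) - X ζ‖ₑ ^ 2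

theorem oscMultiplier_integrand_eq (X : E → ℂ) (s : ℕ) (η ζ : E) :
    ENNReal.ofReal (symbol 1 ζ ^ s) * ‖X (ζ - η) - X ζ‖ₑ ^ 2 =
      ENNReal.ofReal (symbol 1 ζ ^ s * ‖X (ζ - η) - X ζ‖ ^ 2) := by
  rw [ENNReal.ofReal_mul (pow_nonneg (symbol_one_pos ζ).le s), ENNReal.ofReal_pow (norm_nonneg _),
    ofReal_norm]

theorem exists_symbol_mul_schwartz_sq_le (X : 𝓢(E, ℂ)) (s : ℕ) :
    ∃ C, 0 ≤ C ∧ ∀ ξ, symbol 1 ξ ^ s * ‖X ξ‖ ^ 2 ≤ C * (symbol 1 ξ ^ s)⁻¹ := by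
  obtain ⟨C, hC, h⟩ := exists_schwartz_le_symbol_pow_inv X s
  refine ⟨C ^ 2, by positivity, fun ξ => ?_⟩
  have hpos : 0 < symbol 1 ξ ^ s := pow_pos (symbol_one_pos ξ) s
  calc symbol 1 ξ ^ s * ‖X ξ‖ ^ 2 ≤ symbol 1 ξ ^ s * (C * (symbol 1 ξ ^ s)⁻¹) ^ 2 := by
        gcongr
        exact h ξ
    _ = C ^ 2 * (symbol 1 ξ ^ s)⁻¹ := by
        field_simp

theorem oscMultiplier_integrand_le {X : 𝓢(E, ℂ)} {s : ℕ} {C : ℝ}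
    (h : ∀ ξ, symbol 1 ξ ^ s * ‖X ξ‖ ^ 2 ≤ C * (symbol 1 ξ ^ s)⁻¹) (η ζ : E) :
    symbol 1 ζ ^ s * ‖X (ζ - η) - X ζ‖ ^ 2 ≤ 2 * (2 ^ s * symbol 1 η ^ s) * C *
      ((symbol 1 (ζ - η) ^ s)⁻¹ + (symbol 1 ζ ^ s)⁻¹) := by
  have hp := fun ξ : E => pow_pos (symbol_one_pos ξ) s
  have h1 : symbol 1 ζ ^ s ≤ 2 ^ s * symbol 1 (ζ - η) ^ s * symbol 1 η ^ s := by
    rw [← mul_pow, ← mul_pow]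
    exact pow_le_pow_left₀ (symbol_one_pos ζ).le (symbol_one_le_mul ζ η) s
  have h2 : ‖X (ζ - η) - X ζ‖ ^ 2 ≤ 2 * ‖X (ζ - η)‖ ^ 2 + 2 * ‖X ζ‖ ^ 2 := by
    have := norm_sub_le (X (ζ - η)) (X ζ)
    have h3 : ‖X (ζ - η) - X ζ‖ ^ 2 ≤ (‖X (ζ - η)‖ + ‖X ζ‖) ^ 2 := by gcongr
    nlinarith [sq_nonneg (‖X (ζ - η)‖ - ‖X ζ‖)]
  have h4 : 1 ≤ 2 ^ s * symbol 1 η ^ s :=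
    one_le_mul_of_one_le_of_one_le (one_le_pow₀ (by norm_num)) (one_le_pow₀ (one_le_symbol_one η))
  calc symbol 1 ζ ^ s * ‖X (ζ - η) - X ζ‖ ^ 2
      ≤ symbol 1 ζ ^ s * (2 * ‖X (ζ - η)‖ ^ 2 + 2 * ‖X ζ‖ ^ 2) := by
        gcongr
        exact (hp ζ).le
    _ = 2 * (symbol 1 ζ ^ s * ‖X (ζ - η)‖ ^ 2) + 2 * (1 * (symbol 1 ζ ^ s * ‖X ζ‖ ^ 2)) := by ring
    _ ≤ 2 * ((2 ^ s * symbol 1 (ζ - η) ^ s * symbol 1 η ^ s) * ‖X (ζ - η)‖ ^ 2) +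
        2 * ((2 ^ s * symbol 1 η ^ s) * (symbol 1 ζ ^ s * ‖X ζ‖ ^ 2)) := by
        have := hp ζ
        gcongr
    _ = 2 * (2 ^ s * symbol 1 η ^ s) *
          (symbol 1 (ζ - η) ^ s * ‖X (ζ - η)‖ ^ 2 + symbol 1 ζ ^ s * ‖X ζ‖ ^ 2) := by ring
    _ ≤ 2 * (2 ^ s * symbol 1 η ^ s) *
          (C * (symbol 1 (ζ - η) ^ s)⁻¹ + C * (symbol 1 ζ ^ s)⁻¹) := by
        have := hp η
        exact mul_le_mul_of_nonneg_left (add_le_add (h _) (h _)) (by positivity)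
    _ = _ := by ring

/-- The oscillation multiplier grows at most like `|η|^(2s)`. -/
theorem exists_oscMultiplier_le (X : 𝓢(E, ℂ)) {s : ℕ} (hs : Module.finrank ℝ E < 2 * s) :
    ∃ C, 0 ≤ C ∧ ∀ η, oscMultiplier X s η ≤ ENNReal.ofReal (C * symbol 1 η ^ s) := by
  obtain ⟨C, hC, h⟩ := exists_symbol_mul_schwartz_sq_le X s
  have hi := integrable_symbol_one_pow_inv hs
  have hp := fun ξ : E => pow_pos (symbol_one_pos ξ) s
  let J := ∫ ξ : E, (symbol 1 ξ ^ s)⁻¹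
  have hJ : 0 ≤ J := integral_nonneg fun ξ => (inv_pos.2 (hp ξ)).le
  refine ⟨2 * 2 ^ s * C * (J + J), by positivity, fun η => ?_⟩
  have h1 : Integrable fun ζ : E => 2 * (2 ^ s * symbol 1 η ^ s) * C *
      ((symbol 1 (ζ - η) ^ s)⁻¹ + (symbol 1 ζ ^ s)⁻¹) :=
    ((hi.comp_sub_right η).add hi).const_mul _
  have h2 : ∫ ζ : E, 2 * (2 ^ s * symbol 1 η ^ s) * C *
      ((symbol 1 (ζ - η) ^ s)⁻¹ + (symbol 1 ζ ^ s)⁻¹) =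
      2 * 2 ^ s * C * (J + J) * symbol 1 η ^ s := by
    rw [integral_const_mul, integral_add (hi.comp_sub_right η) hi,
      integral_sub_right_eq_self (fun ζ : E => (symbol 1 ζ ^ s)⁻¹)]
    ring
  rw [← h2, ofReal_integral_eq_lintegral_ofReal h1]
  · refine lintegral_mono fun ζ => ?_
    rw [oscMultiplier_integrand_eq]
    exact ENNReal.ofReal_le_ofReal (oscMultiplier_integrand_le h η ζ)
  · refine Eventually.of_forall fun ζ => ?_
    have := hp η
    have := hp ζ
    have := hp (ζ - η)
    positivity

/-- The oscillation multiplier is small at low frequencies: slowly varying functions oscillate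
little on unit balls. -/
theorem tendsto_oscMultiplier (X : 𝓢(E, ℂ)) {s : ℕ} (hs : Module.finrank ℝ E < 2 * s) :
    Tendsto (oscMultiplier X s) (𝓝 0) (𝓝 0) := by
  obtain ⟨C, hC, h⟩ := exists_symbol_mul_schwartz_sq_le X s
  have hi := integrable_symbol_one_pow_inv hs
  have hp := fun ξ : E => pow_pos (symbol_one_pos ξ) s
  let B : ℝ := (2 * Real.pi) ^ 2 + 1
  have hB : ∀ η : E, ‖η‖ ≤ 1 → symbol 1 η ≤ B := fun η hη => symbol_one_le_of_norm_le_one hη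
  let F : E → ℝ := fun ζ => 2 * (2 ^ s * B ^ s) * C * ((2 ^ s * B ^ s) + 1) * (symbol 1 ζ ^ s)⁻¹
  have hF : ∀ η : E, ‖η‖ ≤ 1 → ∀ ζ, symbol 1 ζ ^ s * ‖X (ζ - η) - X ζ‖ ^ 2 ≤ F ζ := by
    intro η hη ζ
    refine (oscMultiplier_integrand_le h η ζ).trans ?_
    have h1 : symbol 1 η ^ s ≤ B ^ s := pow_le_pow_left₀ (symbol_one_pos η).le (hB η hη) s
    have h2 : (symbol 1 (ζ - η) ^ s)⁻¹ ≤ (2 ^ s * B ^ s) * (symbol 1 ζ ^ s)⁻¹ := by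
      rw [← div_eq_mul_inv, le_div_iff₀ (hp ζ), inv_mul_le_iff₀ (hp _)]
      calc symbol 1 ζ ^ s ≤ (2 * symbol 1 (ζ - η) * symbol 1 η) ^ s :=
            pow_le_pow_left₀ (symbol_one_pos ζ).le (symbol_one_le_mul ζ η) s
        _ = symbol 1 (ζ - η) ^ s * (2 ^ s * symbol 1 η ^ s) := by ring
        _ ≤ _ := by
            have := hp (ζ - η)
            gcongr
    have := hp η
    have := hp ζ
    calc _ ≤ 2 * (2 ^ s * B ^ s) * C *
        ((2 ^ s * B ^ s) * (symbol 1 ζ ^ s)⁻¹ + (symbol 1 ζ ^ s)⁻¹) := by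
          have : 0 ≤ (symbol 1 (ζ - η) ^ s)⁻¹ := (inv_pos.2 (hp _)).le
          gcongr
      _ = F ζ := by simp only [F]; ring
  have hX := X.continuous
  have key := tendsto_lintegral_filter_of_dominated_convergence (μ := (volume : Measure E))
    (l := 𝓝 (0 : E)) (F := fun η ζ => ENNReal.ofReal (symbol 1 ζ ^ s * ‖X (ζ - η) - X ζ‖ ^ 2))
    (f := fun _ => 0) (fun ζ => ENNReal.ofReal (F ζ)) ?_ ?_ ?_ ?_
  · simp only [lintegral_zero] at key
    refine key.congr fun η => ?_
    exact lintegral_congr fun ζ => (oscMultiplier_integrand_eq X s η ζ).symm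
  · refine Eventually.of_forall fun η => ?_
    refine (Continuous.measurable ?_).ennreal_ofReal
    fun_prop
  · filter_upwards [Metric.closedBall_mem_nhds (0 : E) one_pos] with η hη
    exact Eventually.of_forall fun ζ =>
      ENNReal.ofReal_le_ofReal (hF η (by simpa using hη) ζ)
  · exact (hi.const_mul _).lintegral_lt_top.ne
  · refine Eventually.of_forall fun ζ => ?_
    have hc : Continuous fun η => ENNReal.ofReal (symbol 1 ζ ^ s * ‖X (ζ - η) - X ζ‖ ^ 2) :=
      ENNReal.continuous_ofReal.comp (by fun_prop)
    have := hc.tendsto 0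
    simpa using this

end LocalSobolev

/-! ### Local oscillation of Sobolev functions -/

section Oscillation

variable {E : Type*} [NormedAddCommGroup E] [InnerProductSpace ℝ E] [FiniteDimensional ℝ E]
  [MeasurableSpace E] [BorelSpace E]

variable (E) in
/-- A Schwartz function whose inverse Fourier transform is `1` on the unit ball. -/
theorem exists_schwartz_fourierInv_eq_one :
    ∃ X : 𝓢(E, ℂ), ∀ z, ‖z‖ ≤ 1 → 𝓕⁻ (X : E → ℂ) z = 1 := by
  let b : ContDiffBump (0 : E) := ⟨1, 2, one_pos, one_lt_two⟩
  have hc : HasCompactSupport fun x => (b x : ℂ) :=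
    b.hasCompactSupport.comp_left (g := ((↑) : ℝ → ℂ)) rfl
  let χ : 𝓢(E, ℂ) := hc.toSchwartzMap (Complex.ofRealCLM.contDiff.comp b.contDiff)
  refine ⟨𝓕 χ, fun z hz => ?_⟩
  rw [← SchwartzMap.fourierInv_coe, FourierTransform.fourierInv_fourier_eq]
  have : b z = 1 := b.one_of_mem_closedBall (by simpa using hz)
  change (b z : ℂ) = 1
  rw [this, Complex.ofReal_one]

/-- The oscillation of `𝓕⁻ Φ` on unit balls around `a` is, by Fourier inversion, the inverse
Fourier transform of a function of `ζ` which is itself an inverse Fourier transform taken at `a`. -/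
theorem fourierInv_add_sub_fourierInv {X : 𝓢(E, ℂ)} (hX : ∀ z, ‖z‖ ≤ 1 → 𝓕⁻ (X : E → ℂ) z = 1)
    {Φ : E → ℂ} (h1 : Integrable Φ) (a z : E) (hz : ‖z‖ ≤ 1) :
    𝓕⁻ Φ (a + z) - 𝓕⁻ Φ a = 𝓕⁻ (fun ζ => 𝓕⁻ (fun η => Φ η * (X (ζ - η) - X ζ)) a) z := by
  have hXi : Integrable X := X.integrable
  have e1 : ∀ v w : E, ‖Complex.exp (((2 * Real.pi * ⟪v, w⟫ : ℝ) : ℂ) * Complex.I)‖ = 1 :=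
    fun v w => Complex.norm_exp_ofReal_mul_I _
  have hint : Integrable (Function.uncurry fun ζ η => Φ η * (X (ζ - η) - X ζ))
      ((volume : Measure E).prod volume) := by
    have i1 : Integrable (fun p : E × E => Φ p.2 * X (p.1 - p.2)) (volume.prod volume) :=
      h1.convolution_integrand (ContinuousLinearMap.mul ℝ ℂ) hXi
    have i2 : Integrable (fun p : E × E => X p.1 * Φ p.2) (volume.prod volume) := hXi.mul_prod h1
    refine (i1.sub i2).congr (Eventually.of_forall fun p => ?_)
    simp only [Function.uncurry, Pi.sub_apply]
    ring
  have hint2 : Integrable (Function.uncurry fun ζ η =>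
      Complex.exp (((2 * Real.pi * ⟪ζ, z⟫ : ℝ) : ℂ) * Complex.I) *
        (Complex.exp (((2 * Real.pi * ⟪η, a⟫ : ℝ) : ℂ) * Complex.I) *
          (Φ η * (X (ζ - η) - X ζ)))) ((volume : Measure E).prod volume) := by
    refine hint.mono ?_ (Eventually.of_forall fun p => ?_)
    · refine AEStronglyMeasurable.mul ?_ (AEStronglyMeasurable.mul ?_ hint.1)
      · exact Continuous.aestronglyMeasurable (by fun_prop)
      · exact Continuous.aestronglyMeasurable (by fun_prop)
    · simp only [Function.uncurry, norm_mul, e1, one_mul, le_refl]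
  have hXz : ∀ η, ∫ ζ, Complex.exp (((2 * Real.pi * ⟪ζ, z⟫ : ℝ) : ℂ) * Complex.I) *
      (X (ζ - η) - X ζ) = Complex.exp (((2 * Real.pi * ⟪η, z⟫ : ℝ) : ℂ) * Complex.I) - 1 := by
    intro η
    have hz1 := hX z hz
    rw [Real.fourierInv_eq'] at hz1
    simp only [smul_eq_mul] at hz1
    have i0 : Integrable fun ζ =>
        Complex.exp (((2 * Real.pi * ⟪ζ, z⟫ : ℝ) : ℂ) * Complex.I) * X ζ := by
      refine hXi.mono (AEStronglyMeasurable.mul (Continuous.aestronglyMeasurable (by fun_prop))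
        hXi.1) (Eventually.of_forall fun p => ?_)
      rw [norm_mul, e1, one_mul]
    have i1 : Integrable fun ζ =>
        Complex.exp (((2 * Real.pi * ⟪ζ, z⟫ : ℝ) : ℂ) * Complex.I) * X (ζ - η) := by
      refine (hXi.comp_sub_right η).mono (AEStronglyMeasurable.mul
        (Continuous.aestronglyMeasurable (by fun_prop)) (hXi.comp_sub_right η).1)
        (Eventually.of_forall fun p => ?_)
      rw [norm_mul, e1, one_mul]
    simp only [mul_sub]
    rw [integral_sub i1 i0, hz1]
    congr 1
    rw [← integral_add_right_eq_self _ η]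
    calc _ = ∫ ζ, Complex.exp (((2 * Real.pi * ⟪η, z⟫ : ℝ) : ℂ) * Complex.I) *
        (Complex.exp (((2 * Real.pi * ⟪ζ, z⟫ : ℝ) : ℂ) * Complex.I) * X ζ) := by
          refine integral_congr_ae (Eventually.of_forall fun ζ => ?_)
          simp only [add_sub_cancel_right, inner_add_left]
          rw [← mul_assoc, ← Complex.exp_add]
          congr 2
          push_cast
          ring
      _ = _ := by rw [integral_const_mul, hz1, mul_one]
  have e0 : ∀ w, Integrable fun η => Complex.exp (((2 * Real.pi * ⟪η, w⟫ : ℝ) : ℂ) * Complex.I) *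
      Φ η := fun w => by
    refine h1.mono (AEStronglyMeasurable.mul (Continuous.aestronglyMeasurable (by fun_prop))
      h1.1) (Eventually.of_forall fun p => ?_)
    rw [norm_mul, e1, one_mul]
  rw [Real.fourierInv_eq', Real.fourierInv_eq', Real.fourierInv_eq']
  simp only [Real.fourierInv_eq', smul_eq_mul]
  rw [← integral_sub (e0 _) (e0 _)]
  calc _ = ∫ η, Complex.exp (((2 * Real.pi * ⟪η, a⟫ : ℝ) : ℂ) * Complex.I) * Φ η *
        ∫ ζ, Complex.exp (((2 * Real.pi * ⟪ζ, z⟫ : ℝ) : ℂ) * Complex.I) * (X (ζ - η) - X ζ) := by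
        refine integral_congr_ae (Eventually.of_forall fun η => ?_)
        simp only [hXz, inner_add_right]
        rw [mul_add, Complex.ofReal_add, add_mul, Complex.exp_add]
        ring
    _ = ∫ η, ∫ ζ, Complex.exp (((2 * Real.pi * ⟪ζ, z⟫ : ℝ) : ℂ) * Complex.I) *
        (Complex.exp (((2 * Real.pi * ⟪η, a⟫ : ℝ) : ℂ) * Complex.I) *
          (Φ η * (X (ζ - η) - X ζ))) := by
        refine integral_congr_ae (Eventually.of_forall fun η => ?_)
        simp only
        rw [← integral_const_mul]
        refine integral_congr_ae (Eventually.of_forall fun ζ => ?_)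
        ring
    _ = ∫ ζ, ∫ η, Complex.exp (((2 * Real.pi * ⟪ζ, z⟫ : ℝ) : ℂ) * Complex.I) *
        (Complex.exp (((2 * Real.pi * ⟪η, a⟫ : ℝ) : ℂ) * Complex.I) *
          (Φ η * (X (ζ - η) - X ζ))) := (integral_integral_swap hint2).symm
    _ = _ := by
        simp only [integral_const_mul]

/-- Cauchy-Schwarz with the Sobolev weight. -/
theorem enorm_fourierInv_sq_le {s : ℕ} {G : E → ℂ} (hG : AEMeasurable G) (z : E) :
    ‖𝓕⁻ G z‖ₑ ^ 2 ≤ (∫⁻ ξ : E, ENNReal.ofReal ((symbol 1 ξ ^ s)⁻¹)) *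
      ∫⁻ ξ, ENNReal.ofReal (symbol 1 ξ ^ s) * ‖G ξ‖ₑ ^ 2 := by
  have hp := fun ξ : E => pow_pos (symbol_one_pos ξ) s
  have h1 : ‖𝓕⁻ G z‖ₑ ≤ ∫⁻ ξ, ‖G ξ‖ₑ := by
    rw [Real.fourierInv_eq]
    refine (enorm_integral_le_lintegral_enorm _).trans_eq (lintegral_congr fun ξ => ?_)
    rw [← ofReal_norm, ← ofReal_norm, Circle.norm_smul]
  let f : E → ℝ≥0∞ := fun ξ => ENNReal.ofReal (√((symbol 1 ξ ^ s)⁻¹))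
  let g : E → ℝ≥0∞ := fun ξ => ENNReal.ofReal (√(symbol 1 ξ ^ s)) * ‖G ξ‖ₑ
  have hf : AEMeasurable f := by
    refine (Measurable.ennreal_ofReal ?_).aemeasurable
    exact ((continuous_symbol 1).measurable.pow_const s).inv.sqrt
  have hg : AEMeasurable g := by
    refine AEMeasurable.mul ?_ hG.enorm
    exact (Measurable.ennreal_ofReal ((continuous_symbol 1).measurable.pow_const s).sqrt).aemeasurable
  have h2 : ∫⁻ ξ, ‖G ξ‖ₑ = ∫⁻ ξ, (f * g) ξ := by
    refine lintegral_congr fun ξ => ?_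
    simp only [Pi.mul_apply, f, g]
    rw [← mul_assoc, ← ENNReal.ofReal_mul (Real.sqrt_nonneg _), ← Real.sqrt_mul
      (inv_nonneg.2 (hp ξ).le), inv_mul_cancel₀ (hp ξ).ne', Real.sqrt_one, ENNReal.ofReal_one,
      one_mul]
  have h3 := ENNReal.lintegral_mul_le_Lp_mul_Lq volume Real.HolderConjugate.two_two hf hg
  rw [h2] at h1
  have hsq : ∀ x : ℝ≥0∞, (x ^ (1 / (2 : ℝ))) ^ 2 = x := fun x => by
    rw [← ENNReal.rpow_natCast, ← ENNReal.rpow_mul]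
    norm_num
  have h4 := pow_le_pow_left₀ zero_le (h1.trans h3) 2
  rw [mul_pow, hsq, hsq] at h4
  refine h4.trans_eq ?_
  congr 1
  · refine lintegral_congr fun ξ => ?_
    simp only [f, ENNReal.rpow_ofNat]
    rw [← ENNReal.ofReal_pow (Real.sqrt_nonneg _), Real.sq_sqrt (inv_nonneg.2 (hp ξ).le)]
  · refine lintegral_congr fun ξ => ?_
    simp only [g, ENNReal.rpow_ofNat]
    rw [mul_pow, ← ENNReal.ofReal_pow (Real.sqrt_nonneg _), Real.sq_sqrt (hp ξ).le]

/-- The oscillation of `𝓕⁻ Φ` on unit balls is square integrable, with the weight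
`oscMultiplier`. -/
theorem exists_oscillation_bound {X : 𝓢(E, ℂ)} (hX : ∀ z, ‖z‖ ≤ 1 → 𝓕⁻ (X : E → ℂ) z = 1) (s : ℕ)
    {Φ : E → ℂ} (h1 : Integrable Φ) (h2 : MemLp Φ 2) :
    ∃ M : E → ℝ≥0∞, Measurable M ∧
      (∀ a z, ‖z‖ ≤ 1 → ‖𝓕⁻ Φ (a + z) - 𝓕⁻ Φ a‖ₑ ^ 2 ≤ M a) ∧
      ∫⁻ a, M a = (∫⁻ ξ : E, ENNReal.ofReal ((symbol 1 ξ ^ s)⁻¹)) *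
        ∫⁻ η, ‖Φ η‖ₑ ^ 2 * oscMultiplier X s η := by
  -- a strongly measurable representative of `Φ`, for joint measurability
  wlog hm : StronglyMeasurable Φ generalizing Φ
  · obtain ⟨Φ', hΦ', hae⟩ := h1.1
    obtain ⟨M, hM, hM1, hM2⟩ := this (h1.congr hae) ((memLp_congr_ae hae).1 h2) hΦ'
    refine ⟨M, hM, fun a z hz => ?_, ?_⟩
    · rw [Real.fourierInv_congr_ae hae, Real.fourierInv_congr_ae hae]
      exact hM1 a z hz
    · rw [hM2]
      congr 1
      refine lintegral_congr_ae ?_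
      filter_upwards [hae] with η hη
      rw [hη]
  have hXc := X.continuous
  let C := ∫⁻ ξ : E, ENNReal.ofReal ((symbol 1 ξ ^ s)⁻¹)
  let G : E → E → ℂ := fun a ζ => 𝓕⁻ (fun η => Φ η * (X (ζ - η) - X ζ)) a
  have hGm : StronglyMeasurable (Function.uncurry G) := by
    have : Function.uncurry G = fun p : E × E => ∫ η, Complex.exp
        (((2 * Real.pi * ⟪η, p.1⟫ : ℝ) : ℂ) * Complex.I) * (Φ η * (X (p.2 - η) - X p.2)) := by
      ext p
      simp only [Function.uncurry, G, Real.fourierInv_eq', smul_eq_mul]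
    rw [this]
    refine StronglyMeasurable.integral_prod_right' (f := fun q : (E × E) × E => Complex.exp
        (((2 * Real.pi * ⟪q.2, q.1.1⟫ : ℝ) : ℂ) * Complex.I) *
          (Φ q.2 * (X (q.1.2 - q.2) - X q.1.2))) ?_
    refine StronglyMeasurable.mul ?_ (StronglyMeasurable.mul (hm.comp_measurable measurable_snd) ?_)
    · exact Continuous.stronglyMeasurable (by fun_prop)
    · exact Continuous.stronglyMeasurable (by fun_prop)
  have hGe : Measurable (Function.uncurry fun a ζ => ENNReal.ofReal (symbol 1 ζ ^ s) *
      ‖G a ζ‖ₑ ^ 2) := by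
    have hc : Measurable fun p : E × E => ENNReal.ofReal (symbol 1 p.2 ^ s) :=
      (((continuous_symbol 1).measurable.comp measurable_snd).pow_const s).ennreal_ofReal
    exact hc.mul (hGm.measurable.enorm.pow_const 2)
  obtain ⟨B, hB⟩ : ∃ B, ∀ ζ, ‖X ζ‖ ≤ B := by
    obtain ⟨B, -, hB⟩ := exists_schwartz_le_symbol_pow_inv X 0
    exact ⟨B, fun ζ => by simpa using hB ζ⟩
  have hbd : ∀ ζ η, ‖X (ζ - η) - X ζ‖ ≤ B + B := fun ζ η =>
    (norm_sub_le _ _).trans (add_le_add (hB _) (hB _))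
  have hGi : Measurable fun a => ∫⁻ ζ, ENNReal.ofReal (symbol 1 ζ ^ s) * ‖G a ζ‖ₑ ^ 2 :=
    hGe.lintegral_prod_right'
  refine ⟨fun a => C * ∫⁻ ζ, ENNReal.ofReal (symbol 1 ζ ^ s) * ‖G a ζ‖ₑ ^ 2,
    hGi.const_mul C, fun a z hz => ?_, ?_⟩
  · rw [fourierInv_add_sub_fourierInv hX h1 a z hz]
    exact enorm_fourierInv_sq_le (hGm.comp_measurable measurable_prodMk_left).measurable.aemeasurable
      z
  · rw [lintegral_const_mul _ hGi]
    congr 1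
    rw [lintegral_lintegral_swap hGe.aemeasurable]
    have hin : ∀ ζ, ∫⁻ a, ENNReal.ofReal (symbol 1 ζ ^ s) * ‖G a ζ‖ₑ ^ 2 =
        ∫⁻ η, ‖Φ η‖ₑ ^ 2 * (ENNReal.ofReal (symbol 1 ζ ^ s) * ‖X (ζ - η) - X ζ‖ₑ ^ 2) := by
      intro ζ
      rw [lintegral_const_mul' _ _ ENNReal.ofReal_ne_top]
      have hcm : AEStronglyMeasurable (fun η => X (ζ - η) - X ζ) volume :=
        Continuous.aestronglyMeasurable (by fun_prop)
      have i1 : Integrable fun η => Φ η * (X (ζ - η) - X ζ) :=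
        h1.mul_bdd hcm (Eventually.of_forall (hbd ζ))
      have i2 : MemLp (fun η => Φ η * (X (ζ - η) - X ζ)) 2 := by
        refine MemLp.of_le_mul (c := B + B) h2 (h2.1.mul hcm) (Eventually.of_forall fun η => ?_)
        rw [norm_mul, mul_comm]
        exact mul_le_mul_of_nonneg_right (hbd ζ η) (norm_nonneg _)
      have := lintegral_enorm_sq_fourierInv i1 i2
      rw [show (fun a => ‖G a ζ‖ₑ ^ 2) = fun a =>
        ‖𝓕⁻ (fun η => Φ η * (X (ζ - η) - X ζ)) a‖ₑ ^ 2 from rfl, this, ← lintegral_const_mul']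
      · refine lintegral_congr fun η => ?_
        rw [enorm_mul, mul_pow]
        ring
      · exact ENNReal.ofReal_ne_top
    simp only [hin]
    rw [lintegral_lintegral_swap]
    · refine lintegral_congr fun η => ?_
      rw [oscMultiplier, lintegral_const_mul' _ _ (ENNReal.pow_ne_top enorm_ne_top)]
    · have m1 : Measurable fun p : E × E => ENNReal.ofReal (symbol 1 p.1 ^ s) :=
        (((continuous_symbol 1).measurable.comp measurable_fst).pow_const s).ennreal_ofReal
      have m2 : Measurable fun p : E × E => X (p.1 - p.2) - X p.1 :=
        Continuous.measurable (by fun_prop)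
      exact (((hm.measurable.comp measurable_snd).enorm.pow_const 2).mul
        (m1.mul (m2.enorm.pow_const 2))).aemeasurable

end Oscillation

/-! ### Poincaré and Bessel inequalities in Sobolev spaces -/

section Sobolev

variable {E : Type*} [NormedAddCommGroup E] [InnerProductSpace ℝ E] [FiniteDimensional ℝ E]
  [MeasurableSpace E] [BorelSpace E]

/-- The weight `(1 + |2πξ|²)^(k/2)`. -/
noncomputable def sobolevWeight (k : ℕ) (ξ : E) : ℝ := √(symbol 1 ξ) ^ k

/-- `Φ` is the Fourier transform of an element of the Sobolev space `H^k`. -/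
def MemFourierSobolev (k : ℕ) (Φ : E → ℂ) : Prop :=
  MemLp (fun ξ => (sobolevWeight k ξ : ℂ) * Φ ξ) 2

theorem one_le_sobolevWeight (k : ℕ) (ξ : E) : 1 ≤ sobolevWeight k ξ :=
  one_le_pow₀ (Real.one_le_sqrt.2 (one_le_symbol_one ξ))

theorem sobolevWeight_pos (k : ℕ) (ξ : E) : 0 < sobolevWeight k ξ :=
  zero_lt_one.trans_le (one_le_sobolevWeight k ξ)

theorem sobolevWeight_sq (k : ℕ) (ξ : E) : sobolevWeight k ξ ^ 2 = symbol 1 ξ ^ k := by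
  rw [sobolevWeight, ← pow_mul, mul_comm, pow_mul, Real.sq_sqrt (symbol_one_pos ξ).le]

@[fun_prop]
theorem continuous_sobolevWeight (k : ℕ) : Continuous (sobolevWeight k : E → ℝ) := by
  unfold sobolevWeight
  fun_prop

theorem continuous_sobolevWeight_inv (k : ℕ) :
    Continuous fun ξ : E => (((sobolevWeight k ξ)⁻¹ : ℝ) : ℂ) :=
  Complex.continuous_ofReal.comp
    ((continuous_sobolevWeight k).inv₀ fun ξ => (sobolevWeight_pos k ξ).ne')

theorem memLp_sobolevWeight_inv {k : ℕ} (hk : Module.finrank ℝ E < 2 * k) :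
    MemLp (fun ξ : E => (((sobolevWeight k ξ)⁻¹ : ℝ) : ℂ)) 2 := by
  refine (memLp_two_iff_integrable_sq_norm
    (continuous_sobolevWeight_inv k).aestronglyMeasurable).2 ?_
  refine (integrable_symbol_one_pow_inv hk).congr (Eventually.of_forall fun ξ => ?_)
  simp only [Complex.norm_real]
  rw [Real.norm_of_nonneg (inv_nonneg.2 (sobolevWeight_pos k ξ).le), inv_pow, sobolevWeight_sq]

theorem norm_sobolevWeight_mul_sq (k : ℕ) (Φ : E → ℂ) (ξ : E) :
    ‖(sobolevWeight k ξ : ℂ) * Φ ξ‖ ^ 2 = symbol 1 ξ ^ k * ‖Φ ξ‖ ^ 2 := by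
  rw [norm_mul, Complex.norm_real, Real.norm_of_nonneg (sobolevWeight_pos k ξ).le, mul_pow,
    sobolevWeight_sq]

namespace MemFourierSobolev

variable {k : ℕ} {Φ : E → ℂ}

theorem aestronglyMeasurable (h : MemFourierSobolev k Φ) : AEStronglyMeasurable Φ := by
  refine ((continuous_sobolevWeight_inv k).aestronglyMeasurable.mul h.1).congr
    (Eventually.of_forall fun ξ => ?_)
  have : (sobolevWeight k ξ : ℂ) ≠ 0 := Complex.ofReal_ne_zero.2 (sobolevWeight_pos k ξ).ne'
  simp only [Pi.mul_apply, Complex.ofReal_inv]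
  field_simp

theorem memLp (h : MemFourierSobolev k Φ) : MemLp Φ 2 := by
  refine h.of_le h.aestronglyMeasurable (Eventually.of_forall fun ξ => ?_)
  rw [norm_mul, Complex.norm_real, Real.norm_of_nonneg (sobolevWeight_pos k ξ).le]
  exact le_mul_of_one_le_left (norm_nonneg _) (one_le_sobolevWeight k ξ)

theorem integrable (h : MemFourierSobolev k Φ) (hk : Module.finrank ℝ E < 2 * k) :
    Integrable Φ := by
  refine ((memLp_sobolevWeight_inv hk).integrable_mul h).congr (Eventually.of_forall fun ξ => ?_)
  have : (sobolevWeight k ξ : ℂ) ≠ 0 := Complex.ofReal_ne_zero.2 (sobolevWeight_pos k ξ).ne'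
  simp only [Pi.mul_apply, Complex.ofReal_inv]
  field_simp

theorem integrable_symbol_mul (h : MemFourierSobolev k Φ) :
    Integrable fun ξ => symbol 1 ξ ^ k * ‖Φ ξ‖ ^ 2 := by
  refine ((memLp_two_iff_integrable_sq_norm h.1).1 h).congr (Eventually.of_forall fun ξ => ?_)
  exact norm_sobolevWeight_mul_sq k Φ ξ

theorem integrable_norm_sq (h : MemFourierSobolev k Φ) : Integrable fun ξ => ‖Φ ξ‖ ^ 2 :=
  (memLp_two_iff_integrable_sq_norm h.aestronglyMeasurable).1 h.memLp

theorem integrable_pow_mul (h : MemFourierSobolev k Φ) :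
    Integrable fun ξ => (2 * Real.pi * ‖ξ‖) ^ (2 * k) * ‖Φ ξ‖ ^ 2 := by
  refine h.integrable_symbol_mul.mono (AEStronglyMeasurable.mul
    (Continuous.aestronglyMeasurable (by fun_prop)) h.integrable_norm_sq.1)
    (Eventually.of_forall fun ξ => ?_)
  have := symbol_one_pos ξ
  rw [Real.norm_of_nonneg (by positivity), Real.norm_of_nonneg (by positivity), pow_mul]
  gcongr
  unfold symbol
  linarith

end MemFourierSobolev

/-- Near the origin the oscillation multiplier is small, and elsewhere it is dominated by
`|η / ρ|^(2k)`, where `ρ` does not depend on `k`. -/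
theorem oscMultiplier_absorb (X : 𝓢(E, ℂ)) {s : ℕ} (hs : Module.finrank ℝ E < 2 * s)
    {A : ℝ≥0∞} (hA : A ≠ ⊤) :
    ∃ D ρ : ℝ, 0 ≤ D ∧ 0 < ρ ∧ ∀ k, s ≤ k → ∀ η : E, A * oscMultiplier X s η ≤
      2⁻¹ + ENNReal.ofReal (D * (2 * Real.pi * ‖η‖ / ρ) ^ (2 * k)) := by
  obtain ⟨C, hC, hCK⟩ := exists_oscMultiplier_le X hs
  have ht : Tendsto (fun η => A * oscMultiplier X s η) (𝓝 0) (𝓝 0) := by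
    have := ENNReal.Tendsto.const_mul (tendsto_oscMultiplier X hs) (Or.inr hA)
    simpa using this
  have hev := ht.eventually_le_const (u := 2⁻¹) (by norm_num)
  obtain ⟨r, hr, hball⟩ := Metric.eventually_nhds_iff.1 hev
  let ρ := 2 * Real.pi * r
  have hρ : 0 < ρ := by positivity
  refine ⟨A.toReal * C * (ρ ^ 2 + 1) ^ s, ρ, by positivity, hρ, fun k hk η => ?_⟩
  by_cases hη : ‖η‖ < r
  · exact (hball (by simpa using hη)).trans le_self_add
  · push Not at hη
    refine le_trans ?_ le_add_self
    rw [← ENNReal.ofReal_toReal hA]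
    refine (mul_le_mul_right (hCK η) _).trans ?_
    rw [← ENNReal.ofReal_mul ENNReal.toReal_nonneg, ENNReal.toReal_ofReal ENNReal.toReal_nonneg]
    refine ENNReal.ofReal_le_ofReal ?_
    set t := 2 * Real.pi * ‖η‖ / ρ with ht
    have hηt : 2 * Real.pi * ‖η‖ = t * ρ := by
      rw [ht]
      field_simp
    have ht1 : 1 ≤ t := by
      rw [ht, one_le_div hρ]
      simp only [ρ]
      gcongr
    have hsym : symbol 1 η ≤ (ρ ^ 2 + 1) * t ^ 2 := by
      unfold symbol
      rw [hηt]
      nlinarith [one_le_pow₀ ht1 (n := 2)]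
    calc A.toReal * (C * symbol 1 η ^ s) ≤ A.toReal * (C * ((ρ ^ 2 + 1) * t ^ 2) ^ s) := by
          have := (symbol_one_pos η).le
          gcongr
      _ = A.toReal * C * (ρ ^ 2 + 1) ^ s * t ^ (2 * s) := by
          rw [mul_pow, ← pow_mul]
          ring
      _ ≤ _ := by
          gcongr

variable (E) in
/-- A Poincaré inequality at unit scale. The constant is geometric in the order `k`, because the
oscillation is estimated with the multiplier of the fixed order `n / 2 + 1` for every `k`. -/
theorem exists_poincare_unit : ∃ C : ℝ, 0 < C ∧ ∀ k, Module.finrank ℝ E / 2 + 1 ≤ k →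
    ∀ Φ : E → ℂ, MemFourierSobolev k Φ → (∀ a, ∃ z, dist a z ≤ 1 ∧ 𝓕⁻ Φ z = 0) →
    ∫ ξ, ‖Φ ξ‖ ^ 2 ≤ C ^ (2 * k) * ∫ ξ, (2 * Real.pi * ‖ξ‖) ^ (2 * k) * ‖Φ ξ‖ ^ 2 := by
  obtain ⟨X, hX⟩ := exists_schwartz_fourierInv_eq_one E
  let s := Module.finrank ℝ E / 2 + 1
  have hs : Module.finrank ℝ E < 2 * s := by simp only [s]; omega
  let A := ∫⁻ ξ : E, ENNReal.ofReal ((symbol 1 ξ ^ s)⁻¹)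
  have hA : A ≠ ⊤ := (integrable_symbol_one_pow_inv hs).lintegral_lt_top.ne
  obtain ⟨D, ρ, hD, hρ, hK⟩ := oscMultiplier_absorb X hs hA
  refine ⟨(2 * D + 1) / ρ, by positivity, fun k hk Φ hΦ hz => ?_⟩
  obtain ⟨M, hM, hM1, hM2⟩ := exists_oscillation_bound hX s (hΦ.integrable (by omega)) hΦ.memLp
  have hfM : ∀ a, ‖𝓕⁻ Φ a‖ₑ ^ 2 ≤ M a := fun a => by
    obtain ⟨z, hz1, hz2⟩ := hz a
    have := hM1 a (z - a) (by rwa [← dist_eq_norm, dist_comm])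
    rwa [add_sub_cancel, hz2, zero_sub, enorm_neg] at this
  let I := ∫ ξ, (2 * Real.pi * ‖ξ‖) ^ (2 * k) * ‖Φ ξ‖ ^ 2
  have hI : Integrable fun ξ => (2 * Real.pi * ‖ξ‖) ^ (2 * k) * ‖Φ ξ‖ ^ 2 := hΦ.integrable_pow_mul
  let N := ∫ ξ, ‖Φ ξ‖ ^ 2
  have hN0 : 0 ≤ N := integral_nonneg fun ξ => by positivity
  have hI0 : 0 ≤ I := integral_nonneg fun ξ => by positivity
  have hN : ENNReal.ofReal N = ∫⁻ ξ, ‖Φ ξ‖ₑ ^ 2 := ofReal_integral_norm_sq hΦ.memLp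
  have key : ENNReal.ofReal N ≤ ENNReal.ofReal (2⁻¹ * N + D / ρ ^ (2 * k) * I) := by
    calc ENNReal.ofReal N = ∫⁻ a, ‖𝓕⁻ Φ a‖ₑ ^ 2 := by
          rw [hN, lintegral_enorm_sq_fourierInv (hΦ.integrable (by omega)) hΦ.memLp]
      _ ≤ ∫⁻ a, M a := lintegral_mono hfM
      _ = ∫⁻ η, ‖Φ η‖ₑ ^ 2 * (A * oscMultiplier X s η) := by
          rw [hM2, ← lintegral_const_mul' _ _ hA]
          refine lintegral_congr fun η => ?_
          ring
      _ ≤ ∫⁻ η, ENNReal.ofReal (2⁻¹ * ‖Φ η‖ ^ 2 +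
            D / ρ ^ (2 * k) * ((2 * Real.pi * ‖η‖) ^ (2 * k) * ‖Φ η‖ ^ 2)) := by
          refine lintegral_mono fun η => ?_
          refine (mul_le_mul_right (hK k hk η) _).trans_eq ?_
          rw [show (2⁻¹ : ℝ≥0∞) = ENNReal.ofReal 2⁻¹ by
            rw [ENNReal.ofReal_inv_of_pos two_pos, ENNReal.ofReal_ofNat]]
          rw [← ENNReal.ofReal_add (by norm_num) (by positivity), ← ofReal_norm,
            ← ENNReal.ofReal_pow (norm_nonneg _), ← ENNReal.ofReal_mul (by positivity)]
          congr 1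
          rw [div_pow]
          ring
      _ = ENNReal.ofReal (2⁻¹ * N + D / ρ ^ (2 * k) * I) := by
          rw [← ofReal_integral_eq_lintegral_ofReal]
          · rw [integral_add (hΦ.integrable_norm_sq.const_mul _) (hI.const_mul _),
              integral_const_mul, integral_const_mul]
          · exact (hΦ.integrable_norm_sq.const_mul _).add (hI.const_mul _)
          · exact Eventually.of_forall fun ξ => by positivity
  have key2 := (ENNReal.ofReal_le_ofReal_iff (by positivity)).1 key
  have h3 : N ≤ 2 * D / ρ ^ (2 * k) * I := by
    rw [mul_div_assoc, mul_assoc]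
    linarith
  refine h3.trans (mul_le_mul_of_nonneg_right ?_ hI0)
  rw [div_pow]
  gcongr
  calc 2 * D ≤ 2 * D + 1 := by linarith
    _ ≤ (2 * D + 1) ^ (2 * k) := le_self_pow₀ (by linarith) (by omega)

theorem fourierInv_comp_smul (Φ : E → ℂ) {h : ℝ} (hh : 0 < h) (x : E) :
    𝓕⁻ (fun η => Φ (h⁻¹ • η)) x = (h ^ Module.finrank ℝ E : ℝ) * 𝓕⁻ Φ (h • x) := by
  have hpos : (0 : ℝ) < h ^ Module.finrank ℝ E := by positivity
  rw [Real.fourierInv_eq', Real.fourierInv_eq']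
  have := Measure.integral_comp_smul (volume : Measure E) (fun η : E =>
    Complex.exp (((2 * Real.pi * ⟪η, h • x⟫ : ℝ) : ℂ) * Complex.I) • Φ η) h⁻¹
  rw [inv_pow, inv_inv, abs_of_pos hpos, Complex.real_smul] at this
  rw [← this]
  refine integral_congr_ae (Eventually.of_forall fun η => ?_)
  simp only [inner_smul_left, inner_smul_right, conj_trivial]
  rw [mul_inv_cancel_left₀ hh.ne']

variable (E) in
/-- The Poincaré inequality for functions vanishing on an `h`-dense set; the constant `C` depends
on the dimension only. -/
theorem exists_poincare : ∃ C : ℝ, 0 < C ∧ ∀ k, Module.finrank ℝ E / 2 + 1 ≤ k → ∀ h : ℝ, 0 < h →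
    ∀ Φ : E → ℂ, MemFourierSobolev k Φ → (∀ a, ∃ z, dist a z ≤ h ∧ 𝓕⁻ Φ z = 0) →
    ∫ ξ, ‖Φ ξ‖ ^ 2 ≤ (C * h) ^ (2 * k) * ∫ ξ, (2 * Real.pi * ‖ξ‖) ^ (2 * k) * ‖Φ ξ‖ ^ 2 := by
  obtain ⟨C, hC, H⟩ := exists_poincare_unit E
  refine ⟨C, hC, fun k hk h hh Φ hΦ hz => ?_⟩
  have hh' : h⁻¹ ≠ 0 := (inv_pos.2 hh).ne'
  have hpos : (0 : ℝ) < h ^ Module.finrank ℝ E := by positivity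
  have hmem : MemFourierSobolev k fun η => Φ (h⁻¹ • η) := by
    have hqm : Measure.QuasiMeasurePreserving (fun η : E => h⁻¹ • η) volume volume := by
      refine ⟨measurable_const_smul _, ?_⟩
      rw [Measure.map_addHaar_smul volume hh']
      exact Measure.smul_absolutelyContinuous
    have hm : AEStronglyMeasurable (fun η => Φ (h⁻¹ • η)) volume :=
      hΦ.aestronglyMeasurable.comp_quasiMeasurePreserving hqm
    refine (memLp_two_iff_integrable_sq_norm (AEStronglyMeasurable.mul
      (Continuous.aestronglyMeasurable (by fun_prop)) hm)).2 ?_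
    have hint := (hΦ.integrable_symbol_mul.const_mul ((1 + h ^ 2) ^ k)).comp_smul hh'
    refine hint.mono ((AEStronglyMeasurable.mul
      (Continuous.aestronglyMeasurable (by fun_prop)) hm).norm.pow 2)
      (Eventually.of_forall fun η => ?_)
    have p1 := symbol_one_pos η
    have p2 := symbol_one_pos (h⁻¹ • η)
    refine le_of_eq_of_le (congrArg norm
      (norm_sobolevWeight_mul_sq k (fun η => Φ (h⁻¹ • η)) η)) ?_
    rw [Real.norm_of_nonneg (by positivity), Real.norm_of_nonneg (by positivity), ← mul_assoc,
      ← mul_pow]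
    gcongr
    unfold symbol
    rw [norm_smul, Real.norm_of_nonneg (inv_pos.2 hh).le]
    have e : 2 * Real.pi * ‖η‖ = h * (2 * Real.pi * (h⁻¹ * ‖η‖)) := by field_simp
    rw [e]
    set t := 2 * Real.pi * (h⁻¹ * ‖η‖)
    nlinarith [sq_nonneg t, sq_nonneg h]
  have h1 := H k hk (fun η => Φ (h⁻¹ • η)) hmem fun a => by
    obtain ⟨z, hz1, hz2⟩ := hz (h • a)
    refine ⟨h⁻¹ • z, ?_, ?_⟩
    · have : a - h⁻¹ • z = h⁻¹ • (h • a - z) := by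
        rw [smul_sub, smul_smul, inv_mul_cancel₀ hh.ne', one_smul]
      rw [dist_eq_norm] at hz1 ⊢
      rw [this, norm_smul, Real.norm_of_nonneg (inv_pos.2 hh).le, inv_mul_le_iff₀ hh, mul_one]
      exact hz1
    · rw [fourierInv_comp_smul Φ hh, smul_smul, mul_inv_cancel₀ hh.ne', one_smul, hz2, mul_zero]
  have e1 := Measure.integral_comp_smul (volume : Measure E) (fun η => ‖Φ η‖ ^ 2) h⁻¹
  have e2 := Measure.integral_comp_smul (volume : Measure E)
    (fun η => h ^ (2 * k) * ((2 * Real.pi * ‖η‖) ^ (2 * k) * ‖Φ η‖ ^ 2)) h⁻¹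
  have e3 : ∀ η : E, h ^ (2 * k) * ((2 * Real.pi * ‖h⁻¹ • η‖) ^ (2 * k) * ‖Φ (h⁻¹ • η)‖ ^ 2) =
      (2 * Real.pi * ‖η‖) ^ (2 * k) * ‖Φ (h⁻¹ • η)‖ ^ 2 := fun η => by
    rw [norm_smul, Real.norm_of_nonneg (inv_pos.2 hh).le, ← mul_assoc, ← mul_pow]
    congr 2
    field_simp
  simp only [e3] at e2
  rw [inv_pow, inv_inv, abs_of_pos hpos, smul_eq_mul] at e1 e2
  rw [e1, e2, integral_const_mul] at h1
  rw [mul_pow]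
  refine le_of_mul_le_mul_left ?_ hpos
  calc _ ≤ _ := h1
    _ = _ := by ring

/-- The values of an `H^k` function on a separated set are square summable: each value is
controlled by the function and its oscillation on a ball, and these balls are disjoint. -/
theorem exists_bessel_bound {k : ℕ} (hk : Module.finrank ℝ E < 2 * k) {X : Set E} {δ : ℝ}
    (hδ : 0 < δ) (hX : ∀ x ∈ X, ∀ y ∈ X, x ≠ y → δ ≤ dist x y) :
    ∃ C : ℝ, ∀ Φ : E → ℂ, MemFourierSobolev k Φ → ∀ F : Finset X,
      ∑ x ∈ F, ‖𝓕⁻ Φ (x : E)‖ ^ 2 ≤ C * ∫ ξ, symbol 1 ξ ^ k * ‖Φ ξ‖ ^ 2 := by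
  obtain ⟨χ, hχ⟩ := exists_schwartz_fourierInv_eq_one E
  let A := ∫⁻ ξ : E, ENNReal.ofReal ((symbol 1 ξ ^ k)⁻¹)
  have hA : A ≠ ⊤ := (integrable_symbol_one_pow_inv hk).lintegral_lt_top.ne
  obtain ⟨C, hC, hK⟩ := exists_oscMultiplier_le χ hk
  let r := min (δ / 2) 1
  have hr : 0 < r := by positivity
  let v := (volume (Metric.ball (0 : E) r))
  have hv0 : 0 < v.toReal :=
    ENNReal.toReal_pos (Metric.measure_ball_pos volume _ hr).ne' measure_ball_lt_top.ne
  have hvtop : v ≠ ⊤ := measure_ball_lt_top.ne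
  refine ⟨v.toReal⁻¹ * (2 + 2 * (A.toReal * C)), fun Φ hΦ F => ?_⟩
  have h1 := hΦ.integrable hk
  obtain ⟨M, hM, hM1, hM2⟩ := exists_oscillation_bound hχ k h1 hΦ.memLp
  let I := ∫ ξ, symbol 1 ξ ^ k * ‖Φ ξ‖ ^ 2
  have hI0 : 0 ≤ I := integral_nonneg fun ξ => by
    have := symbol_one_pos ξ
    positivity
  have hIN : ∫⁻ ξ, ‖Φ ξ‖ₑ ^ 2 ≤ ENNReal.ofReal I := by
    rw [← ofReal_integral_norm_sq hΦ.memLp]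
    refine ENNReal.ofReal_le_ofReal (integral_mono hΦ.integrable_norm_sq hΦ.integrable_symbol_mul
      fun ξ => ?_)
    exact le_mul_of_one_le_left (by positivity) (one_le_pow₀ (one_le_symbol_one ξ))
  have hMI : ∫⁻ a, M a ≤ ENNReal.ofReal (A.toReal * C * I) := by
    rw [hM2, mul_assoc, ENNReal.ofReal_mul ENNReal.toReal_nonneg, ENNReal.ofReal_toReal hA]
    refine mul_le_mul_right ?_ _
    rw [← integral_const_mul, ofReal_integral_eq_lintegral_ofReal
      (hΦ.integrable_symbol_mul.const_mul C)]
    · refine lintegral_mono fun η => ?_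
      refine (mul_le_mul_right (hK η) _).trans_eq ?_
      rw [← ofReal_norm, ← ENNReal.ofReal_pow (norm_nonneg _), ← ENNReal.ofReal_mul (by positivity)]
      congr 1
      ring
    · refine Eventually.of_forall fun ξ => ?_
      have := symbol_one_pos ξ
      positivity
  let W : E → ℝ≥0∞ := fun a => 2 * ‖𝓕⁻ Φ a‖ₑ ^ 2 + 2 * M a
  have hWle : ∫⁻ a, W a ≤ ENNReal.ofReal ((2 + 2 * (A.toReal * C)) * I) := by
    have hm : Measurable fun a => 2 * ‖𝓕⁻ Φ a‖ₑ ^ 2 :=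
      ((continuous_fourierInv h1).measurable.enorm.pow_const 2).const_mul 2
    rw [lintegral_add_left hm, lintegral_const_mul' _ _ (by norm_num),
      lintegral_const_mul' _ _ (by norm_num), lintegral_enorm_sq_fourierInv h1 hΦ.memLp]
    have : (2 + 2 * (A.toReal * C)) * I = 2 * I + 2 * (A.toReal * C * I) := by ring
    rw [this, ENNReal.ofReal_add (by positivity) (by positivity), ENNReal.ofReal_mul (by norm_num),
      ENNReal.ofReal_mul (by norm_num), ENNReal.ofReal_ofNat]
    gcongr
  have hpt : ∀ x a : E, a ∈ Metric.ball x r → ‖𝓕⁻ Φ x‖ₑ ^ 2 ≤ W a := by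
    intro x a ha
    have hxa : ‖x - a‖ ≤ 1 := by
      rw [← dist_eq_norm, dist_comm]
      exact (Metric.mem_ball.1 ha).le.trans (min_le_right _ _)
    have h2 := hM1 a (x - a) hxa
    rw [add_sub_cancel] at h2
    refine le_trans ?_ (add_le_add_right (mul_le_mul_right h2 2) _)
    simp only [← ofReal_norm, ← ENNReal.ofReal_pow (norm_nonneg _)]
    rw [← ENNReal.ofReal_ofNat 2, ← ENNReal.ofReal_mul (by norm_num),
      ← ENNReal.ofReal_mul (by norm_num), ← ENNReal.ofReal_add (by positivity) (by positivity)]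
    refine ENNReal.ofReal_le_ofReal ?_
    have h3 : ‖𝓕⁻ Φ x‖ ≤ ‖𝓕⁻ Φ a‖ + ‖𝓕⁻ Φ x - 𝓕⁻ Φ a‖ := by
      have := norm_add_le (𝓕⁻ Φ a) (𝓕⁻ Φ x - 𝓕⁻ Φ a)
      rwa [add_sub_cancel] at this
    have h4 : ‖𝓕⁻ Φ x‖ ^ 2 ≤ (‖𝓕⁻ Φ a‖ + ‖𝓕⁻ Φ x - 𝓕⁻ Φ a‖) ^ 2 := by gcongr
    nlinarith [sq_nonneg (‖𝓕⁻ Φ a‖ - ‖𝓕⁻ Φ x - 𝓕⁻ Φ a‖)]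
  have hball : ∀ x : E, v * ‖𝓕⁻ Φ x‖ₑ ^ 2 ≤ ∫⁻ a in Metric.ball x r, W a := by
    intro x
    calc v * ‖𝓕⁻ Φ x‖ₑ ^ 2 = ∫⁻ a in Metric.ball x r, ‖𝓕⁻ Φ x‖ₑ ^ 2 := by
          rw [setLIntegral_const, mul_comm, Measure.addHaar_ball_center]
      _ ≤ _ := setLIntegral_mono' measurableSet_ball (hpt x)
  have hdisj : Set.PairwiseDisjoint (F : Set X) fun x : X => Metric.ball (x : E) r := by
    intro x _ y _ hxy
    refine Metric.ball_disjoint_ball ?_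
    have h5 := hX x x.2 y y.2 fun h => hxy (Subtype.ext h)
    have h6 : r ≤ δ / 2 := min_le_left _ _
    linarith
  have hsum : v * ∑ x ∈ F, ‖𝓕⁻ Φ (x : E)‖ₑ ^ 2 ≤ ENNReal.ofReal ((2 + 2 * (A.toReal * C)) * I) := by
    rw [Finset.mul_sum]
    refine (Finset.sum_le_sum fun (x : X) _ => hball (x : E)).trans ?_
    rw [← lintegral_biUnion_finset hdisj fun x _ => measurableSet_ball]
    exact (setLIntegral_le_lintegral _ _).trans hWle
  have hconv : v * ∑ x ∈ F, ‖𝓕⁻ Φ (x : E)‖ₑ ^ 2 =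
      ENNReal.ofReal (v.toReal * ∑ x ∈ F, ‖𝓕⁻ Φ (x : E)‖ ^ 2) := by
    rw [ENNReal.ofReal_mul ENNReal.toReal_nonneg, ENNReal.ofReal_toReal hvtop,
      ENNReal.ofReal_sum_of_nonneg fun x _ => by positivity]
    simp only [ENNReal.ofReal_pow (norm_nonneg _), ofReal_norm]
  rw [hconv, ENNReal.ofReal_le_ofReal_iff (by positivity)] at hsum
  rw [mul_assoc, le_inv_mul_iff₀ hv0]
  exact hsum

end Sobolev

/-! ### The Sobolev space as a Hilbert space, and the energy -/

section SplineSpace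

variable {E : Type*} [NormedAddCommGroup E] [InnerProductSpace ℝ E] [FiniteDimensional ℝ E]
  [MeasurableSpace E] [BorelSpace E]

/-- The Fourier transform `(1 + |2πξ|²)^(-k/2) g` of the element of `H^k` parametrized by
`g ∈ L²`. -/
noncomputable def sobolevRep (k : ℕ) (g : E → ℂ) (ξ : E) : ℂ :=
  (((sobolevWeight k ξ)⁻¹ : ℝ) : ℂ) * g ξ

theorem sobolevWeight_mul_rep (k : ℕ) (g : E → ℂ) (ξ : E) :
    (sobolevWeight k ξ : ℂ) * sobolevRep k g ξ = g ξ := by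
  have : (sobolevWeight k ξ : ℂ) ≠ 0 := Complex.ofReal_ne_zero.2 (sobolevWeight_pos k ξ).ne'
  simp only [sobolevRep, Complex.ofReal_inv]
  field_simp

theorem sobolevRep_weight_mul (k : ℕ) (Φ : E → ℂ) :
    sobolevRep k (fun ξ => (sobolevWeight k ξ : ℂ) * Φ ξ) = Φ := by
  ext ξ
  have : (sobolevWeight k ξ : ℂ) ≠ 0 := Complex.ofReal_ne_zero.2 (sobolevWeight_pos k ξ).ne'
  simp only [sobolevRep, Complex.ofReal_inv]
  field_simp

theorem memFourierSobolev_sobolevRep (k : ℕ) {g : E → ℂ} (hg : MemLp g 2) :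
    MemFourierSobolev k (sobolevRep k g) := by
  unfold MemFourierSobolev
  simpa only [sobolevWeight_mul_rep] using hg

theorem memFourierSobolev_lp (k : ℕ) (g : Lp ℂ 2 (volume : Measure E)) :
    MemFourierSobolev k (sobolevRep k g) :=
  memFourierSobolev_sobolevRep k (Lp.memLp g)

theorem sobolevRep_ae_congr (k : ℕ) {f g : E → ℂ} (h : f =ᵐ[volume] g) :
    sobolevRep k f =ᵐ[volume] sobolevRep k g := by
  filter_upwards [h] with ξ hξ
  rw [sobolevRep, sobolevRep, hξ]

theorem sobolevRep_toLp_ae (k : ℕ) {Φ : E → ℂ} (h : MemFourierSobolev k Φ) :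
    sobolevRep k (MemLp.toLp _ h) =ᵐ[volume] Φ := by
  refine (sobolevRep_ae_congr k h.coeFn_toLp).trans ?_
  rw [sobolevRep_weight_mul]

theorem norm_sq_lp_eq_integral (g : Lp ℂ 2 (volume : Measure E)) : ‖g‖ ^ 2 = ∫ ξ, ‖g ξ‖ ^ 2 := by
  have h : inner ℂ g g = ((‖g‖ ^ 2 : ℝ) : ℂ) := by
    rw [inner_self_eq_norm_sq_to_K]
    simp
  rw [L2.inner_def] at h
  simp only [inner_self_eq_norm_sq_to_K] at h
  have h2 : ∫ ξ, ((‖g ξ‖ ^ 2 : ℝ) : ℂ) = ((‖g‖ ^ 2 : ℝ) : ℂ) := by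
    rw [← h]
    refine integral_congr_ae (Eventually.of_forall fun ξ => ?_)
    simp
  rw [integral_complex_ofReal] at h2
  exact_mod_cast h2.symm

theorem integral_symbol_mul_sobolevRep (k : ℕ) (g : Lp ℂ 2 (volume : Measure E)) :
    ∫ ξ, symbol 1 ξ ^ k * ‖sobolevRep k g ξ‖ ^ 2 = ‖g‖ ^ 2 := by
  rw [norm_sq_lp_eq_integral]
  refine integral_congr_ae (Eventually.of_forall fun ξ => ?_)
  simp only
  rw [← norm_sobolevWeight_mul_sq, sobolevWeight_mul_rep]

/-- The element of `L²` which represents the evaluation at `x` on `H^k`. -/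
noncomputable def evalVec (k : ℕ) (hk : Module.finrank ℝ E < 2 * k) (x : E) :
    Lp ℂ 2 (volume : Measure E) :=
  MemLp.toLp (fun ξ => Complex.exp (((-(2 * Real.pi * ⟪ξ, x⟫) : ℝ) : ℂ) * Complex.I) *
      (((sobolevWeight k ξ)⁻¹ : ℝ) : ℂ))
    ((memLp_sobolevWeight_inv hk).of_le
      ((Continuous.aestronglyMeasurable (by fun_prop)).mul (memLp_sobolevWeight_inv hk).1)
      (Eventually.of_forall fun ξ => by
        rw [norm_mul, Complex.norm_exp_ofReal_mul_I, one_mul]))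

theorem coeFn_evalVec (k : ℕ) (hk : Module.finrank ℝ E < 2 * k) (x : E) :
    evalVec k hk x =ᵐ[volume] fun ξ =>
      Complex.exp (((-(2 * Real.pi * ⟪ξ, x⟫) : ℝ) : ℂ) * Complex.I) *
        (((sobolevWeight k ξ)⁻¹ : ℝ) : ℂ) :=
  MemLp.coeFn_toLp _

theorem inner_evalVec (k : ℕ) (hk : Module.finrank ℝ E < 2 * k) (x : E)
    (g : Lp ℂ 2 (volume : Measure E)) :
    inner ℂ (evalVec k hk x) g = 𝓕⁻ (sobolevRep k g) x := by
  rw [L2.inner_def, Real.fourierInv_eq']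
  refine integral_congr_ae ?_
  filter_upwards [coeFn_evalVec k hk x] with ξ hξ
  rw [hξ, RCLike.inner_apply, map_mul, Complex.conj_ofReal, ← Complex.exp_conj, map_mul,
    Complex.conj_ofReal, Complex.conj_I, sobolevRep, smul_eq_mul]
  push_cast
  rw [neg_mul_neg]
  ring

/-- Multiplication by a bounded continuous real function on `L²`. -/
theorem exists_mul_operator {m : E → ℝ} (hm : Continuous m) {B : ℝ} (hB : ∀ ξ, |m ξ| ≤ B) :
    ∃ Q : Lp ℂ 2 (volume : Measure E) →L[ℂ] Lp ℂ 2 (volume : Measure E),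
      ∀ g, Q g =ᵐ[volume] fun ξ => (m ξ : ℂ) * g ξ := by
  have hbd : ∀ (g : Lp ℂ 2 (volume : Measure E)) ξ, ‖(m ξ : ℂ) * g ξ‖ ≤ B * ‖g ξ‖ := fun g ξ => by
    rw [norm_mul, Complex.norm_real]
    exact mul_le_mul_of_nonneg_right (hB ξ) (norm_nonneg _)
  have hmem : ∀ g : Lp ℂ 2 (volume : Measure E), MemLp (fun ξ => (m ξ : ℂ) * g ξ) 2 := fun g =>
    MemLp.of_le_mul (Lp.memLp g)
      ((Continuous.aestronglyMeasurable (by fun_prop)).mul (Lp.aestronglyMeasurable g))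
      (Eventually.of_forall (hbd g))
  let L : Lp ℂ 2 (volume : Measure E) →ₗ[ℂ] Lp ℂ 2 (volume : Measure E) :=
    { toFun := fun g => (hmem g).toLp
      map_add' := fun f g => by
        rw [← MemLp.toLp_add]
        refine MemLp.toLp_congr _ _ ?_
        filter_upwards [Lp.coeFn_add f g] with ξ hξ
        rw [hξ, Pi.add_apply, Pi.add_apply, mul_add]
      map_smul' := fun c g => by
        rw [RingHom.id_apply, ← MemLp.toLp_const_smul]
        refine MemLp.toLp_congr _ _ ?_
        filter_upwards [Lp.coeFn_smul c g] with ξ hξ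
        rw [hξ, Pi.smul_apply, Pi.smul_apply, smul_eq_mul, smul_eq_mul]
        ring }
  refine ⟨L.mkContinuous B fun g => ?_, fun g => (hmem g).coeFn_toLp⟩
  refine Lp.norm_le_mul_norm_of_ae_le_mul ?_
  filter_upwards [(hmem g).coeFn_toLp] with ξ hξ
  change ‖(hmem g).toLp _ ξ‖ ≤ _
  rw [hξ]
  exact hbd g ξ

theorem symbol_le_max_mul (ε : ℝ) (ξ : E) : symbol ε ξ ≤ max 1 ε * symbol 1 ξ := by
  unfold symbol
  have h1 := le_max_left 1 ε
  have h2 := le_max_right 1 ε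
  nlinarith [sq_nonneg (2 * Real.pi * ‖ξ‖)]

theorem exists_energyOp (k : ℕ) {ε : ℝ} (hε : 0 ≤ ε) :
    ∃ Q : Lp ℂ 2 (volume : Measure E) →L[ℂ] Lp ℂ 2 (volume : Measure E),
      ∀ g, Q g =ᵐ[volume] fun ξ => ((symbol ε ξ ^ k / symbol 1 ξ ^ k : ℝ) : ℂ) * g ξ := by
  refine exists_mul_operator (B := max 1 ε ^ k) ?_ fun ξ => ?_
  · exact ((continuous_symbol ε).pow k).div ((continuous_symbol 1).pow k)
      fun ξ => (pow_pos (symbol_one_pos ξ) k).ne'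
  · have h1 := symbol_nonneg hε ξ
    have h2 := symbol_one_pos ξ
    rw [abs_of_nonneg (by positivity), div_le_iff₀ (by positivity), ← mul_pow]
    exact pow_le_pow_left₀ h1 (symbol_le_max_mul ε ξ) k

/-- The operator `D^k`, as an operator from `H^k` to `H^{-k}` with both spaces identified
with `L²`. -/
noncomputable def energyOp (k : ℕ) {ε : ℝ} (hε : 0 ≤ ε) :
    Lp ℂ 2 (volume : Measure E) →L[ℂ] Lp ℂ 2 (volume : Measure E) :=
  (exists_energyOp k hε).choose

theorem coeFn_energyOp (k : ℕ) {ε : ℝ} (hε : 0 ≤ ε) (g : Lp ℂ 2 (volume : Measure E)) :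
    energyOp k hε g =ᵐ[volume] fun ξ => ((symbol ε ξ ^ k / symbol 1 ξ ^ k : ℝ) : ℂ) * g ξ :=
  (exists_energyOp k hε).choose_spec g

/-- `D^k`, in terms of Fourier transforms. -/
theorem symbol_mul_sobolevRep_ae (k : ℕ) {ε : ℝ} (hε : 0 ≤ ε) (g : Lp ℂ 2 (volume : Measure E)) :
    (fun ξ => ((symbol ε ξ ^ k : ℝ) : ℂ) * sobolevRep k g ξ) =ᵐ[volume]
      fun ξ => (sobolevWeight k ξ : ℂ) * energyOp k hε g ξ := by
  filter_upwards [coeFn_energyOp k hε g] with ξ hξ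
  rw [hξ, ← sobolevWeight_sq, sobolevRep]
  have : (sobolevWeight k ξ : ℂ) ≠ 0 := Complex.ofReal_ne_zero.2 (sobolevWeight_pos k ξ).ne'
  push_cast
  field_simp

theorem inner_energyOp (k : ℕ) {ε : ℝ} (hε : 0 ≤ ε) (f g : Lp ℂ 2 (volume : Measure E)) :
    inner ℂ (energyOp k hε f) g = ∫ ξ, starRingEnd ℂ (((symbol ε ξ ^ k : ℝ) : ℂ) *
      sobolevRep k f ξ) * sobolevRep k g ξ := by
  rw [L2.inner_def]
  refine integral_congr_ae ?_
  filter_upwards [symbol_mul_sobolevRep_ae k hε f] with ξ hξ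
  rw [hξ, RCLike.inner_apply, map_mul, Complex.conj_ofReal, ← sobolevWeight_mul_rep k g]
  ring

theorem inner_energyOp_self (k : ℕ) {ε : ℝ} (hε : 0 ≤ ε) (g : Lp ℂ 2 (volume : Measure E)) :
    inner ℂ (energyOp k hε g) g = ((∫ ξ, symbol ε ξ ^ k * ‖sobolevRep k g ξ‖ ^ 2 : ℝ) : ℂ) := by
  rw [inner_energyOp, ← integral_complex_ofReal]
  refine integral_congr_ae (Eventually.of_forall fun ξ => ?_)
  simp only
  rw [map_mul, Complex.conj_ofReal, mul_assoc, Complex.conj_mul']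
  push_cast
  rfl

theorem MemFourierSobolev.integrable_symbol_pow_mul {k : ℕ} {Φ : E → ℂ}
    (h : MemFourierSobolev k Φ) {ε : ℝ} (hε : 0 ≤ ε) :
    Integrable fun ξ => symbol ε ξ ^ k * ‖Φ ξ‖ ^ 2 := by
  refine (h.integrable_symbol_mul.const_mul (max 1 ε ^ k)).mono (AEStronglyMeasurable.mul
    (Continuous.aestronglyMeasurable (by fun_prop)) h.integrable_norm_sq.1)
    (Eventually.of_forall fun ξ => ?_)
  have h1 := symbol_nonneg hε ξ
  have h2 := symbol_one_pos ξ
  rw [Real.norm_of_nonneg (by positivity), Real.norm_of_nonneg (by positivity), ← mul_assoc,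
    ← mul_pow]
  gcongr
  exact symbol_le_max_mul ε ξ

theorem integral_pow_mul_le_integral_symbol {k : ℕ} {Φ : E → ℂ} (h : MemFourierSobolev k Φ)
    {ε : ℝ} (hε : 0 ≤ ε) : ∫ ξ, (2 * Real.pi * ‖ξ‖) ^ (2 * k) * ‖Φ ξ‖ ^ 2 ≤
      ∫ ξ, symbol ε ξ ^ k * ‖Φ ξ‖ ^ 2 := by
  refine integral_mono h.integrable_pow_mul (h.integrable_symbol_pow_mul hε) fun ξ => ?_
  simp only
  rw [pow_mul]
  gcongr
  unfold symbol
  linarith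

/-- The energy controls the norm of `H^k` as soon as the Poincaré inequality holds. -/
theorem sobolev_norm_le_energy {k : ℕ} {Φ : E → ℂ} (h : MemFourierSobolev k Φ) {ε B : ℝ}
    (hε : 0 ≤ ε) (hB : ∫ ξ, ‖Φ ξ‖ ^ 2 ≤ B * ∫ ξ, (2 * Real.pi * ‖ξ‖) ^ (2 * k) * ‖Φ ξ‖ ^ 2)
    (hB0 : 0 ≤ B) :
    ∫ ξ, symbol 1 ξ ^ k * ‖Φ ξ‖ ^ 2 ≤ 2 ^ k * (B + 1) * ∫ ξ, symbol ε ξ ^ k * ‖Φ ξ‖ ^ 2 := by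
  have h1 : ∫ ξ, symbol 1 ξ ^ k * ‖Φ ξ‖ ^ 2 ≤
      ∫ ξ, 2 ^ k * (‖Φ ξ‖ ^ 2 + (2 * Real.pi * ‖ξ‖) ^ (2 * k) * ‖Φ ξ‖ ^ 2) := by
    refine integral_mono h.integrable_symbol_mul
      ((h.integrable_norm_sq.add h.integrable_pow_mul).const_mul _) fun ξ => ?_
    simp only
    rw [← one_add_mul, ← mul_assoc]
    gcongr
    rw [pow_mul]
    unfold symbol
    set t := (2 * Real.pi * ‖ξ‖) ^ 2 with ht
    have ht0 : 0 ≤ t := by positivity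
    have hm : t + 1 ≤ 2 * max t 1 := by
      have := le_max_left t 1
      have := le_max_right t 1
      linarith
    calc (t + 1) ^ k ≤ (2 * max t 1) ^ k := by gcongr
      _ = 2 ^ k * (max t 1) ^ k := mul_pow _ _ _
      _ ≤ 2 ^ k * (1 + t ^ k) := by
        gcongr
        rcases max_choice t 1 with hc | hc
        · rw [hc]
          linarith
        · rw [hc, one_pow]
          linarith [pow_nonneg ht0 k]
  rw [integral_const_mul, integral_add h.integrable_norm_sq h.integrable_pow_mul] at h1
  have h2 := integral_pow_mul_le_integral_symbol h hε
  have h3 : (0 : ℝ) ≤ 2 ^ k := by positivity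
  calc _ ≤ _ := h1
    _ ≤ 2 ^ k * ((B + 1) * ∫ ξ, (2 * Real.pi * ‖ξ‖) ^ (2 * k) * ‖Φ ξ‖ ^ 2) := by
      gcongr
      linarith
    _ ≤ _ := by
      rw [mul_assoc]
      gcongr

end SplineSpace

/-! ### Fourier characterization of splines -/

section SplineCharacterization

variable {E : Type*} [NormedAddCommGroup E] [InnerProductSpace ℝ E] [FiniteDimensional ℝ E]
  [MeasurableSpace E] [BorelSpace E]

theorem fourier_dOp (ε : ℝ) (ψ : 𝓢(E, ℂ)) (ξ : E) :
    𝓕 (dOp ε ψ) ξ = (symbol ε ξ : ℂ) * 𝓕 ψ ξ := by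
  have h1 : 𝓕 (Δ ψ) ξ = -((2 * Real.pi * ‖ξ‖) ^ 2 : ℝ) * 𝓕 ψ ξ := by
    rw [SchwartzMap.laplacian_eq_fourierMultiplierCLM, SchwartzMap.fourierMultiplierCLM_apply,
      FourierTransform.fourier_smul, FourierTransform.fourier_fourierInv_eq]
    rw [smul_apply, SchwartzMap.smulLeftCLM_apply_apply (by fun_prop)]
    simp
    ring
  have h2 : 𝓕 (dOp ε ψ) = -𝓕 (Δ ψ) + (ε : ℂ) • 𝓕 ψ := by
    simp only [dOp, ← SchwartzMap.fourierTransformCLM_apply (𝕜 := ℂ), map_add, map_neg, map_smul]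
  rw [h2, add_apply, neg_apply, smul_apply, h1]
  simp only [symbol]
  push_cast
  rw [smul_eq_mul]
  ring

theorem fourier_dOp_iterate (ε : ℝ) (k : ℕ) (ψ : 𝓢(E, ℂ)) (ξ : E) :
    𝓕 ((dOp ε)^[k] ψ) ξ = ((symbol ε ξ ^ k : ℝ) : ℂ) * 𝓕 ψ ξ := by
  induction k generalizing ψ with
  | zero => simp
  | succ k ih =>
    rw [Function.iterate_succ_apply, ih, fourier_dOp]
    push_cast
    ring

theorem fourierInv_dOp_iterate (ε : ℝ) (k : ℕ) (ψ : 𝓢(E, ℂ)) (ξ : E) :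
    𝓕⁻ ((dOp ε)^[k] ψ) ξ = ((symbol ε ξ ^ k : ℝ) : ℂ) * 𝓕⁻ ψ ξ := by
  have h : ∀ f : 𝓢(E, ℂ), 𝓕⁻ f ξ = 𝓕 f (-ξ) := fun f => by
    rw [SchwartzMap.fourierInv_coe, SchwartzMap.fourier_coe, Real.fourierInv_eq_fourier_neg]
  rw [h, h, fourier_dOp_iterate]
  simp [symbol]

theorem memFourierSobolev_schwartz {k : ℕ} (hk : Module.finrank ℝ E < 2 * k) (θ : 𝓢(E, ℂ)) :
    MemFourierSobolev k θ := by
  obtain ⟨C, hC, h⟩ := exists_symbol_mul_schwartz_sq_le θ k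
  have hθ := θ.continuous
  have hm : AEStronglyMeasurable (fun ξ => (sobolevWeight k ξ : ℂ) * θ ξ) volume :=
    Continuous.aestronglyMeasurable (by fun_prop)
  refine (memLp_two_iff_integrable_sq_norm hm).2 ?_
  refine ((integrable_symbol_one_pow_inv hk).const_mul C).mono (hm.norm.pow 2)
    (Eventually.of_forall fun ξ => ?_)
  rw [norm_sobolevWeight_mul_sq]
  have := symbol_one_pos ξ
  rw [Real.norm_of_nonneg (by positivity), Real.norm_of_nonneg (by positivity)]
  exact h ξ

variable {k : ℕ} (hk : Module.finrank ℝ E < 2 * k) {X : Set E}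
  {S : Lp ℂ 2 (volume : Measure E) →L[ℂ] lp (fun _ : X => ℂ) 2}

/-- The series `∑ bₓ δₓ`, tested against `𝓕 θ`. -/
theorem hasSum_mul_fourier (hS : ∀ g (x : X), S g x = inner ℂ (evalVec k hk (x : E)) g)
    (b : lp (fun _ : X => ℂ) 2) (θ : 𝓢(E, ℂ)) :
    HasSum (fun x : X => b x * 𝓕 θ (x : E))
      (∫ ξ, θ ξ * ((sobolevWeight k ξ : ℂ) * ContinuousLinearMap.adjoint S b ξ)) := by
  have hv : MemLp (fun ξ => starRingEnd ℂ ((sobolevWeight k ξ : ℂ) * θ ξ)) 2 :=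
    (memFourierSobolev_schwartz hk θ).star
  have h := (hasSum_adjoint_analysis hS b).mapL (innerSL ℂ hv.toLp)
  have e1 : ∀ g : Lp ℂ 2 (volume : Measure E), innerSL ℂ hv.toLp g =
      ∫ ξ, θ ξ * ((sobolevWeight k ξ : ℂ) * g ξ) := fun g => by
    rw [innerSL_apply_apply, L2.inner_def]
    refine integral_congr_ae ?_
    filter_upwards [hv.coeFn_toLp] with ξ hξ
    rw [hξ, RCLike.inner_apply, Complex.conj_conj]
    ring
  rw [e1] at h
  have hfun : (fun x : X => b x * 𝓕 θ (x : E)) =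
      fun x : X => innerSL ℂ hv.toLp (b x • evalVec k hk (x : E)) := ?_
  · rw [hfun]
    exact h
  ext x
  rw [map_smul, smul_eq_mul, e1, SchwartzMap.fourier_coe, Real.fourier_eq']
  congr 1
  refine integral_congr_ae ?_
  filter_upwards [coeFn_evalVec k hk (x : E)] with ξ hξ
  rw [hξ]
  have : (sobolevWeight k ξ : ℂ) ≠ 0 := Complex.ofReal_ne_zero.2 (sobolevWeight_pos k ξ).ne'
  push_cast
  field_simp
  simp only [smul_eq_mul]
  ring_nf

variable {ε : ℝ} (hε : 0 ≤ ε)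

include hk in
/-- If `D^k u` is in the range of the synthesis operator, `u` is a spline. -/
theorem isSpline_of_energyOp_eq (hS : ∀ g (x : X), S g x = inner ℂ (evalVec k hk (x : E)) g)
    {g : Lp ℂ 2 (volume : Measure E)} {b : lp (fun _ : X => ℂ) 2}
    (h : energyOp k hε g = ContinuousLinearMap.adjoint S b) :
    IsSpline ε k X (𝓕⁻ (sobolevRep k g)) := by
  have hΦ := memFourierSobolev_lp k g
  have h1 := hΦ.integrable hk
  refine ⟨continuous_fourierInv h1, memLp_fourierInv h1 hΦ.memLp, b, summable_norm_sq_lp b,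
    fun ψ => ?_⟩
  have h2 := hasSum_mul_fourier hk hS b (𝓕⁻ ψ)
  rw [FourierTransform.fourier_fourierInv_eq] at h2
  rw [h2.tsum_eq, integral_fourierInv_mul h1 (SchwartzMap.integrable _)]
  refine integral_congr_ae ?_
  filter_upwards [symbol_mul_sobolevRep_ae k hε g] with ξ hξ
  rw [← SchwartzMap.fourierInv_coe, fourierInv_dOp_iterate, ← h, ← hξ]
  ring

include hk in
/-- A spline lies in `H^k`, and `D^k u` is in the range of the synthesis operator. -/
theorem IsSpline.exists_energyOp_eq (hS : ∀ g (x : X), S g x = inner ℂ (evalVec k hk (x : E)) g)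
    {u : E → ℂ} (hu : IsSpline ε k X u) :
    ∃ g : Lp ℂ 2 (volume : Measure E), ∃ b : lp (fun _ : X => ℂ) 2,
      u = 𝓕⁻ (sobolevRep k g) ∧ energyOp k hε g = ContinuousLinearMap.adjoint S b := by
  obtain ⟨hcont, hL2, a, ha, hψ⟩ := hu
  let b : lp (fun _ : X => ℂ) 2 := ⟨a, memℓp_two_of_summable ha⟩
  let v : Lp ℂ 2 (volume : Measure E) := 𝓕 (hL2.toLp u)
  let T : Lp ℂ 2 (volume : Measure E) := ContinuousLinearMap.adjoint S b
  have hv : LocallyIntegrable (v : E → ℂ) volume := (Lp.memLp v).locallyIntegrable (by norm_num)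
  have hT : LocallyIntegrable (T : E → ℂ) volume := (Lp.memLp T).locallyIntegrable (by norm_num)
  have hae : (fun ξ => ((symbol ε ξ ^ k : ℝ) : ℂ) * v ξ) =ᵐ[volume]
      fun ξ => (sobolevWeight k ξ : ℂ) * T ξ := by
    refine ae_eq_of_integral_schwartz_mul_eq (hv.continuous_mul (by fun_prop))
      (hT.continuous_mul (by fun_prop)) fun θ => ?_
    rw [← (hasSum_mul_fourier hk hS b θ).tsum_eq]
    have h1 := hψ (𝓕 θ)
    have h2 := integral_schwartz_mul_fourier (𝓕⁻ ((dOp ε)^[k] (𝓕 θ))) (hL2.toLp u)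
    rw [FourierTransform.fourier_fourierInv_eq] at h2
    refine Eq.trans ?_ (Eq.trans h2 (Eq.trans ?_ h1))
    · refine integral_congr_ae (Eventually.of_forall fun ξ => ?_)
      simp only [fourierInv_dOp_iterate, FourierTransform.fourierInv_fourier_eq]
      ring
    · refine integral_congr_ae ?_
      filter_upwards [hL2.coeFn_toLp] with x hx
      rw [hx, mul_comm]
  -- near the origin the weight is bounded, away from it the two symbols are comparable
  have hbound : ∀ᵐ ξ, ‖(sobolevWeight k ξ : ℂ) * v ξ‖ ≤ 2 ^ k * (‖v ξ‖ + ‖T ξ‖) := by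
    filter_upwards [hae] with ξ hξ
    have hw := sobolevWeight_pos k ξ
    rw [norm_mul, Complex.norm_real, Real.norm_of_nonneg hw.le]
    rcases le_total (2 * Real.pi * ‖ξ‖) 1 with ht | ht
    · have h1 : symbol 1 ξ ≤ 2 := by
        unfold symbol
        have : (2 * Real.pi * ‖ξ‖) ^ 2 ≤ 1 := pow_le_one₀ (by positivity) ht
        linarith
      have h2 : sobolevWeight k ξ ≤ 2 ^ k := by
        unfold sobolevWeight
        refine pow_le_pow_left₀ (Real.sqrt_nonneg _) ?_ k
        rw [Real.sqrt_le_left (by norm_num)]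
        linarith
      calc _ ≤ 2 ^ k * ‖v ξ‖ := by gcongr
        _ ≤ _ := by
          gcongr
          linarith [norm_nonneg (T ξ)]
    · have h1 : symbol 1 ξ ≤ 2 * symbol ε ξ := by
        unfold symbol
        have : 1 ≤ (2 * Real.pi * ‖ξ‖) ^ 2 := one_le_pow₀ ht
        linarith
      have h2 : sobolevWeight k ξ ^ 2 ≤ 2 ^ k * symbol ε ξ ^ k := by
        rw [sobolevWeight_sq, ← mul_pow]
        exact pow_le_pow_left₀ (symbol_one_pos ξ).le h1 k
      have h3 := congrArg norm hξ
      rw [norm_mul, norm_mul, Complex.norm_real, Complex.norm_real, Real.norm_of_nonneg hw.le,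
        Real.norm_of_nonneg (pow_nonneg (symbol_nonneg hε ξ) k)] at h3
      have h4 : sobolevWeight k ξ * (sobolevWeight k ξ * ‖v ξ‖) ≤
          sobolevWeight k ξ * (2 ^ k * ‖T ξ‖) := by
        calc _ = sobolevWeight k ξ ^ 2 * ‖v ξ‖ := by ring
          _ ≤ 2 ^ k * symbol ε ξ ^ k * ‖v ξ‖ := by gcongr
          _ = _ := by rw [mul_assoc, h3]; ring
      refine (le_of_mul_le_mul_left h4 hw).trans ?_
      gcongr
      linarith [norm_nonneg (v ξ)]
  have hmem : MemFourierSobolev k (v : E → ℂ) := by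
    refine MemLp.of_le_mul ((Lp.memLp v).norm.add (Lp.memLp T).norm) (c := 2 ^ k)
      ((Continuous.aestronglyMeasurable (by fun_prop)).mul (Lp.aestronglyMeasurable v)) ?_
    filter_upwards [hbound] with ξ hξ
    refine hξ.trans (mul_le_mul_of_nonneg_left ?_ (by positivity))
    exact Real.le_norm_self _
  have h1 := hmem.integrable hk
  refine ⟨hmem.toLp, b, ?_, ?_⟩
  · have e1 : u =ᵐ[volume] 𝓕⁻ (v : E → ℂ) := by
      have h2 := fourierInv_toLp_ae_eq h1 (Lp.memLp v)
      rw [Lp.toLp_coeFn, FourierTransform.fourierInv_fourier_eq] at h2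
      exact hL2.coeFn_toLp.symm.trans h2
    have e2 := (hcont.ae_eq_iff_eq volume (continuous_fourierInv h1)).1 e1
    rw [e2]
    ext x
    exact (Real.fourierInv_congr_ae (sobolevRep_toLp_ae k hmem) x).symm
  · refine Lp.ext ?_
    filter_upwards [coeFn_energyOp k hε hmem.toLp, hmem.coeFn_toLp, hae] with ξ e1 e2 e3
    rw [e1, e2]
    have : (sobolevWeight k ξ : ℂ) ≠ 0 := Complex.ofReal_ne_zero.2 (sobolevWeight_pos k ξ).ne'
    rw [← sobolevWeight_sq]
    push_cast at e3 ⊢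
    field_simp
    linear_combination e3

end SplineCharacterization

/-! ### Spline interpolation on knot sets -/

section Interpolation

variable {E : Type*} [NormedAddCommGroup E] [InnerProductSpace ℝ E] [FiniteDimensional ℝ E]
  [MeasurableSpace E] [BorelSpace E]

theorem dOp_eventuallyEq_zero {ε : ℝ} {ψ : 𝓢(E, ℂ)} {x : E} (h : ψ =ᶠ[𝓝 x] (0 : E → ℂ)) :
    dOp ε ψ =ᶠ[𝓝 x] (0 : E → ℂ) := by
  filter_upwards [h, InnerProductSpace.laplacian_congr_nhds h] with y h1 h2
  rw [← SchwartzMap.laplacian_apply] at h2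
  have h3 : Δ (0 : E → ℂ) y = 0 := by
    have : (0 : E → ℂ) = fun _ => 0 := rfl
    simp [InnerProductSpace.laplacian_eq_iteratedFDeriv_stdOrthonormalBasis]
  rw [dOp, add_apply, neg_apply, smul_apply, h1, h2, h3]
  simp

/-- `D^k` is a local operator. -/
theorem dOp_iterate_eventuallyEq_zero {ε : ℝ} (k : ℕ) {ψ : 𝓢(E, ℂ)} {x : E}
    (h : ψ =ᶠ[𝓝 x] (0 : E → ℂ)) : (dOp ε)^[k] ψ =ᶠ[𝓝 x] (0 : E → ℂ) := by
  induction k generalizing ψ with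
  | zero => exact h
  | succ k ih =>
    rw [Function.iterate_succ_apply]
    exact ih (dOp_eventuallyEq_zero h)

variable (E) in
theorem exists_schwartz_bump {δ : ℝ} (hδ : 0 < δ) :
    ∃ b : 𝓢(E, ℂ), b 0 = 1 ∧ ∀ x, δ < ‖x‖ → b =ᶠ[𝓝 x] (0 : E → ℂ) := by
  let f : ContDiffBump (0 : E) := ⟨δ / 2, δ, by positivity, by linarith⟩
  have hc : HasCompactSupport fun x => (f x : ℂ) :=
    f.hasCompactSupport.comp_left (g := ((↑) : ℝ → ℂ)) rfl
  refine ⟨hc.toSchwartzMap (Complex.ofRealCLM.contDiff.comp f.contDiff), ?_, fun x hx => ?_⟩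
  · change (f 0 : ℂ) = 1
    rw [f.one_of_mem_closedBall (by simp [f]; positivity), Complex.ofReal_one]
  · have : {y : E | δ < ‖y‖} ∈ 𝓝 x := (isOpen_lt continuous_const continuous_norm).mem_nhds hx
    filter_upwards [this] with y hy
    change (f y : ℂ) = 0
    rw [f.zero_of_le_dist (by simpa [f] using le_of_lt hy), Complex.ofReal_zero]

theorem norm_fourier_compSubConst (b : 𝓢(E, ℂ)) (x ξ : E) :
    ‖𝓕 (b.compSubConstCLM ℂ x) ξ‖ = ‖𝓕 b ξ‖ := by
  have h := congrFun (VectorFourier.fourierIntegral_comp_add_right Real.fourierChar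
    (volume : Measure E) (innerₗ E) (b : E → ℂ) (-x)) ξ
  have h2 : 𝓕 (b.compSubConstCLM ℂ x) ξ = VectorFourier.fourierIntegral Real.fourierChar
      (volume : Measure E) (innerₗ E) ((b : E → ℂ) ∘ fun v => v + -x) ξ := by
    have h3 : (b.compSubConstCLM ℂ x : E → ℂ) = (b : E → ℂ) ∘ fun v => v + -x := by
      ext v
      simp [sub_eq_add_neg]
    rw [SchwartzMap.fourier_coe, h3]
    rfl
  rw [h2, h, Circle.norm_smul]
  rfl

/-- Functions in `H^k` with prescribed square summable values on a separated set, depending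
linearly and continuously on the values: the translates of a bump function with small support are
orthogonal in `H^k`. -/
theorem exists_sampling_right_inverse {k : ℕ} (hk : Module.finrank ℝ E < 2 * k) {X : Set E} {δ : ℝ}
    (hδ : 0 < δ) (hX : ∀ x ∈ X, ∀ y ∈ X, x ≠ y → δ ≤ dist x y)
    {S : Lp ℂ 2 (volume : Measure E) →L[ℂ] lp (fun _ : X => ℂ) 2}
    (hS : ∀ g (x : X), S g x = inner ℂ (evalVec k hk (x : E)) g) :
    ∃ R : lp (fun _ : X => ℂ) 2 →L[ℂ] Lp ℂ 2 (volume : Measure E), ∀ α, S (R α) = α := by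
  classical
  obtain ⟨b, hb1, hb0⟩ := exists_schwartz_bump E (δ := δ / 3) (by positivity)
  let bx : E → 𝓢(E, ℂ) := fun x => b.compSubConstCLM ℂ x
  have hbx : ∀ x y, bx x y = b (y - x) := fun x y => rfl
  have hbx0 : ∀ x y, δ / 3 < ‖y - x‖ → bx x =ᶠ[𝓝 y] (0 : E → ℂ) := by
    intro x y hxy
    have hcont : Tendsto (fun z => z - x) (𝓝 y) (𝓝 (y - x)) := by
      have : Continuous fun z => z - x := by fun_prop
      exact this.tendsto y
    exact hcont.eventually (hb0 _ hxy)
  have hmem : ∀ x, MemFourierSobolev k ((𝓕 (bx x) : 𝓢(E, ℂ)) : E → ℂ) := fun x =>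
    memFourierSobolev_schwartz hk _
  let β : X → Lp ℂ 2 (volume : Measure E) := fun x => (hmem x).toLp
  have hinner : ∀ x y : X, inner ℂ (β x) (β y) =
      ∫ z, inner ℂ (bx x z) ((dOp 1)^[k] (bx y) z) := by
    intro x y
    rw [← SchwartzMap.integral_inner_fourier_fourier, L2.inner_def]
    refine integral_congr_ae ?_
    filter_upwards [(hmem x).coeFn_toLp, (hmem y).coeFn_toLp] with ξ h1 h2
    simp only [β]
    rw [h1, h2, fourier_dOp_iterate, ← sobolevWeight_sq, RCLike.inner_apply, RCLike.inner_apply,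
      map_mul, Complex.conj_ofReal]
    push_cast
    ring
  have horth : ∀ x y : X, x ≠ y → inner ℂ (β x) (β y) = 0 := by
    intro x y hxy
    rw [hinner]
    refine integral_eq_zero_of_ae (Eventually.of_forall fun z => ?_)
    have hd := hX x x.2 y y.2 fun h => hxy (Subtype.ext h)
    rcases lt_or_ge (δ / 3) ‖z - x‖ with h | h
    · have := (hbx0 x z h).self_of_nhds
      simp only [this, Pi.zero_apply, inner_zero_left]
    · have h2 : δ / 3 < ‖z - y‖ := by
        have := dist_triangle_left (x : E) y z
        rw [dist_eq_norm z, dist_eq_norm z] at this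
        linarith
      have := (dOp_iterate_eventuallyEq_zero (ε := 1) k (hbx0 y z h2)).self_of_nhds
      simp only [this, Pi.zero_apply, inner_zero_right]
  let c := ∫ ξ, symbol 1 ξ ^ k * ‖𝓕 b ξ‖ ^ 2
  have hnorm : ∀ x : X, ‖β x‖ ^ 2 = c := by
    intro x
    rw [norm_sq_lp_eq_integral]
    refine integral_congr_ae ?_
    filter_upwards [(hmem x).coeFn_toLp] with ξ h1
    simp only [β]
    rw [h1, norm_sobolevWeight_mul_sq, norm_fourier_compSubConst]
  have hval : ∀ x y : X, inner ℂ (evalVec k hk (y : E)) (β x) = if x = y then 1 else 0 := by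
    intro x y
    rw [inner_evalVec, Real.fourierInv_congr_ae (sobolevRep_toLp_ae k (hmem x)),
      ← SchwartzMap.fourierInv_coe, FourierTransform.fourierInv_fourier_eq, hbx]
    split_ifs with h
    · rw [h, sub_self, hb1]
    · refine (hb0 _ ?_).self_of_nhds
      have hd := hX x x.2 y y.2 fun h' => h (Subtype.ext h')
      rw [dist_comm, dist_eq_norm] at hd
      linarith
  have hc : ∀ _ : X, 0 < √c := fun x => by
    rw [← hnorm x, Real.sqrt_sq (norm_nonneg _)]
    refine norm_pos_iff.2 fun h0 => ?_
    have := hval x x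
    rw [h0, inner_zero_right, if_pos rfl] at this
    exact zero_ne_one this
  have hon : Orthonormal ℂ fun x : X => ((√c)⁻¹ : ℂ) • β x := by
    refine ⟨fun x => ?_, fun x y hxy => ?_⟩
    · have h1 : ‖β x‖ = √c := by rw [← hnorm x, Real.sqrt_sq (norm_nonneg _)]
      rw [norm_smul, h1, norm_inv, Complex.norm_real, Real.norm_of_nonneg (Real.sqrt_nonneg _),
        inv_mul_cancel₀ (hc x).ne']
    · simp only [inner_smul_left, inner_smul_right, horth x y hxy, mul_zero]
  have hbes : ∀ g (F : Finset X), ∑ x ∈ F, ‖inner ℂ (β x) g‖ ^ 2 ≤ (√c) ^ 2 * ‖g‖ ^ 2 := by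
    intro g F
    have h1 := hon.sum_inner_products_le g (s := F)
    refine le_trans (le_of_eq ?_) (mul_le_mul_of_nonneg_left h1 (sq_nonneg _))
    rw [Finset.mul_sum]
    refine Finset.sum_congr rfl fun x _ => ?_
    rw [inner_smul_left, norm_mul, RCLike.norm_conj, norm_inv, Complex.norm_real,
      Real.norm_of_nonneg (Real.sqrt_nonneg _), mul_pow, inv_pow, ← mul_assoc,
      mul_inv_cancel₀ (pow_ne_zero 2 (hc x).ne'), one_mul]
  obtain ⟨B, hB⟩ := exists_analysis_operator β hbes
  refine ⟨ContinuousLinearMap.adjoint B, fun α => ?_⟩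
  ext y
  rw [hS]
  have h1 := (hasSum_adjoint_analysis hB α).mapL (innerSL ℂ (evalVec k hk (y : E)))
  simp only [innerSL_apply_apply, inner_smul_right, hval, mul_ite, mul_one, mul_zero] at h1
  exact h1.unique (hasSum_ite_eq y (α y) |>.congr_fun fun x => by
    by_cases h : x = y
    · simp [h]
    · simp [h])

theorem IsKnotSet.exists_dist_le {lam : ℝ} {X : Set E} (hX : IsKnotSet lam X) (a : E) :
    ∃ x ∈ X, dist a x ≤ lam := by
  obtain ⟨Q, -, hQX, -, hdiam, -, hcov⟩ := hX.exists_cells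
  have ha : a ∈ ⋃ x ∈ X, closure (Q x) := hcov ▸ mem_univ a
  simp only [mem_iUnion] at ha
  obtain ⟨x, hx, hax⟩ := ha
  have hxQ : x ∈ Q x := ((hQX x hx).symm ▸ mem_singleton x : x ∈ Q x ∩ X).1
  refine ⟨x, hx, ?_⟩
  have hcl : closure (Q x) ⊆ Metric.closedBall x lam :=
    closure_minimal (fun y hy => Metric.mem_closedBall.2 (hdiam x hx y hy x hxQ))
      Metric.isClosed_closedBall
  exact Metric.mem_closedBall.1 (hcl hax)

/-- The sampling operator `S` of a knot set. -/
theorem exists_sampling {k : ℕ} (hk : Module.finrank ℝ E < 2 * k) {lam : ℝ} {X : Set E}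
    (hX : IsKnotSet lam X) :
    ∃ S : Lp ℂ 2 (volume : Measure E) →L[ℂ] lp (fun _ : X => ℂ) 2,
      ∀ g (x : X), S g x = inner ℂ (evalVec k hk (x : E)) g := by
  obtain ⟨δ, hδ, hsep⟩ := hX.separated
  obtain ⟨C, hC⟩ := exists_bessel_bound hk hδ hsep
  refine exists_analysis_operator (C := C) (fun x : X => evalVec k hk (x : E)) fun g F => ?_
  simp only [inner_evalVec]
  rw [← integral_symbol_mul_sobolevRep k g]
  exact hC _ (memFourierSobolev_lp k g) F

/-- Coercivity of the energy on functions which vanish on an `h`-dense set, with a constant which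
depends on the set only through `h`. -/
theorem exists_sobolev_norm_le {k : ℕ} (hk : Module.finrank ℝ E / 2 + 1 ≤ k) {ε : ℝ}
    (hε : 0 ≤ ε) {h : ℝ} (hh : 0 < h) : ∃ A, 0 < A ∧ ∀ Φ : E → ℂ, MemFourierSobolev k Φ →
      (∀ a, ∃ z, dist a z ≤ h ∧ 𝓕⁻ Φ z = 0) →
      ∫ ξ, symbol 1 ξ ^ k * ‖Φ ξ‖ ^ 2 ≤ A * ∫ ξ, symbol ε ξ ^ k * ‖Φ ξ‖ ^ 2 := by
  obtain ⟨C, hC, hP⟩ := exists_poincare E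
  exact ⟨2 ^ k * ((C * h) ^ (2 * k) + 1), by positivity, fun Φ hΦ hz =>
    sobolev_norm_le_energy hΦ hε (hP k hk h hh Φ hΦ hz) (by positivity)⟩

/-- On functions which vanish on a knot set the energy is coercive. -/
theorem energyOp_coercive {k : ℕ} (hk : Module.finrank ℝ E / 2 + 1 ≤ k) {ε : ℝ} (hε : 0 ≤ ε)
    {lam : ℝ} (hlam : 0 < lam) {X : Set E} (hX : IsKnotSet lam X) :
    ∃ c > 0, ∀ g : Lp ℂ 2 (volume : Measure E), (∀ x ∈ X, 𝓕⁻ (sobolevRep k g) x = 0) →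
      c * ‖g‖ ^ 2 ≤ ‖inner ℂ (energyOp k hε g) g‖ := by
  obtain ⟨A, hA, H⟩ := exists_sobolev_norm_le (E := E) hk hε hlam
  refine ⟨A⁻¹, inv_pos.2 hA, fun g hg => ?_⟩
  have h := H _ (memFourierSobolev_lp k g) fun a => by
    obtain ⟨x, hx, hd⟩ := hX.exists_dist_le a
    exact ⟨x, hd, hg x hx⟩
  rw [integral_symbol_mul_sobolevRep] at h
  rw [inner_energyOp_self, Complex.norm_real, inv_mul_le_iff₀ hA]
  exact h.trans (mul_le_mul_of_nonneg_left (Real.le_norm_self _) hA.le)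

/-- Uniqueness of spline interpolation. -/
theorem eq_zero_of_energyOp_eq {k : ℕ} (hk : Module.finrank ℝ E / 2 + 1 ≤ k)
    (hk' : Module.finrank ℝ E < 2 * k) {ε : ℝ} (hε : 0 ≤ ε)
    {lam : ℝ} (hlam : 0 < lam) {X : Set E} (hX : IsKnotSet lam X)
    {S : Lp ℂ 2 (volume : Measure E) →L[ℂ] lp (fun _ : X => ℂ) 2}
    (hS : ∀ g (x : X), S g x = inner ℂ (evalVec k hk' (x : E)) g)
    {g : Lp ℂ 2 (volume : Measure E)} {b : lp (fun _ : X => ℂ) 2} (hg : S g = 0)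
    (h : energyOp k hε g = ContinuousLinearMap.adjoint S b) : g = 0 := by
  obtain ⟨c, hc, hcoer⟩ := energyOp_coercive hk hε hlam hX
  have h1 := hcoer g fun x hx => by
    rw [← inner_evalVec k hk', ← hS g ⟨x, hx⟩, hg]
    rfl
  rw [h, ContinuousLinearMap.adjoint_inner_left, hg, inner_zero_right, norm_zero] at h1
  have h2 : ‖g‖ ^ 2 ≤ 0 := by
    by_contra! h3
    nlinarith
  have h3 : ‖g‖ = 0 := by nlinarith [sq_nonneg ‖g‖]
  exact norm_eq_zero.1 h3

/-- Spline interpolation of square summable data on a knot set. -/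
theorem exists_spline_interpolation {k : ℕ} (hk : Module.finrank ℝ E / 2 + 1 ≤ k)
    (hk' : Module.finrank ℝ E < 2 * k) {ε : ℝ} (hε : 0 ≤ ε)
    {lam : ℝ} (hlam : 0 < lam) {X : Set E} (hX : IsKnotSet lam X)
    {S : Lp ℂ 2 (volume : Measure E) →L[ℂ] lp (fun _ : X => ℂ) 2}
    (hS : ∀ g (x : X), S g x = inner ℂ (evalVec k hk' (x : E)) g) :
    ∃ I : lp (fun _ : X => ℂ) 2 →L[ℂ] Lp ℂ 2 (volume : Measure E), (∀ α, S (I α) = α) ∧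
      ∀ α, ∃ b, energyOp k hε (I α) = ContinuousLinearMap.adjoint S b := by
  obtain ⟨δ, hδ, hsep⟩ := hX.separated
  obtain ⟨R, hR⟩ := exists_sampling_right_inverse hk' hδ hsep hS
  obtain ⟨c, hc, hcoer⟩ := energyOp_coercive hk hε hlam hX
  refine exists_interpolation_operator S R (energyOp k hε) hR hc fun v hv => ?_
  refine hcoer v fun x hx => ?_
  rw [← inner_evalVec k hk', ← hS v ⟨x, hx⟩, hv]
  rfl

open Classical in
/-- The Lagrangian spline is the interpolant of the unit data. -/
theorem isLagrangeSpline_iff {k : ℕ} (hk : Module.finrank ℝ E / 2 + 1 ≤ k)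
    (hk' : Module.finrank ℝ E < 2 * k) {ε : ℝ} (hε : 0 ≤ ε)
    {lam : ℝ} (hlam : 0 < lam) {X : Set E} (hX : IsKnotSet lam X)
    {S : Lp ℂ 2 (volume : Measure E) →L[ℂ] lp (fun _ : X => ℂ) 2}
    (hS : ∀ g (x : X), S g x = inner ℂ (evalVec k hk' (x : E)) g)
    {I : lp (fun _ : X => ℂ) 2 →L[ℂ] Lp ℂ 2 (volume : Measure E)} (hSI : ∀ α, S (I α) = α)
    (hI : ∀ α, ∃ b, energyOp k hε (I α) = ContinuousLinearMap.adjoint S b) (x : X) (u : E → ℂ) :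
    IsLagrangeSpline ε k X x u ↔ u = 𝓕⁻ (sobolevRep k (I (lp.single 2 x 1))) := by
  have hval : ∀ (g : Lp ℂ 2 (volume : Measure E)) (y : X),
      𝓕⁻ (sobolevRep k g) (y : E) = S g y := fun g y => by
    rw [hS, inner_evalVec]
  constructor
  · rintro ⟨hspl, h1, h0⟩
    obtain ⟨g, b, hg, hb⟩ := hspl.exists_energyOp_eq hk' hε hS
    obtain ⟨b', hb'⟩ := hI (lp.single 2 x 1)
    have hdiff : g - I (lp.single 2 x 1) = 0 := by
      refine eq_zero_of_energyOp_eq hk hk' hε hlam hX hS (b := b - b') ?_ ?_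
      · rw [map_sub, hSI, sub_eq_zero]
        ext y
        rw [← hval, ← hg]
        by_cases hy : y = x
        · rw [hy, h1]
          simp
        · rw [h0 y hy]
          simp [hy]
      · rw [map_sub, map_sub, hb, hb']
    rw [hg, sub_eq_zero.1 hdiff]
  · rintro rfl
    obtain ⟨b, hb⟩ := hI (lp.single 2 x 1)
    refine ⟨isSpline_of_energyOp_eq hk' hε hS hb, ?_, fun y hy => ?_⟩
    · rw [hval, hSI]
      simp
    · rw [hval, hSI]
      simp [hy]

end Interpolation

/-! ### Inverse Fourier transforms of splines -/

section InverseTransform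

variable {E : Type*} [NormedAddCommGroup E] [InnerProductSpace ℝ E] [FiniteDimensional ℝ E]
  [MeasurableSpace E] [BorelSpace E]

theorem lp_coeFn_finset_sum {ι : Type*} (F : Finset ι) (f : ι → Lp ℂ 2 (volume : Measure E)) :
    (∑ i ∈ F, f i : Lp ℂ 2 (volume : Measure E)) =ᵐ[volume] fun ξ => ∑ i ∈ F, f i ξ := by
  classical
  induction F using Finset.induction_on with
  | empty =>
    simp only [Finset.sum_empty]
    exact Lp.coeFn_zero _ _ _
  | insert i F hi ih =>
    rw [Finset.sum_insert hi]
    filter_upwards [Lp.coeFn_add (f i) (∑ i ∈ F, f i), ih] with ξ h1 h2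
    rw [h1, Pi.add_apply, h2, Finset.sum_insert hi]

theorem fourierInv_lp_ae_eq_fourier_neg (v : Lp ℂ 2 (volume : Measure E)) :
    (𝓕⁻ v : Lp ℂ 2 (volume : Measure E)) =ᵐ[volume]
      fun x => (𝓕 v : Lp ℂ 2 (volume : Measure E)) (-x) := by
  have hmp : MeasurePreserving (fun x : E => -x) volume volume := Measure.measurePreserving_neg _
  refine ae_eq_of_integral_schwartz_mul_eq ((Lp.memLp _).locallyIntegrable (by norm_num))
    (((Lp.memLp (𝓕 v)).comp_measurePreserving hmp).locallyIntegrable (by norm_num)) fun ψ => ?_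
  let ψ' : 𝓢(E, ℂ) := SchwartzMap.compCLMOfContinuousLinearEquiv ℂ (ContinuousLinearEquiv.neg ℝ) ψ
  have hψ' : ∀ x, ψ' x = ψ (-x) := fun x => rfl
  have hF : ∀ x, 𝓕 ψ' x = 𝓕⁻ ψ x := fun x => by
    rw [SchwartzMap.fourierInv_coe, SchwartzMap.fourier_coe, Real.fourierInv_eq_fourier_comp_neg]
    rfl
  have h1 := integral_schwartz_mul_fourier ψ' v
  rw [integral_schwartz_mul_fourierInv, ← integral_neg_eq_self (fun x => ψ x * _)]
  simp only [hF, hψ', neg_neg] at h1 ⊢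
  exact h1.symm

/-- The inverse Fourier transform of `Ψ = 𝓕⁻ Φ`, in the normalization of `invFourierL2`. -/
noncomputable def flipScale (Φ : E → ℂ) (x : E) : ℂ :=
  (((2 * Real.pi) ^ (-(Module.finrank ℝ E : ℝ) / 2) : ℝ) : ℂ) * Φ (-((2 * Real.pi)⁻¹ • x))

theorem two_pi_inv_ne_zero : -(2 * Real.pi)⁻¹ ≠ 0 := by
  have := Real.pi_pos
  exact neg_ne_zero.2 (by positivity)

theorem quasiMeasurePreserving_flipScale :
    Measure.QuasiMeasurePreserving (fun x : E => -((2 * Real.pi)⁻¹ • x)) volume volume := by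
  simp only [← neg_smul]
  refine ⟨measurable_const_smul _, ?_⟩
  rw [Measure.map_addHaar_smul volume two_pi_inv_ne_zero]
  exact Measure.smul_absolutelyContinuous

theorem flipScale_ae_congr {Φ Ψ : E → ℂ} (h : Φ =ᵐ[volume] Ψ) :
    flipScale Φ =ᵐ[volume] flipScale Ψ := by
  filter_upwards [quasiMeasurePreserving_flipScale.ae_eq_comp h] with x hx
  simp only [flipScale]
  rw [show Φ (-((2 * Real.pi)⁻¹ • x)) = Ψ (-((2 * Real.pi)⁻¹ • x)) from hx]

theorem aestronglyMeasurable_flipScale {Φ : E → ℂ} (h : AEStronglyMeasurable Φ) :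
    AEStronglyMeasurable (flipScale Φ) :=
  (h.comp_quasiMeasurePreserving quasiMeasurePreserving_flipScale).const_mul _

theorem norm_flipScale_sq (Φ : E → ℂ) (x : E) :
    ‖flipScale Φ x‖ ^ 2 = ((2 * Real.pi) ^ Module.finrank ℝ E)⁻¹ *
      ‖Φ ((-(2 * Real.pi)⁻¹) • x)‖ ^ 2 := by
  have hp : 0 < 2 * Real.pi := by positivity
  rw [flipScale, norm_mul, Complex.norm_real, Real.norm_of_nonneg (by positivity), mul_pow,
    neg_smul]
  congr 1
  rw [← Real.rpow_natCast, ← Real.rpow_mul hp.le, ← Real.rpow_natCast, ← Real.rpow_neg hp.le]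
  congr 1
  push_cast
  ring

theorem integral_norm_flipScale_sq (Φ : E → ℂ) :
    ∫ x, ‖flipScale Φ x‖ ^ 2 = ∫ x, ‖Φ x‖ ^ 2 := by
  have hp : 0 < 2 * Real.pi := by positivity
  simp only [norm_flipScale_sq]
  rw [integral_const_mul, Measure.integral_comp_smul (volume : Measure E) (fun x => ‖Φ x‖ ^ 2),
    abs_inv, abs_pow, abs_neg, abs_of_pos (inv_pos.2 hp), smul_eq_mul, inv_pow, inv_inv,
    inv_mul_cancel_left₀ (by positivity)]

theorem memLp_flipScale {Φ : E → ℂ} (h : MemLp Φ 2) : MemLp (flipScale Φ) 2 := by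
  refine (memLp_two_iff_integrable_sq_norm (aestronglyMeasurable_flipScale h.1)).2 ?_
  simp only [norm_flipScale_sq]
  exact (((memLp_two_iff_integrable_sq_norm h.1).1 h).comp_smul two_pi_inv_ne_zero).const_mul _

theorem eLpNorm_two_eq_of_integral_eq {f g : E → ℂ} (hf : MemLp f 2) (hg : MemLp g 2)
    (h : ∫ x, ‖f x‖ ^ 2 = ∫ x, ‖g x‖ ^ 2) : eLpNorm f 2 volume = eLpNorm g 2 volume := by
  have h1 : eLpNorm f 2 volume ^ 2 = eLpNorm g 2 volume ^ 2 := by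
    rw [← lintegral_enorm_sq_eq, ← lintegral_enorm_sq_eq, ← ofReal_integral_norm_sq hf,
      ← ofReal_integral_norm_sq hg, h]
  exact (ENNReal.pow_right_strictMono (by norm_num : (2 : ℕ) ≠ 0)).injective h1

theorem eLpNorm_flipScale {Φ : E → ℂ} (h : MemLp Φ 2) :
    eLpNorm (flipScale Φ) 2 volume = eLpNorm Φ 2 volume :=
  eLpNorm_two_eq_of_integral_eq (memLp_flipScale h) h (integral_norm_flipScale_sq Φ)

theorem invFourierL2_fourierInv_ae {Φ : E → ℂ} (h1 : Integrable Φ) (h2 : MemLp Φ 2) :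
    invFourierL2 (𝓕⁻ Φ) =ᵐ[volume] flipScale Φ := by
  have hm := memLp_fourierInv h1 h2
  have e1 : hm.toLp (𝓕⁻ Φ) = 𝓕⁻ (h2.toLp Φ) := by
    refine Lp.ext ?_
    exact hm.coeFn_toLp.trans (fourierInv_toLp_ae_eq h1 h2).symm
  have e2 := fourierInv_lp_ae_eq_fourier_neg (𝓕⁻ (h2.toLp Φ))
  rw [FourierTransform.fourier_fourierInv_eq] at e2
  have hqm : Measure.QuasiMeasurePreserving (fun x : E => (2 * Real.pi)⁻¹ • x) volume volume := by
    refine ⟨measurable_const_smul _, ?_⟩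
    rw [Measure.map_addHaar_smul volume (by positivity)]
    exact Measure.smul_absolutelyContinuous
  have e3 := hqm.ae_eq_comp e2
  have e4 := quasiMeasurePreserving_flipScale.ae_eq_comp h2.coeFn_toLp
  filter_upwards [e3, e4] with x hx3 hx4
  simp only [Function.comp_apply] at hx3 hx4
  rw [invFourierL2, dif_pos hm, e1, hx3, hx4, flipScale]

theorem symbol_flip (ε : ℝ) (x : E) : symbol ε (-((2 * Real.pi)⁻¹ • x)) = ‖x‖ ^ 2 + ε := by
  have hp : 0 < 2 * Real.pi := by positivity
  unfold symbol
  rw [norm_neg, norm_smul, Real.norm_of_nonneg (inv_pos.2 hp).le]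
  congr 2
  field_simp

variable {k : ℕ} (hk : Module.finrank ℝ E < 2 * k) {X : Set E}
  {S : Lp ℂ 2 (volume : Measure E) →L[ℂ] lp (fun _ : X => ℂ) 2} {ε : ℝ} (hε : 0 ≤ ε)

include hk in
/-- The inverse Fourier transform of a spline has the exponential form: the partial sums converge
in the weighted space, and on a ball the weight is bounded. -/
theorem hasExpForm_of_energyOp_eq (hS : ∀ g (x : X), S g x = inner ℂ (evalVec k hk (x : E)) g)
    {g : Lp ℂ 2 (volume : Measure E)} {b : lp (fun _ : X => ℂ) 2}
    (h : energyOp k hε g = ContinuousLinearMap.adjoint S b) :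
    HasExpForm ε k X (invFourierL2 (𝓕⁻ (sobolevRep k g))) := by
  let c : ℂ := (((2 * Real.pi) ^ (-(Module.finrank ℝ E : ℝ) / 2) : ℝ) : ℂ)
  refine ⟨fun x => c * b x, ?_, fun R => ?_⟩
  · simp only [norm_mul, mul_pow]
    exact (summable_norm_sq_lp b).mul_left _
  have hΦ := memFourierSobolev_lp k g
  let D : Finset X → Lp ℂ 2 (volume : Measure E) := fun F =>
    ContinuousLinearMap.adjoint S b - ∑ x ∈ F, b x • evalVec k hk (x : E)
  have hD : Tendsto (fun F => ‖D F‖ₑ) atTop (𝓝 0) := by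
    have h1 : Tendsto (fun F => ∑ x ∈ F, b x • evalVec k hk (x : E)) atTop
        (𝓝 (ContinuousLinearMap.adjoint S b)) := hasSum_adjoint_analysis hS b
    have h2 : Tendsto D atTop (𝓝 0) := by
      have := (tendsto_const_nhds (x := ContinuousLinearMap.adjoint S b)).sub h1
      rwa [sub_self] at this
    have h3 := h2.enorm
    rwa [enorm_zero] at h3
  have hae : ∀ F : Finset X, (fun x => ((‖x‖ ^ 2 + ε : ℝ) : ℂ) ^ k *
      invFourierL2 (𝓕⁻ (sobolevRep k g)) x - ∑ μ ∈ F, (c * b μ) *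
        Complex.exp (Complex.I * ((⟪(μ : E), x⟫ : ℝ) : ℂ))) =ᵐ[volume]
      flipScale fun ξ => (sobolevWeight k ξ : ℂ) * D F ξ := by
    intro F
    have e1 := invFourierL2_fourierInv_ae (hΦ.integrable hk) hΦ.memLp
    have e2 : (fun ξ => (sobolevWeight k ξ : ℂ) * D F ξ) =ᵐ[volume] fun ξ =>
        ((symbol ε ξ ^ k : ℝ) : ℂ) * sobolevRep k g ξ -
          ∑ μ ∈ F, b μ * Complex.exp (((-(2 * Real.pi * ⟪ξ, (μ : E)⟫) : ℝ) : ℂ) * Complex.I) := by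
      have e3 : ∀ᵐ ξ, ∀ μ ∈ F, (b μ • evalVec k hk (μ : E) : Lp ℂ 2 (volume : Measure E)) ξ =
          b μ * (Complex.exp (((-(2 * Real.pi * ⟪ξ, (μ : E)⟫) : ℝ) : ℂ) * Complex.I) *
            (((sobolevWeight k ξ)⁻¹ : ℝ) : ℂ)) := by
        rw [Finset.eventually_all]
        intro μ _
        filter_upwards [Lp.coeFn_smul (b μ) (evalVec k hk (μ : E)), coeFn_evalVec k hk (μ : E)]
          with ξ h1 h2
        rw [h1, Pi.smul_apply, h2, smul_eq_mul]
      filter_upwards [e3, Lp.coeFn_sub (ContinuousLinearMap.adjoint S b)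
        (∑ x ∈ F, b x • evalVec k hk (x : E)), lp_coeFn_finset_sum F
        (fun x : X => b x • evalVec k hk (x : E)), symbol_mul_sobolevRep_ae k hε g]
        with ξ h1 h2 h3 h4
      simp only [D]
      rw [h2, Pi.sub_apply, h3, h4, h, mul_sub, Finset.mul_sum]
      congr 1
      refine Finset.sum_congr rfl fun μ hμ => ?_
      rw [h1 μ hμ]
      have : (sobolevWeight k ξ : ℂ) ≠ 0 := Complex.ofReal_ne_zero.2 (sobolevWeight_pos k ξ).ne'
      push_cast
      field_simp
    filter_upwards [e1, flipScale_ae_congr e2] with x h1 h2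
    have hp : (Real.pi : ℂ) ≠ 0 := Complex.ofReal_ne_zero.2 Real.pi_ne_zero
    rw [h1, h2, flipScale, flipScale, symbol_flip, mul_sub, Finset.mul_sum]
    congr 1
    · push_cast
      ring
    · refine Finset.sum_congr rfl fun μ _ => ?_
      rw [mul_assoc]
      congr 3
      rw [inner_neg_left, inner_smul_left, real_inner_comm, conj_trivial]
      push_cast
      field_simp
  let W : ℝ := √(R ^ 2 + 1) ^ k
  have hbound : ∀ F : Finset X, eLpNorm (fun x => ((‖x‖ ^ 2 + ε : ℝ) : ℂ) ^ k *
      invFourierL2 (𝓕⁻ (sobolevRep k g)) x - ∑ μ ∈ F, (c * b μ) *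
        Complex.exp (Complex.I * ((⟪(μ : E), x⟫ : ℝ) : ℂ))) 2
        ((volume : Measure E).restrict (Metric.ball 0 R)) ≤ ENNReal.ofReal W * ‖D F‖ₑ := by
    intro F
    rw [eLpNorm_congr_ae (ae_restrict_of_ae (hae F))]
    have h1 : eLpNorm (flipScale fun ξ => (sobolevWeight k ξ : ℂ) * D F ξ) 2
        ((volume : Measure E).restrict (Metric.ball 0 R)) ≤
        ENNReal.ofReal W * eLpNorm (flipScale (D F)) 2
          ((volume : Measure E).restrict (Metric.ball 0 R)) := by
      refine eLpNorm_le_mul_eLpNorm_of_ae_le_mul ?_ 2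
      filter_upwards [ae_restrict_mem measurableSet_ball] with x hx
      have hx' : ‖x‖ < R := by simpa using hx
      simp only [flipScale, norm_mul]
      rw [← mul_assoc, ← mul_assoc, mul_comm W]
      gcongr
      rw [Complex.norm_real, Real.norm_of_nonneg (sobolevWeight_pos k _).le, sobolevWeight,
        symbol_flip]
      simp only [W]
      gcongr
    refine h1.trans (mul_le_mul_right ?_ _)
    refine (eLpNorm_mono_measure _ Measure.restrict_le_self).trans_eq ?_
    rw [eLpNorm_flipScale (Lp.memLp _), Lp.enorm_def]
  refine tendsto_of_tendsto_of_tendsto_of_le_of_le tendsto_const_nhds ?_ (fun F => zero_le) hbound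
  have := ENNReal.Tendsto.const_mul hD (Or.inr (ENNReal.ofReal_ne_top (r := W)))
  rwa [mul_zero] at this

end InverseTransform

/-! ### The Lagrange expansion and the interpolation error -/

section Reconstruction

variable {E : Type*} [NormedAddCommGroup E] [InnerProductSpace ℝ E] [FiniteDimensional ℝ E]
  [MeasurableSpace E] [BorelSpace E]

/-- The embedding of `H^k` in `L²`, in terms of Fourier transforms. -/
theorem exists_sobolevEmbedding (k : ℕ) :
    ∃ W : Lp ℂ 2 (volume : Measure E) →L[ℂ] Lp ℂ 2 (volume : Measure E),
      ∀ g, W g =ᵐ[volume] sobolevRep k g := by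
  refine exists_mul_operator (m := fun ξ => (sobolevWeight k ξ)⁻¹) (B := 1)
    ((continuous_sobolevWeight k).inv₀ fun ξ => (sobolevWeight_pos k ξ).ne') fun ξ => ?_
  rw [abs_of_pos (inv_pos.2 (sobolevWeight_pos k ξ))]
  exact inv_le_one_of_one_le₀ (one_le_sobolevWeight k ξ)

theorem flipScale_sub (Φ Ψ : E → ℂ) (x : E) :
    flipScale Φ x - flipScale Ψ x = flipScale (fun ξ => Φ ξ - Ψ ξ) x := by
  simp only [flipScale]
  ring

theorem sobolevRep_sub_ae (k : ℕ) (f g : Lp ℂ 2 (volume : Measure E)) :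
    sobolevRep k (f - g : Lp ℂ 2 (volume : Measure E)) =ᵐ[volume]
      fun ξ => sobolevRep k f ξ - sobolevRep k g ξ := by
  filter_upwards [Lp.coeFn_sub f g] with ξ h
  simp only [sobolevRep]
  rw [h, Pi.sub_apply, mul_sub]

variable {k : ℕ} {X : Set E}
  {S : Lp ℂ 2 (volume : Measure E) →L[ℂ] lp (fun _ : X => ℂ) 2}
  {I : lp (fun _ : X => ℂ) 2 →L[ℂ] Lp ℂ 2 (volume : Measure E)} {ε : ℝ}

open Classical in
/-- The Lagrangian expansion of the interpolant, after the inverse Fourier transform. -/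
theorem hasL2Sum_interpolation (hk : Module.finrank ℝ E < 2 * k) {L : X → E → ℂ}
    (hL : ∀ x, L x = 𝓕⁻ (sobolevRep k (I (lp.single 2 x 1)))) (α : lp (fun _ : X => ℂ) 2) :
    HasL2Sum (fun (x : X) y => α x * invFourierL2 (L x) y) (flipScale (sobolevRep k (I α))) := by
  obtain ⟨W, hW⟩ := exists_sobolevEmbedding (E := E) k
  have hmem := fun g => memFourierSobolev_lp (E := E) k g
  have hae : ∀ x, invFourierL2 (L x) =ᵐ[volume]
      flipScale (sobolevRep k (I (lp.single 2 x 1))) := fun x => by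
    rw [hL]
    exact invFourierL2_fourierInv_ae ((hmem _).integrable hk) (hmem _).memLp
  refine ⟨fun x => ?_, memLp_flipScale (hmem _).memLp, ?_⟩
  · exact ((memLp_congr_ae (hae x)).2 (memLp_flipScale (hmem _).memLp)).const_mul _
  let T := W ∘L I
  have hsum : HasSum (fun x => α x • T (lp.single 2 x 1)) (T α) := by
    have h := (lp.hasSum_single (p := 2) (by norm_num) α).mapL T
    have hfun : (fun x => α x • T (lp.single 2 x 1)) =
        fun x => T (lp.single 2 x (α x)) := by
      ext1 x
      rw [← map_smul, ← lp.single_smul, smul_eq_mul, mul_one]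
    rw [hfun]
    exact h
  let D : Finset X → Lp ℂ 2 (volume : Measure E) := fun F =>
    T α - ∑ x ∈ F, α x • T (lp.single 2 x 1)
  have hD : Tendsto (fun F => ‖D F‖ₑ) atTop (𝓝 0) := by
    have h1 : Tendsto (fun F => ∑ x ∈ F, α x • T (lp.single 2 x 1)) atTop (𝓝 (T α)) := hsum
    have h2 : Tendsto D atTop (𝓝 0) := by
      have := (tendsto_const_nhds (x := T α)).sub h1
      rwa [sub_self] at this
    have h3 := h2.enorm
    rwa [enorm_zero] at h3
  refine hD.congr fun F => ?_
  rw [Lp.enorm_def, ← eLpNorm_flipScale (Lp.memLp _)]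
  refine eLpNorm_congr_ae ?_
  have e1 : ∀ᵐ y, ∀ x ∈ F, invFourierL2 (L x) y =
      flipScale (sobolevRep k (I (lp.single 2 x 1))) y := by
    rw [Finset.eventually_all]
    exact fun x _ => hae x
  have e2 : (D F : E → ℂ) =ᵐ[volume] fun ξ => sobolevRep k (I α) ξ -
      ∑ x ∈ F, α x * sobolevRep k (I (lp.single 2 x 1)) ξ := by
    have e3 : ∀ᵐ ξ, ∀ x ∈ F, (α x • T (lp.single 2 x 1) : Lp ℂ 2 (volume : Measure E)) ξ =
        α x * sobolevRep k (I (lp.single 2 x 1)) ξ := by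
      rw [Finset.eventually_all]
      intro x _
      filter_upwards [Lp.coeFn_smul (α x) (T (lp.single 2 x 1)), hW (I (lp.single 2 x 1))]
        with ξ h1 h2
      rw [h1, Pi.smul_apply, smul_eq_mul]
      congr 1
    filter_upwards [e3, Lp.coeFn_sub (T α) (∑ x ∈ F, α x • T (lp.single 2 x 1)),
      lp_coeFn_finset_sum F (fun x => α x • T (lp.single 2 x 1)), hW (I α)] with ξ h1 h2 h3 h4
    simp only [D]
    rw [h2, Pi.sub_apply, h3, show (T α : Lp ℂ 2 (volume : Measure E)) ξ = _ from h4]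
    congr 1
    exact Finset.sum_congr rfl h1
  filter_upwards [e1, flipScale_ae_congr e2] with y h1 h2
  rw [h2, flipScale, flipScale, mul_sub, Finset.mul_sum]
  congr 1
  refine Finset.sum_congr rfl fun x hx => ?_
  rw [h1 x hx, flipScale]
  ring

/-- The error of spline interpolation of a band-limited function. Both the Poincaré inequality
and the Galerkin orthogonality enter: since the error `v` vanishes on the knots, its
energy `⟨D^k v, v⟩` is the inner product of `v` with `D^k` of the interpolated function; this
doubles the order. -/
theorem eLpNorm_interpolation_error_le {C : ℝ} (hC : 0 < C)
    (hP : ∀ h : ℝ, 0 < h → ∀ Φ : E → ℂ, MemFourierSobolev k Φ →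
      (∀ a, ∃ z, dist a z ≤ h ∧ 𝓕⁻ Φ z = 0) →
      ∫ ξ, ‖Φ ξ‖ ^ 2 ≤ (C * h) ^ (2 * k) * ∫ ξ, (2 * Real.pi * ‖ξ‖) ^ (2 * k) * ‖Φ ξ‖ ^ 2)
    (hk : Module.finrank ℝ E < 2 * k) (hε : 0 ≤ ε) {lam : ℝ} (hlam : 0 < lam)
    (hX : IsKnotSet lam X) (hS : ∀ g (x : X), S g x = inner ℂ (evalVec k hk (x : E)) g)
    (hSI : ∀ α, S (I α) = α)
    (hI : ∀ α, ∃ b, energyOp k hε (I α) = ContinuousLinearMap.adjoint S b)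
    {σ : ℝ} (g : Lp ℂ 2 (volume : Measure E))
    (hg : ∀ᵐ ξ, sobolevRep k g ξ ≠ 0 → 2 * Real.pi * ‖ξ‖ ≤ σ) :
    eLpNorm (sobolevRep k (g - I (S g) : Lp ℂ 2 (volume : Measure E))) 2 volume ≤
      ENNReal.ofReal ((C * lam) ^ (2 * k) * (σ ^ 2 + ε) ^ k) *
        eLpNorm (sobolevRep k g) 2 volume := by
  obtain ⟨W, hW⟩ := exists_sobolevEmbedding (E := E) k
  set v := g - I (S g) with hv
  have hΦ := memFourierSobolev_lp k v
  have hSv : S v = 0 := by rw [hv, map_sub, hSI, sub_self]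
  have h1 := hP lam hlam _ hΦ fun a => by
    obtain ⟨x, hx, hd⟩ := hX.exists_dist_le a
    refine ⟨x, hd, ?_⟩
    rw [← inner_evalVec k hk, ← hS v ⟨x, hx⟩, hSv]
    rfl
  have h2 := integral_pow_mul_le_integral_symbol hΦ hε
  have hinner : inner ℂ (energyOp k hε v) v = inner ℂ (energyOp k hε g) v := by
    obtain ⟨b, hb⟩ := hI (S g)
    rw [hv, map_sub, inner_sub_left, ← hv, hb, ContinuousLinearMap.adjoint_inner_left, hSv,
      inner_zero_right, sub_zero]
  have hWn : ∀ f : Lp ℂ 2 (volume : Measure E), ‖W f‖ ^ 2 = ∫ ξ, ‖sobolevRep k f ξ‖ ^ 2 :=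
    fun f => by
      rw [norm_sq_lp_eq_integral]
      refine integral_congr_ae ?_
      filter_upwards [hW f] with ξ hξ
      rw [hξ]
  let M := (σ ^ 2 + ε) ^ k
  have hM0 : 0 ≤ M := by positivity
  -- `D^k` of a band-limited function is bounded by its size
  have hbd : ∀ᵐ ξ, ‖((symbol ε ξ ^ k : ℝ) : ℂ) * sobolevRep k g ξ‖ ≤ M * ‖W g ξ‖ := by
    filter_upwards [hg, hW g] with ξ hξ hw
    rw [hw, norm_mul, Complex.norm_real,
      Real.norm_of_nonneg (pow_nonneg (symbol_nonneg hε ξ) k)]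
    by_cases h0 : sobolevRep k g ξ = 0
    · simp [h0]
    · gcongr
      refine pow_le_pow_left₀ (symbol_nonneg hε ξ) ?_ k
      unfold symbol
      have := hξ h0
      gcongr
  have hmem : MemLp (fun ξ => ((symbol ε ξ ^ k : ℝ) : ℂ) * sobolevRep k g ξ) 2 :=
    MemLp.of_le_mul (Lp.memLp (W g)) ((Continuous.aestronglyMeasurable (by fun_prop)).mul
      (memFourierSobolev_lp k g).aestronglyMeasurable) hbd
  have hnorm : ‖hmem.toLp‖ ≤ M * ‖W g‖ := by
    refine Lp.norm_le_mul_norm_of_ae_le_mul ?_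
    filter_upwards [hbd, hmem.coeFn_toLp] with ξ h3 h4
    rw [h4]
    exact h3
  have hinner2 : inner ℂ (energyOp k hε g) v = inner ℂ hmem.toLp (W v) := by
    rw [inner_energyOp, L2.inner_def]
    refine integral_congr_ae ?_
    filter_upwards [hmem.coeFn_toLp, hW v] with ξ h3 h4
    rw [h3, h4, RCLike.inner_apply, mul_comm]
  have h3 : ∫ ξ, symbol ε ξ ^ k * ‖sobolevRep k v ξ‖ ^ 2 ≤ M * ‖W g‖ * ‖W v‖ := by
    have h4 := norm_inner_le_norm (𝕜 := ℂ) hmem.toLp (W v)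
    rw [← hinner2, ← hinner, inner_energyOp_self, Complex.norm_real] at h4
    exact (Real.le_norm_self _).trans
      (h4.trans (mul_le_mul_of_nonneg_right hnorm (norm_nonneg _)))
  have h4 : ‖W v‖ * ‖W v‖ ≤ (C * lam) ^ (2 * k) * M * ‖W g‖ * ‖W v‖ := by
    rw [← pow_two, hWn v]
    calc _ ≤ _ := h1
      _ ≤ (C * lam) ^ (2 * k) * (M * ‖W g‖ * ‖W v‖) := by
        gcongr
        exact h2.trans h3
      _ = _ := by ring
  have h5 : ‖W v‖ ≤ (C * lam) ^ (2 * k) * M * ‖W g‖ := by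
    rcases (norm_nonneg (W v)).eq_or_lt with h0 | h0
    · rw [← h0]
      positivity
    · exact le_of_mul_le_mul_right h4 h0
  rw [← eLpNorm_congr_ae (hW v), ← eLpNorm_congr_ae (hW g), ← Lp.enorm_def, ← Lp.enorm_def,
    ← ofReal_norm, ← ofReal_norm, ← ENNReal.ofReal_mul (by positivity)]
  exact ENNReal.ofReal_le_ofReal h5

end Reconstruction

/-! ### The Radon transform -/

section Radon

variable {E : Type*} [NormedAddCommGroup E] [InnerProductSpace ℝ E] [FiniteDimensional ℝ E]
  [MeasurableSpace E] [BorelSpace E]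

/-- Cartesian coordinates with first axis `θ`. -/
theorem measurePreserving_axis {θ : E} (hθ : ‖θ‖ = 1) :
    MeasurePreserving (fun p : ℝ × (ℝ ∙ θ)ᗮ => p.1 • θ + (p.2 : E)) volume volume := by
  have h1 := (LinearIsometryEquiv.toSpanUnitSingleton (𝕜 := ℝ) θ hθ).measurePreserving
  have h2 : MeasurePreserving (Prod.map (LinearIsometryEquiv.toSpanUnitSingleton (𝕜 := ℝ) θ hθ)
      (id : (ℝ ∙ θ)ᗮ → (ℝ ∙ θ)ᗮ)) volume volume := h1.prod (MeasurePreserving.id _)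
  have h3 := WithLp.volume_preserving_toLp (ℝ ∙ θ) (ℝ ∙ θ)ᗮ
  have h4 := ((ℝ ∙ θ).orthogonalDecomposition.symm).measurePreserving
  have h5 := h4.comp (h3.comp h2)
  have h6 : (fun p : ℝ × (ℝ ∙ θ)ᗮ => p.1 • θ + (p.2 : E)) =
      (ℝ ∙ θ).orthogonalDecomposition.symm ∘ WithLp.toLp 2 ∘
        Prod.map (LinearIsometryEquiv.toSpanUnitSingleton (𝕜 := ℝ) θ hθ) id := by
    funext p
    simp
  rw [h6]
  exact h5

theorem norm_axis_sq {θ : E} (hθ : ‖θ‖ = 1) (s : ℝ) (y : (ℝ ∙ θ)ᗮ) :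
    ‖s • θ + (y : E)‖ ^ 2 = s ^ 2 + ‖y‖ ^ 2 := by
  have h : ⟪s • θ, (y : E)⟫ = 0 := by
    rw [inner_smul_left, Submodule.mem_orthogonal_singleton_iff_inner_right.1 y.2, mul_zero]
  rw [pow_two, norm_add_sq_eq_norm_sq_add_norm_sq_real h, norm_smul, hθ, mul_one,
    Submodule.coe_norm, Real.norm_eq_abs, abs_mul_abs_self]
  ring

theorem inner_axis {θ : E} (hθ : ‖θ‖ = 1) (s : ℝ) (y : (ℝ ∙ θ)ᗮ) :
    ⟪θ, s • θ + (y : E)⟫ = s := by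
  rw [inner_add_right, inner_smul_right, Submodule.mem_orthogonal_singleton_iff_inner_right.1 y.2,
    real_inner_self_eq_norm_sq, hθ]
  ring

theorem integrable_radon {φ : E → ℂ} (hφ : Integrable φ) {θ : E} (hθ : ‖θ‖ = 1) :
    Integrable (radon φ θ) := by
  have h := (measurePreserving_axis hθ).integrable_comp_of_integrable hφ
  exact Integrable.integral_prod_left h

/-- The Fourier slice theorem. -/
theorem integral_radon_mul_exp {φ : E → ℂ} (hφ : Integrable φ) {θ : E} (hθ : ‖θ‖ = 1) (τ : ℝ) :
    ∫ s, radon φ θ s * Complex.exp (-Complex.I * ((s * τ : ℝ) : ℂ)) =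
      ∫ x, φ x * Complex.exp (-Complex.I * ((⟪θ, x⟫ * τ : ℝ) : ℂ)) := by
  have hint : Integrable fun x => φ x * Complex.exp (-Complex.I * ((⟪θ, x⟫ * τ : ℝ) : ℂ)) := by
    refine hφ.mul_bdd (c := 1) (Continuous.aestronglyMeasurable (by fun_prop))
      (Eventually.of_forall fun x => ?_)
    rw [show -Complex.I * ((⟪θ, x⟫ * τ : ℝ) : ℂ) = ((-(⟪θ, x⟫ * τ) : ℝ) : ℂ) * Complex.I by
      push_cast; ring, Complex.norm_exp_ofReal_mul_I]
  have hmp := measurePreserving_axis hθ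
  have h : Integrable (fun p : ℝ × (ℝ ∙ θ)ᗮ => φ (p.1 • θ + (p.2 : E)) *
      Complex.exp (-Complex.I * ((⟪θ, p.1 • θ + (p.2 : E)⟫ * τ : ℝ) : ℂ)))
      ((volume : Measure ℝ).prod volume) := hmp.integrable_comp_of_integrable hint
  rw [← hmp.map_eq, integral_map hmp.measurable.aemeasurable (by rw [hmp.map_eq]; exact hint.1),
    Measure.volume_eq_prod, integral_prod _ h]
  refine integral_congr_ae (Eventually.of_forall fun s => ?_)
  simp only [inner_axis hθ, radon]
  rw [integral_mul_const]

theorem radonHat_eq {φ : E → ℂ} (hφ : Integrable φ) {θ : E} (hθ : ‖θ‖ = 1) (τ : ℝ) :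
    radonHat φ θ τ = (((2 * Real.pi) ^ (-(1 : ℝ) / 2) : ℝ) : ℂ) *
      ∫ x, φ x * Complex.exp (-Complex.I * ((⟪θ, x⟫ * τ : ℝ) : ℂ)) := by
  rw [radonHat, fourierLine, integral_radon_mul_exp hφ hθ]

/-- The function whose inverse Fourier transform, in the normalization of Mathlib, is the Fourier
transform of `φ` in the normalization of the statement. -/
noncomputable def unflipScale (φ : E → ℂ) (y : E) : ℂ :=
  (((2 * Real.pi) ^ ((Module.finrank ℝ E : ℝ) / 2) : ℝ) : ℂ) * φ (-((2 * Real.pi) • y))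

theorem flipScale_unflipScale (φ : E → ℂ) : flipScale (unflipScale φ) = φ := by
  ext x
  have hp : 0 < 2 * Real.pi := by positivity
  rw [flipScale, unflipScale, ← mul_assoc, ← Complex.ofReal_mul, ← Real.rpow_add hp, smul_neg,
    smul_smul, mul_inv_cancel₀ hp.ne', one_smul, neg_neg, neg_div, neg_add_cancel, Real.rpow_zero,
    Complex.ofReal_one, one_mul]

theorem two_pi_norm_le_of_unflipScale_ne_zero {φ : E → ℂ} {σ : ℝ}
    (hs : Function.support φ ⊆ Metric.closedBall 0 σ) {y : E} (hy : unflipScale φ y ≠ 0) :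
    2 * Real.pi * ‖y‖ ≤ σ := by
  have h := hs (show -((2 * Real.pi) • y) ∈ Function.support φ from (mul_ne_zero_iff.1 hy).2)
  rw [mem_closedBall_zero_iff, norm_neg, norm_smul, Real.norm_of_nonneg (by positivity)] at h
  exact h

/-- The Fourier slice theorem: the transformed Radon transform of `φ` at `(θ, τ)` is the Fourier
transform of `φ` at `τ θ`. -/
theorem fourierInv_unflipScale {φ : E → ℂ} (hφ : Integrable φ) {θ : E} (hθ : ‖θ‖ = 1) (τ : ℝ) :
    𝓕⁻ (unflipScale φ) (τ • θ) =
      (((2 * Real.pi) ^ ((1 - (Module.finrank ℝ E : ℝ)) / 2) : ℝ) : ℂ) * radonHat φ θ τ := by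
  have hp : 0 < 2 * Real.pi := by positivity
  have h1 : ∀ y : E, Complex.exp (((2 * Real.pi * ⟪y, τ • θ⟫ : ℝ) : ℂ) * Complex.I) •
      unflipScale φ y = (((2 * Real.pi) ^ ((Module.finrank ℝ E : ℝ) / 2) : ℝ) : ℂ) *
        (fun x => φ x * Complex.exp (-Complex.I * ((⟪θ, x⟫ * τ : ℝ) : ℂ)))
          ((-(2 * Real.pi)) • y) := by
    intro y
    have h2 : ((2 * Real.pi * ⟪y, τ • θ⟫ : ℝ) : ℂ) * Complex.I =
        -Complex.I * ((⟪θ, (-(2 * Real.pi)) • y⟫ * τ : ℝ) : ℂ) := by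
      rw [inner_smul_right, inner_smul_right, real_inner_comm]
      push_cast
      ring
    rw [h2, unflipScale, smul_eq_mul, neg_smul]
    ring
  rw [radonHat_eq hφ hθ, Real.fourierInv_eq']
  simp only [h1]
  rw [integral_const_mul, Measure.integral_comp_smul (volume : Measure E)
    (fun x => φ x * Complex.exp (-Complex.I * ((⟪θ, x⟫ * τ : ℝ) : ℂ))), Complex.real_smul,
    ← mul_assoc, ← mul_assoc,
    ← Complex.ofReal_mul, ← Complex.ofReal_mul, ← Real.rpow_add hp]
  congr 2
  rw [abs_inv, abs_pow, abs_neg, abs_of_pos hp, ← Real.rpow_natCast, ← Real.rpow_neg hp.le,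
    ← Real.rpow_add hp]
  congr 1
  ring

theorem hasCompactSupport_of_support_subset {φ : E → ℂ} {σ : ℝ}
    (hs : Function.support φ ⊆ Metric.closedBall 0 σ) : HasCompactSupport φ :=
  HasCompactSupport.of_support_subset_isCompact (isCompact_closedBall 0 σ) hs

/-- The function `unflipScale φ` is smooth with compact support. -/
theorem exists_schwartz_unflipScale {φ : E → ℂ} (hφ : ContDiff ℝ (⊤ : ℕ∞) φ) {σ : ℝ}
    (hs : Function.support φ ⊆ Metric.closedBall 0 σ) :
    ∃ ψ : 𝓢(E, ℂ), (ψ : E → ℂ) = unflipScale φ := by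
  have hc : HasCompactSupport (unflipScale φ) := by
    refine HasCompactSupport.of_support_subset_isCompact
      (isCompact_closedBall 0 (σ / (2 * Real.pi))) fun y hy => ?_
    rw [mem_closedBall_zero_iff, le_div_iff₀ (by positivity), mul_comm]
    exact two_pi_norm_le_of_unflipScale_ne_zero hs hy
  have hd : ContDiff ℝ (⊤ : ℕ∞) (unflipScale φ) :=
    contDiff_const.mul (hφ.comp (contDiff_const_smul _).neg)
  exact ⟨hc.toSchwartzMap hd, rfl⟩

theorem radon_eq_zero {φ : E → ℂ} {σ : ℝ} (hs : Function.support φ ⊆ Metric.closedBall 0 σ)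
    {θ : E} (hθ : ‖θ‖ = 1) {s : ℝ} (h : σ < |s|) : radon φ θ s = 0 := by
  refine integral_eq_zero_of_ae (Eventually.of_forall fun y => ?_)
  by_contra hne
  have h1 := mem_closedBall_zero_iff.1 (hs hne)
  have h2 := norm_axis_sq hθ s y
  have h3 : |s| ^ 2 ≤ σ ^ 2 := by
    rw [sq_abs]
    nlinarith [norm_nonneg (s • θ + (y : E)), sq_nonneg ‖y‖]
  exact absurd (abs_le_of_sq_le_sq' h3 ((norm_nonneg _).trans h1)).2 (not_le.2 h)

theorem continuous_radon {φ : E → ℂ} (hφ : Continuous φ) {σ : ℝ}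
    (hs : Function.support φ ⊆ Metric.closedBall 0 σ) {θ : E} (hθ : ‖θ‖ = 1) :
    Continuous (radon φ θ) := by
  obtain ⟨B, hB⟩ := hφ.bounded_above_of_compact_support (hasCompactSupport_of_support_subset hs)
  have hB0 : 0 ≤ B := (norm_nonneg _).trans (hB 0)
  refine continuous_of_dominated (bound := (Metric.closedBall (0 : (ℝ ∙ θ)ᗮ) σ).indicator
    fun _ => B) (fun s => Continuous.aestronglyMeasurable (by fun_prop))
    (fun s => Eventually.of_forall fun y => ?_) ?_
    (Eventually.of_forall fun y => by fun_prop)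
  · by_cases hne : φ (s • θ + (y : E)) = 0
    · rw [hne, norm_zero]
      exact indicator_nonneg (fun _ _ => hB0) _
    · rw [indicator_of_mem]
      · exact hB _
      · have h1 := mem_closedBall_zero_iff.1 (hs hne)
        rw [mem_closedBall_zero_iff]
        have h2 := norm_axis_sq hθ s y
        refine le_trans (abs_le_of_sq_le_sq' ?_ (norm_nonneg _)).2 h1
        nlinarith [sq_nonneg s]
  · exact (integrable_indicator_iff measurableSet_closedBall).2
      (integrableOn_const measure_closedBall_lt_top.ne)

/-- The Radon transform of a test function in a fixed direction is a test function. -/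
theorem exists_schwartz_radon {φ : E → ℂ} (hφ : ContDiff ℝ (⊤ : ℕ∞) φ) {σ : ℝ}
    (hs : Function.support φ ⊆ Metric.closedBall 0 σ) {θ : E} (hθ : ‖θ‖ = 1) :
    ∃ ψ : 𝓢(ℝ, ℂ), (ψ : ℝ → ℂ) = radon φ θ := by
  have hc := hasCompactSupport_of_support_subset hs
  have hi : Integrable φ := hφ.continuous.integrable_of_hasCompactSupport hc
  let φ' : 𝓢(E, ℂ) := hc.toSchwartzMap hφ
  have hanti : AntilipschitzWith 1 fun τ : ℝ => τ • θ :=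
    AddMonoidHomClass.antilipschitz_of_bound (LinearMap.toSpanSingleton ℝ E θ) fun τ => by
      simp [norm_smul, hθ]
  let χ : 𝓢(ℝ, ℂ) := SchwartzMap.compCLMOfAntilipschitz ℂ
    (ContinuousLinearMap.toSpanSingleton ℝ θ).hasTemperateGrowth hanti (𝓕 φ')
  have hχ : (χ : ℝ → ℂ) = 𝓕 (radon φ θ) := by
    ext τ
    have h1 : χ τ = 𝓕 φ (τ • θ) := rfl
    rw [h1, Real.fourier_eq', Real.fourier_eq']
    have h2 := integral_radon_mul_exp hi hθ (2 * Real.pi * τ)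
    refine Eq.trans ?_ (h2.symm.trans ?_)
    · refine integral_congr_ae (Eventually.of_forall fun x => ?_)
      simp only [smul_eq_mul, inner_smul_right, real_inner_comm x θ]
      rw [mul_comm]
      congr 2
      push_cast
      ring
    · refine integral_congr_ae (Eventually.of_forall fun s => ?_)
      simp only [smul_eq_mul, RCLike.inner_apply, conj_trivial]
      rw [mul_comm]
      congr 2
      push_cast
      ring
  refine ⟨𝓕⁻ χ, ?_⟩
  rw [SchwartzMap.fourierInv_coe, hχ]
  exact (continuous_radon hφ.continuous hs hθ).fourierInv_fourier_eq (integrable_radon hi hθ)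
    (hχ ▸ χ.integrable)

/-- The function whose `L²` norm is `‖Rφ‖` is a multiple of the Fourier transform of `φ`. The origin
is excepted, as it has no direction. -/
theorem radonHat_polar_ae [Nontrivial E] {φ : E → ℂ} (hφ : Integrable φ) :
    (fun ξ : E => radonHat φ (‖ξ‖⁻¹ • ξ) ‖ξ‖) =ᵐ[volume] fun ξ =>
      (((2 * Real.pi) ^ (((Module.finrank ℝ E : ℝ) - 1) / 2) : ℝ) : ℂ) *
        𝓕⁻ (unflipScale φ) ξ := by
  have hp : 0 < 2 * Real.pi := by positivity
  have h0 : ∀ᵐ ξ : E, ξ ≠ 0 := by simp [ae_iff]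
  filter_upwards [h0] with ξ hξ
  have h1 : ‖‖ξ‖⁻¹ • ξ‖ = 1 := norm_smul_inv_norm (𝕜 := ℝ) hξ
  have h2 := fourierInv_unflipScale hφ h1 ‖ξ‖
  rw [smul_smul, mul_inv_cancel₀ (norm_ne_zero_iff.2 hξ), one_smul] at h2
  rw [h2, ← mul_assoc, ← Complex.ofReal_mul, ← Real.rpow_add hp]
  ring_nf
  simp

theorem radonNorm_ne_top [Nontrivial E] {φ : E → ℂ} (hφ : ContDiff ℝ (⊤ : ℕ∞) φ) {σ : ℝ}
    (hs : Function.support φ ⊆ Metric.closedBall 0 σ) : radonNorm φ ≠ ⊤ := by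
  have hi : Integrable φ := hφ.continuous.integrable_of_hasCompactSupport
    (hasCompactSupport_of_support_subset hs)
  obtain ⟨ψ, hψ⟩ := exists_schwartz_unflipScale hφ hs
  rw [radonNorm, eLpNorm_congr_ae (radonHat_polar_ae hi), ← hψ]
  exact ((memLp_fourierInv ψ.integrable (ψ.memLp 2)).const_mul _).eLpNorm_ne_top

/-- Plancherel's theorem, where the normalization gives `‖φ‖ = (2π)^{(1-n)/2} ‖Rφ‖`. -/
theorem eLpNorm_le_radonNorm [Nontrivial E] {φ : E → ℂ} (hφ : ContDiff ℝ (⊤ : ℕ∞) φ) {σ : ℝ}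
    (hs : Function.support φ ⊆ Metric.closedBall 0 σ) : eLpNorm φ 2 volume ≤ radonNorm φ := by
  have hi : Integrable φ := hφ.continuous.integrable_of_hasCompactSupport
    (hasCompactSupport_of_support_subset hs)
  obtain ⟨ψ, hψ⟩ := exists_schwartz_unflipScale hφ hs
  rw [radonNorm, eLpNorm_congr_ae (radonHat_polar_ae hi), ← hψ]
  conv_lhs => rw [← flipScale_unflipScale φ, ← hψ]
  rw [eLpNorm_flipScale (ψ.memLp 2), ← eLpNorm_fourierInv ψ.integrable (ψ.memLp 2)]
  refine eLpNorm_mono fun ξ => ?_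
  rw [norm_mul, Complex.norm_real, Real.norm_of_nonneg (by positivity)]
  refine le_mul_of_one_le_left (norm_nonneg _) (Real.one_le_rpow ?_ ?_)
  · linarith [Real.pi_gt_three]
  · have : (1 : ℝ) ≤ Module.finrank ℝ E := by exact_mod_cast Module.finrank_pos (R := ℝ) (M := E)
    linarith

end Radon

/-! ### First moments -/

section Moments

variable {E : Type*} [NormedAddCommGroup E] [InnerProductSpace ℝ E] [FiniteDimensional ℝ E]
  [MeasurableSpace E] [BorelSpace E]

theorem fourierInv_comp_sub (Φ : E → ℂ) (η x : E) :
    𝓕⁻ (fun ξ => Φ (ξ - η)) x =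
      Complex.exp (((2 * Real.pi * ⟪η, x⟫ : ℝ) : ℂ) * Complex.I) * 𝓕⁻ Φ x := by
  rw [Real.fourierInv_eq', Real.fourierInv_eq', ← integral_const_mul,
    ← integral_add_right_eq_self _ η]
  refine integral_congr_ae (Eventually.of_forall fun ξ => ?_)
  simp only [add_sub_cancel_right, inner_add_left, smul_eq_mul]
  rw [← mul_assoc, ← Complex.exp_add]
  congr 2
  push_cast
  ring

theorem fourierInv_const_mul_sub {Φ Ψ : E → ℂ} (hΦ : Integrable Φ) (hΨ : Integrable Ψ) (c : ℂ)
    (x : E) : 𝓕⁻ (fun ξ => c * Φ ξ - Ψ ξ) x = c * 𝓕⁻ Φ x - 𝓕⁻ Ψ x := by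
  simp only [Real.fourierInv_eq', smul_eq_mul, mul_sub]
  rw [integral_sub, ← integral_const_mul]
  · congr 2
    ext ξ
    ring
  · exact (hΦ.const_mul c).bdd_mul (c := 1)
      (Continuous.aestronglyMeasurable (by fun_prop)) (Eventually.of_forall fun ξ => by
        rw [Complex.norm_exp_ofReal_mul_I])
  · exact hΨ.bdd_mul (c := 1)
      (Continuous.aestronglyMeasurable (by fun_prop)) (Eventually.of_forall fun ξ => by
        rw [Complex.norm_exp_ofReal_mul_I])

theorem sobolevWeight_le_mul (k : ℕ) (ξ η : E) :
    sobolevWeight k ξ ≤ √(2 * symbol 1 η) ^ k * sobolevWeight k (ξ - η) := by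
  unfold sobolevWeight
  rw [← mul_pow, ← Real.sqrt_mul (mul_nonneg zero_le_two (symbol_one_pos η).le)]
  gcongr
  linarith [symbol_one_le_mul ξ η]

theorem MemFourierSobolev.comp_sub {k : ℕ} {Φ : E → ℂ} (h : MemFourierSobolev k Φ) (η : E) :
    MemFourierSobolev k fun ξ => Φ (ξ - η) := by
  have hmp := measurePreserving_sub_right (volume : Measure E) η
  have h1 := h.comp_measurePreserving hmp
  refine h1.of_le_mul (c := √(2 * symbol 1 η) ^ k) ((Continuous.aestronglyMeasurable
    (by fun_prop)).mul (h.aestronglyMeasurable.comp_measurePreserving hmp))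
    (Eventually.of_forall fun ξ => ?_)
  simp only [Function.comp_apply, norm_mul, Complex.norm_real]
  rw [Real.norm_of_nonneg (sobolevWeight_pos k _).le,
    Real.norm_of_nonneg (sobolevWeight_pos k _).le,
    ← mul_assoc]
  gcongr
  exact sobolevWeight_le_mul k ξ η

theorem MemFourierSobolev.const_mul {k : ℕ} {Φ : E → ℂ} (h : MemFourierSobolev k Φ) (c : ℂ) :
    MemFourierSobolev k fun ξ => c * Φ ξ := by
  refine (MemLp.const_mul h c).congr_norm ?_ (Eventually.of_forall fun ξ => ?_)
  · exact (Continuous.aestronglyMeasurable (by fun_prop)).mul (h.aestronglyMeasurable.const_mul c)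
  · simp only [norm_mul]
    ring

theorem MemFourierSobolev.sub {k : ℕ} {Φ Ψ : E → ℂ} (h : MemFourierSobolev k Φ)
    (h' : MemFourierSobolev k Ψ) : MemFourierSobolev k fun ξ => Φ ξ - Ψ ξ := by
  refine (MemLp.sub h h').congr_norm ?_ (Eventually.of_forall fun ξ => ?_)
  · exact (Continuous.aestronglyMeasurable (by fun_prop)).mul
      (h.aestronglyMeasurable.sub h'.aestronglyMeasurable)
  · simp only [Pi.sub_apply, mul_sub]

/-- The symbol of `D^k` is Lipschitz, relative to the weight of `H^k`. -/
theorem exists_abs_symbol_pow_sub_le (k : ℕ) {ε : ℝ} (hε : 0 ≤ ε) :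
    ∃ K, 0 ≤ K ∧ ∀ ξ η : E, ‖η‖ ≤ 1 → |symbol ε ξ ^ k - symbol ε (ξ - η) ^ k| ≤
      K * ‖η‖ * (sobolevWeight k (ξ - η) * sobolevWeight k ξ) := by
  let L : ℝ := 2 * ((2 * Real.pi) ^ 2 + 1)
  let B := max 1 ε
  have hB : 0 ≤ B := zero_le_one.trans (le_max_left _ _)
  refine ⟨4 * Real.pi * k * B ^ (k - 1) * √L ^ k, by positivity, fun ξ η hη => ?_⟩
  set s₁ := symbol 1 ξ with hs₁
  set s₂ := symbol 1 (ξ - η) with hs₂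
  have h1 : 1 ≤ s₁ := one_le_symbol_one ξ
  have h2 : 1 ≤ s₂ := one_le_symbol_one (ξ - η)
  have hL := symbol_one_le_of_norm_le_one hη
  have h12 : s₁ ≤ L * s₂ := by
    have := symbol_one_le_mul ξ η
    have h3 : s₂ * symbol 1 η ≤ s₂ * ((2 * Real.pi) ^ 2 + 1) := by gcongr
    simp only [L]
    linarith
  have h21 : s₂ ≤ L * s₁ := by
    have := symbol_one_sub_le_mul ξ η
    have h3 : s₁ * symbol 1 η ≤ s₁ * ((2 * Real.pi) ^ 2 + 1) := by gcongr
    simp only [L]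
    linarith
  set t := max √s₁ √s₂ with ht
  have ht1 : 1 ≤ t := (Real.one_le_sqrt.2 h1).trans (le_max_left _ _)
  have hL1 : 1 ≤ L := by
    simp only [L]
    nlinarith [sq_nonneg (2 * Real.pi)]
  have ht2 : t ^ 2 ≤ √L * (√s₂ * √s₁) := by
    rw [← Real.sqrt_mul (by linarith), ← Real.sqrt_mul (by linarith)]
    refine Real.le_sqrt_of_sq_le ?_
    rcases max_choice √s₁ √s₂ with h | h
    · rw [ht, h, Real.sq_sqrt (by linarith)]
      nlinarith
    · rw [ht, h, Real.sq_sqrt (by linarith)]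
      nlinarith
  have hs₁t : s₁ ≤ t ^ 2 := by
    rw [← Real.sq_sqrt (show 0 ≤ s₁ by linarith)]
    gcongr
    exact le_max_left _ _
  have hs₂t : s₂ ≤ t ^ 2 := by
    rw [← Real.sq_sqrt (show 0 ≤ s₂ by linarith)]
    gcongr
    exact le_max_right _ _
  have hnorm : ∀ ζ : E, 2 * Real.pi * ‖ζ‖ ≤ √(symbol 1 ζ) := fun ζ => by
    refine Real.le_sqrt_of_sq_le ?_
    unfold symbol
    linarith
  have hdiff : |symbol ε ξ - symbol ε (ξ - η)| ≤ 4 * Real.pi * ‖η‖ * t := by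
    have e1 : symbol ε ξ - symbol ε (ξ - η) =
        2 * Real.pi * ((‖ξ‖ - ‖ξ - η‖) * (2 * Real.pi * ‖ξ‖ + 2 * Real.pi * ‖ξ - η‖)) := by
      unfold symbol
      ring
    have e2 : |‖ξ‖ - ‖ξ - η‖| ≤ ‖η‖ := by
      have := abs_norm_sub_norm_le ξ (ξ - η)
      rwa [sub_sub_cancel] at this
    have e3 := (hnorm ξ).trans (le_max_left √s₁ √s₂)
    have e4 := (hnorm (ξ - η)).trans (le_max_right √s₁ √s₂)
    rw [e1, abs_mul (2 * Real.pi), abs_mul (‖ξ‖ - ‖ξ - η‖),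
      abs_of_pos (show 0 < 2 * Real.pi by positivity),
      abs_of_nonneg (show 0 ≤ 2 * Real.pi * ‖ξ‖ + 2 * Real.pi * ‖ξ - η‖ by positivity)]
    calc _ ≤ 2 * Real.pi * (‖η‖ * (t + t)) := by gcongr
      _ = _ := by ring
  have hpow : |symbol ε ξ ^ k - symbol ε (ξ - η) ^ k| ≤
      |symbol ε ξ - symbol ε (ξ - η)| * k * (B * t ^ 2) ^ (k - 1) := by
    refine (abs_pow_sub_pow_le _ _ k).trans ?_
    gcongr
    rw [abs_of_nonneg (symbol_nonneg hε _), abs_of_nonneg (symbol_nonneg hε _)]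
    refine max_le ?_ ?_
    · exact (symbol_le_max_mul ε ξ).trans (by gcongr)
    · exact (symbol_le_max_mul ε (ξ - η)).trans (by gcongr)
  rcases Nat.eq_zero_or_pos k with hk | hk
  · simp [hk]
  calc _ ≤ _ := hpow
    _ ≤ 4 * Real.pi * ‖η‖ * t * k * (B * t ^ 2) ^ (k - 1) := by gcongr
    _ = 4 * Real.pi * k * B ^ (k - 1) * ‖η‖ * (t * (t ^ 2) ^ (k - 1)) := by
      rw [mul_pow]
      ring
    _ ≤ 4 * Real.pi * k * B ^ (k - 1) * ‖η‖ * (√L * (√s₂ * √s₁)) ^ k := by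
      have e1 : t * (t ^ 2) ^ (k - 1) ≤ (t ^ 2) ^ k := by
        calc t * (t ^ 2) ^ (k - 1) ≤ t ^ 2 * (t ^ 2) ^ (k - 1) := by
              gcongr
              nlinarith
          _ = _ := by rw [← pow_succ', Nat.sub_one_add_one hk.ne']
      have e2 : (t ^ 2) ^ k ≤ (√L * (√s₂ * √s₁)) ^ k := by gcongr
      have := e1.trans e2
      gcongr
    _ = _ := by
      rw [mul_pow, mul_pow, sobolevWeight, sobolevWeight]
      ring

theorem MemFourierSobolev.integrable_symbol_mul_mul {k : ℕ} {Φ Ψ : E → ℂ}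
    (h : MemFourierSobolev k Φ) (h' : MemFourierSobolev k Ψ) {ε : ℝ} (hε : 0 ≤ ε) :
    Integrable fun ξ => starRingEnd ℂ (((symbol ε ξ ^ k : ℝ) : ℂ) * Φ ξ) * Ψ ξ := by
  have h1 : Integrable fun ξ => (sobolevWeight k ξ * ‖Φ ξ‖) * (sobolevWeight k ξ * ‖Ψ ξ‖) := by
    refine (MemLp.integrable_mul h.norm h'.norm).congr (Eventually.of_forall fun ξ => ?_)
    simp only [Pi.mul_apply, norm_mul, Complex.norm_real,
      Real.norm_of_nonneg (sobolevWeight_pos k ξ).le]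
  refine (h1.const_mul (max 1 ε ^ k)).mono' ?_ (Eventually.of_forall fun ξ => ?_)
  · exact (Complex.continuous_conj.comp_aestronglyMeasurable ((Continuous.aestronglyMeasurable
      (by fun_prop)).mul h.aestronglyMeasurable)).mul h'.aestronglyMeasurable
  · rw [norm_mul, RCLike.norm_conj, norm_mul, Complex.norm_real,
      Real.norm_of_nonneg (pow_nonneg (symbol_nonneg hε ξ) k)]
    have e1 : symbol ε ξ ^ k ≤ max 1 ε ^ k * sobolevWeight k ξ ^ 2 := by
      rw [sobolevWeight_sq, ← mul_pow]
      exact pow_le_pow_left₀ (symbol_nonneg hε ξ) (symbol_le_max_mul ε ξ) k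
    calc symbol ε ξ ^ k * ‖Φ ξ‖ * ‖Ψ ξ‖
        ≤ max 1 ε ^ k * sobolevWeight k ξ ^ 2 * ‖Φ ξ‖ * ‖Ψ ξ‖ := by gcongr
      _ = _ := by ring

/-- If `D^k u` agrees with `G` on the functions which vanish on `Y`, and `u` vanishes at the points
of `Y` where the modulation `c exp(2πi⟨η, ·⟩)` is not `1`, then the modulated function differs little from `u`: the
difference vanishes on `Y`, and its energy is controlled through the commutator of `D^k` and the
modulation. -/
theorem exists_translate_sub_bound {k : ℕ} (hk : Module.finrank ℝ E / 2 + 1 ≤ k) {ε : ℝ}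
    (hε : 0 ≤ ε) {h : ℝ} (hh : 0 < h) :
    ∃ A, 0 ≤ A ∧ ∀ (Y : Set E), (∀ a, ∃ z ∈ Y, dist a z ≤ h) →
      ∀ Φ G : E → ℂ, MemFourierSobolev k Φ → MemLp G 2 →
      (∀ Ψ : E → ℂ, MemFourierSobolev k Ψ → (∀ y ∈ Y, 𝓕⁻ Ψ y = 0) →
        ∫ ξ, starRingEnd ℂ (((symbol ε ξ ^ k : ℝ) : ℂ) * Φ ξ) * Ψ ξ =
          ∫ ξ, starRingEnd ℂ (G ξ) * Ψ ξ) →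
      ∀ (η : E) (c : ℂ), ‖η‖ ≤ 1 → ‖c‖ = 1 →
      (∀ y ∈ Y, 𝓕⁻ Φ y = 0 ∨
        c * Complex.exp (((2 * Real.pi * ⟪η, y⟫ : ℝ) : ℂ) * Complex.I) = 1) →
      ∫ ξ, ‖c * Φ (ξ - η) - Φ ξ‖ ^ 2 ≤ A * (‖η‖ ^ 2 * (∫ ξ, symbol 1 ξ ^ k * ‖Φ ξ‖ ^ 2) +
        ∫ ξ, ‖c * G (ξ - η) - G ξ‖ ^ 2) := by
  have hk' : Module.finrank ℝ E < 2 * k := by omega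
  obtain ⟨A, hA, hcoer⟩ := exists_sobolev_norm_le hk hε hh
  obtain ⟨K, hK, hsym⟩ := exists_abs_symbol_pow_sub_le (E := E) k hε
  refine ⟨2 * A ^ 2 * (K ^ 2 + 1), by positivity, fun Y hY Φ G hΦ hG hweak η c hη hc hvan => ?_⟩
  set Ψ : E → ℂ := fun ξ => c * Φ (ξ - η) - Φ ξ with hΨdef
  have hΦη := hΦ.comp_sub η
  have hΨ : MemFourierSobolev k Ψ := (hΦη.const_mul c).sub hΦ
  have hmp := measurePreserving_sub_right (volume : Measure E) η
  have hGη : MemLp (fun ξ => G (ξ - η)) 2 := hG.comp_measurePreserving hmp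
  have hΨvan : ∀ y ∈ Y, 𝓕⁻ Ψ y = 0 := fun y hy => by
    have h1 : 𝓕⁻ Ψ y = c * 𝓕⁻ (fun ξ => Φ (ξ - η)) y - 𝓕⁻ Φ y :=
      fourierInv_const_mul_sub (hΦη.integrable hk') (hΦ.integrable hk') c y
    rw [h1, fourierInv_comp_sub, ← mul_assoc]
    rcases hvan y hy with h | h
    · rw [h, mul_zero, sub_zero]
    · rw [h, one_mul, sub_self]
  have hΨη : MemFourierSobolev k fun ξ => Ψ (ξ + η) := by
    simpa only [sub_neg_eq_add] using hΨ.comp_sub (-η)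
  have hΨηvan : ∀ y ∈ Y, 𝓕⁻ (fun ξ => Ψ (ξ + η)) y = 0 := fun y hy => by
    have := fourierInv_comp_sub Ψ (-η) y
    simp only [sub_neg_eq_add] at this
    rw [this, hΨvan y hy, mul_zero]
  -- the equation for `Φ`, translated by `η`
  have hshift : ∫ ξ, starRingEnd ℂ (((symbol ε (ξ - η) ^ k : ℝ) : ℂ) * Φ (ξ - η)) * Ψ ξ =
      ∫ ξ, starRingEnd ℂ (G (ξ - η)) * Ψ ξ := by
    have := hweak _ hΨη hΨηvan
    rw [← integral_sub_right_eq_self _ η, ← integral_sub_right_eq_self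
      (fun ξ => starRingEnd ℂ (G ξ) * Ψ (ξ + η)) η] at this
    simpa only [sub_add_cancel] using this
  have hint1 := hΦη.integrable_symbol_mul_mul hΨ hε
  have hint2 := hΦ.integrable_symbol_mul_mul hΨ hε
  have hint3 : Integrable fun ξ =>
      starRingEnd ℂ (((symbol ε (ξ - η) ^ k : ℝ) : ℂ) * Φ (ξ - η)) * Ψ ξ := by
    have := (hΦ.integrable_symbol_mul_mul hΨη hε).comp_sub_right η
    simpa only [sub_add_cancel] using this
  have hint4 : ∀ {H : E → ℂ}, MemLp H 2 → Integrable fun ξ => starRingEnd ℂ (H ξ) * Ψ ξ :=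
    fun hH => MemLp.integrable_mul hH.star hΨ.memLp
  set J := ∫ ξ, symbol ε ξ ^ k * ‖Ψ ξ‖ ^ 2 with hJ
  have hJ1 : (J : ℂ) = starRingEnd ℂ c *
      (∫ ξ, starRingEnd ℂ (((symbol ε ξ ^ k : ℝ) : ℂ) * Φ (ξ - η)) * Ψ ξ) -
      ∫ ξ, starRingEnd ℂ (((symbol ε ξ ^ k : ℝ) : ℂ) * Φ ξ) * Ψ ξ := by
    rw [hJ, ← integral_complex_ofReal, ← integral_const_mul,
      ← integral_sub (hint1.const_mul _) hint2]
    refine integral_congr_ae (Eventually.of_forall fun ξ => ?_)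
    have e : ((symbol ε ξ ^ k * ‖Ψ ξ‖ ^ 2 : ℝ) : ℂ) =
        ((symbol ε ξ ^ k : ℝ) : ℂ) * (starRingEnd ℂ (Ψ ξ) * Ψ ξ) := by
      rw [Complex.conj_mul']
      push_cast
      rfl
    simp only [e]
    rw [show starRingEnd ℂ (Ψ ξ) = starRingEnd ℂ c * starRingEnd ℂ (Φ (ξ - η)) -
      starRingEnd ℂ (Φ ξ) by simp only [hΨdef, map_sub, map_mul], map_mul, map_mul,
      Complex.conj_ofReal]
    ring
  have hint5 : Integrable fun ξ => starRingEnd ℂ c *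
      (starRingEnd ℂ (((symbol ε ξ ^ k : ℝ) : ℂ) * Φ (ξ - η)) * Ψ ξ -
        starRingEnd ℂ (((symbol ε (ξ - η) ^ k : ℝ) : ℂ) * Φ (ξ - η)) * Ψ ξ) :=
    (hint1.sub hint3).const_mul _
  have hint6 : Integrable fun ξ => starRingEnd ℂ (c * G (ξ - η) - G ξ) * Ψ ξ :=
    hint4 ((hGη.const_mul c).sub hG)
  have hJ2 : (J : ℂ) = ∫ ξ, (starRingEnd ℂ c *
      (starRingEnd ℂ (((symbol ε ξ ^ k : ℝ) : ℂ) * Φ (ξ - η)) * Ψ ξ -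
        starRingEnd ℂ (((symbol ε (ξ - η) ^ k : ℝ) : ℂ) * Φ (ξ - η)) * Ψ ξ) +
      starRingEnd ℂ (c * G (ξ - η) - G ξ) * Ψ ξ) := by
    rw [integral_add hint5 hint6, integral_const_mul, integral_sub hint1 hint3, hshift,
      hJ1, hweak Ψ hΨ hΨvan]
    have e : ∫ ξ, starRingEnd ℂ (c * G (ξ - η) - G ξ) * Ψ ξ = starRingEnd ℂ c *
        (∫ ξ, starRingEnd ℂ (G (ξ - η)) * Ψ ξ) - ∫ ξ, starRingEnd ℂ (G ξ) * Ψ ξ := by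
      rw [← integral_const_mul, ← integral_sub ((hint4 hGη).const_mul _) (hint4 hG)]
      refine integral_congr_ae (Eventually.of_forall fun ξ => ?_)
      simp only [map_sub, map_mul]
      ring
    rw [e]
    ring
  set f : E → ℝ := fun ξ => K * ‖η‖ * (sobolevWeight k (ξ - η) * ‖Φ (ξ - η)‖) with hf
  set g : E → ℝ := fun ξ => ‖c * G (ξ - η) - G ξ‖ with hg
  set w : E → ℝ := fun ξ => sobolevWeight k ξ * ‖Ψ ξ‖ with hw
  have hW : ∀ ξ, (sobolevWeight k ξ * ‖Φ ξ‖) ^ 2 = symbol 1 ξ ^ k * ‖Φ ξ‖ ^ 2 := fun ξ => by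
    rw [mul_pow, sobolevWeight_sq]
  have hw2 : ∀ ξ, w ξ ^ 2 = symbol 1 ξ ^ k * ‖Ψ ξ‖ ^ 2 := fun ξ => by
    simp only [hw]
    rw [mul_pow, sobolevWeight_sq]
  have hf2i : Integrable fun ξ => f ξ ^ 2 := by
    simp only [hf, mul_pow (K * ‖η‖), hW]
    exact (hΦ.integrable_symbol_mul.comp_sub_right η).const_mul _
  have hf2 : ∫ ξ, f ξ ^ 2 = K ^ 2 * (‖η‖ ^ 2 * ∫ ξ, symbol 1 ξ ^ k * ‖Φ ξ‖ ^ 2) := by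
    simp only [hf, mul_pow (K * ‖η‖), hW]
    rw [integral_const_mul, integral_sub_right_eq_self (fun ξ => symbol 1 ξ ^ k * ‖Φ ξ‖ ^ 2)]
    ring
  have hg2i : Integrable fun ξ => g ξ ^ 2 :=
    (memLp_two_iff_integrable_sq_norm ((hGη.const_mul c).sub hG).1).1 ((hGη.const_mul c).sub hG)
  have hw2i : Integrable fun ξ => w ξ ^ 2 := by
    simp only [hw2]
    exact hΨ.integrable_symbol_mul
  have hJle : A * J ≤ ∫ ξ, (A ^ 2 * (f ξ ^ 2 + g ξ ^ 2) + 2⁻¹ * w ξ ^ 2) := by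
    have e1 : J ≤ ‖(J : ℂ)‖ := by
      rw [Complex.norm_real]
      exact Real.le_norm_self J
    rw [hJ2] at e1
    have e2 := mul_le_mul_of_nonneg_left e1 hA.le
    refine e2.trans ?_
    rw [← Real.norm_of_nonneg hA.le, ← Complex.norm_real, ← norm_mul, ← integral_const_mul]
    rw [Complex.norm_real, Real.norm_of_nonneg hA.le]
    refine norm_integral_le_of_norm_le (((hf2i.add hg2i).const_mul _).add (hw2i.const_mul _))
      (Eventually.of_forall fun ξ => ?_)
    have p1 : ‖starRingEnd ℂ c *
        (starRingEnd ℂ (((symbol ε ξ ^ k : ℝ) : ℂ) * Φ (ξ - η)) * Ψ ξ -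
        starRingEnd ℂ (((symbol ε (ξ - η) ^ k : ℝ) : ℂ) * Φ (ξ - η)) * Ψ ξ)‖ ≤ f ξ * w ξ := by
      rw [← sub_mul, ← map_sub, ← sub_mul, ← Complex.ofReal_sub, norm_mul, norm_mul,
        RCLike.norm_conj, RCLike.norm_conj, norm_mul, hc, one_mul, Complex.norm_real,
        Real.norm_eq_abs]
      calc _ ≤ K * ‖η‖ * (sobolevWeight k (ξ - η) * sobolevWeight k ξ) * ‖Φ (ξ - η)‖ * ‖Ψ ξ‖ := by
            gcongr
            exact hsym ξ η hη
        _ = _ := by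
          simp only [hf, hw]
          ring
    have p2 : ‖starRingEnd ℂ (c * G (ξ - η) - G ξ) * Ψ ξ‖ ≤ g ξ * w ξ := by
      rw [norm_mul, RCLike.norm_conj]
      simp only [hg]
      gcongr
      exact le_mul_of_one_le_left (norm_nonneg _) (one_le_sobolevWeight k ξ)
    have p3 := (norm_add_le _ _).trans (add_le_add p1 p2)
    rw [norm_mul, Complex.norm_real, Real.norm_of_nonneg hA.le]
    refine (mul_le_mul_of_nonneg_left p3 hA.le).trans ?_
    nlinarith [sq_nonneg (A * (f ξ + g ξ) - w ξ), sq_nonneg (A * (f ξ - g ξ))]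
  have hfg : Integrable fun ξ => A ^ 2 * (f ξ ^ 2 + g ξ ^ 2) := (hf2i.add hg2i).const_mul _
  rw [integral_add hfg (hw2i.const_mul _), integral_const_mul,
    integral_const_mul, integral_add hf2i hg2i, hf2] at hJle
  have hfin := hcoer Ψ hΨ fun a => by
    obtain ⟨z, hz, hd⟩ := hY a
    exact ⟨z, hd, hΨvan z hz⟩
  simp only [← hw2] at hfin
  have hΨh : ∫ ξ, ‖Ψ ξ‖ ^ 2 ≤ ∫ ξ, w ξ ^ 2 := by
    refine integral_mono hΨ.integrable_norm_sq hw2i fun ξ => ?_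
    simp only [hw]
    gcongr
    exact le_mul_of_one_le_left (norm_nonneg _) (one_le_sobolevWeight k ξ)
  have hW0 : 0 ≤ ‖η‖ ^ 2 * ∫ ξ, symbol 1 ξ ^ k * ‖Φ ξ‖ ^ 2 :=
    mul_nonneg (sq_nonneg _) (integral_nonneg fun ξ =>
      mul_nonneg (pow_nonneg (symbol_one_pos ξ).le k) (sq_nonneg _))
  have hg0 : 0 ≤ ∫ ξ, g ξ ^ 2 := integral_nonneg fun ξ => sq_nonneg _
  set W := ‖η‖ ^ 2 * ∫ ξ, symbol 1 ξ ^ k * ‖Φ ξ‖ ^ 2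
  calc ∫ ξ, ‖Ψ ξ‖ ^ 2 ≤ ∫ ξ, w ξ ^ 2 := hΨh
    _ ≤ 2 * A ^ 2 * (K ^ 2 * W + ∫ ξ, g ξ ^ 2) := by linarith
    _ ≤ 2 * A ^ 2 * ((K ^ 2 + 1) * (W + ∫ ξ, g ξ ^ 2)) := by
      gcongr
      nlinarith [sq_nonneg K, mul_nonneg (sq_nonneg K) hg0]
    _ = _ := by ring

/-- The derivative of a modulation in its frequency, along the frequencies `1 / (n + 1)`. -/
theorem tendsto_modulation_slope (t : ℝ) :
    Tendsto (fun n : ℕ => ((n + 1 : ℝ) : ℂ) *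
      (Complex.exp (((2 * Real.pi * (t * (1 / ((n : ℝ) + 1))) : ℝ) : ℂ) * Complex.I) - 1))
      atTop (𝓝 (((2 * Real.pi * t : ℝ) : ℂ) * Complex.I)) := by
  let z : ℂ := ((2 * Real.pi * t : ℝ) : ℂ) * Complex.I
  have h1 : HasDerivAt (fun s : ℝ => Complex.exp ((s : ℂ) * z)) z 0 := by
    have h := ((Complex.ofRealCLM.hasDerivAt (x := (0 : ℝ))).mul_const z).cexp
    simpa using h
  have h2 := h1.tendsto_slope_zero
  have h3 : Tendsto (fun n : ℕ => 1 / ((n : ℝ) + 1)) atTop (𝓝[≠] 0) :=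
    tendsto_nhdsWithin_iff.2 ⟨tendsto_one_div_add_atTop_nhds_zero_nat,
      Eventually.of_forall fun n => by
        have : (0 : ℝ) < 1 / ((n : ℝ) + 1) := by positivity
        exact this.ne'⟩
  refine (h2.comp h3).congr fun n => ?_
  simp only [Function.comp_apply, zero_add, Complex.ofReal_zero, zero_mul, Complex.exp_zero,
    one_div, inv_inv, Complex.real_smul, z]
  congr 3
  push_cast
  ring

/-- A bound for the first moment of a function `u` on the line which vanishes on `Y`, except
possibly at `γ`, and for which `D^k u` agrees with `G` on the functions vanishing on `Y`. The
modulations `exp(2πiη(x - γ))` equal `1` at `γ`, so `exists_translate_sub_bound` applies to them,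
and `η → 0` by Fatou's lemma. -/
theorem exists_moment_bound {k : ℕ} (hk : 1 ≤ k) {ε : ℝ} (hε : 0 ≤ ε) {h : ℝ}
    (hh : 0 < h) : ∃ A, 0 ≤ A ∧ ∀ (Y : Set ℝ), (∀ a, ∃ z ∈ Y, dist a z ≤ h) →
      ∀ Φ G : ℝ → ℂ, MemFourierSobolev k Φ → MemLp G 2 →
      (∀ Ψ : ℝ → ℂ, MemFourierSobolev k Ψ → (∀ y ∈ Y, 𝓕⁻ Ψ y = 0) →
        ∫ ξ, starRingEnd ℂ (((symbol ε ξ ^ k : ℝ) : ℂ) * Φ ξ) * Ψ ξ =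
          ∫ ξ, starRingEnd ℂ (G ξ) * Ψ ξ) →
      ∀ (γ M : ℝ), 0 ≤ M → (∀ η : ℝ, |η| ≤ 1 → ∫ ξ, ‖Complex.exp
        (((-(2 * Real.pi * (γ * η)) : ℝ) : ℂ) * Complex.I) * G (ξ - η) - G ξ‖ ^ 2 ≤ M * η ^ 2) →
      (∀ y ∈ Y, y ≠ γ → 𝓕⁻ Φ y = 0) →
      ∫⁻ x : ℝ, ‖((x - γ : ℝ) : ℂ) * 𝓕⁻ Φ x‖ₑ ^ 2 ≤
        ENNReal.ofReal (A * ((∫ ξ, symbol 1 ξ ^ k * ‖Φ ξ‖ ^ 2) + M)) := by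
  have hk1 : Module.finrank ℝ ℝ / 2 + 1 ≤ k := by simpa using hk
  have hk2 : Module.finrank ℝ ℝ < 2 * k := by
    rw [Module.finrank_self]
    omega
  obtain ⟨A, hA, H⟩ := exists_translate_sub_bound (E := ℝ) hk1 hε hh
  refine ⟨A, hA, fun Y hY Φ G hΦ hG hweak γ M hM hGM hvan => ?_⟩
  set W := ∫ ξ, symbol 1 ξ ^ k * ‖Φ ξ‖ ^ 2
  let q : ℕ → ℝ → ℂ := fun n t => ((n + 1 : ℝ) : ℂ) *
      (Complex.exp (((2 * Real.pi * (t * (1 / ((n : ℝ) + 1))) : ℝ) : ℂ) * Complex.I) - 1)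
  have hbound : ∀ n, ∫⁻ x : ℝ, ‖q n (x - γ) * 𝓕⁻ Φ x‖ₑ ^ 2 ≤ ENNReal.ofReal (A * (W + M)) := by
    intro n
    set η : ℝ := 1 / ((n : ℝ) + 1) with hη
    have hη0 : 0 < η := by positivity
    have hη1 : |η| ≤ 1 := by
      rw [abs_of_pos hη0, hη, div_le_one (by positivity)]
      linarith [n.cast_nonneg (α := ℝ)]
    set c := Complex.exp (((-(2 * Real.pi * (γ * η)) : ℝ) : ℂ) * Complex.I) with hc
    have hc1 : ‖c‖ = 1 := Complex.norm_exp_ofReal_mul_I _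
    have hmod : ∀ x : ℝ, c * Complex.exp (((2 * Real.pi * ⟪η, x⟫ : ℝ) : ℂ) * Complex.I) =
        Complex.exp (((2 * Real.pi * ((x - γ) * η) : ℝ) : ℂ) * Complex.I) := fun x => by
      rw [hc, ← Complex.exp_add]
      congr 1
      simp only [RCLike.inner_apply, conj_trivial]
      push_cast
      ring
    have h1 := H Y hY Φ G hΦ hG hweak η c hη1 hc1 fun y hy => by
      by_cases hyγ : y = γ
      · right
        rw [hmod, hyγ, sub_self, zero_mul, mul_zero, Complex.ofReal_zero, zero_mul,
          Complex.exp_zero]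
      · exact Or.inl (hvan y hy hyγ)
    have h2 := hGM η hη1
    have hΨ : MemFourierSobolev k fun ξ => c * Φ (ξ - η) - Φ ξ :=
      ((hΦ.comp_sub η).const_mul c).sub hΦ
    have h3 : ∫ ξ, ‖c * Φ (ξ - η) - Φ ξ‖ ^ 2 ≤ η ^ 2 * (A * (W + M)) := by
      refine h1.trans ?_
      rw [Real.norm_eq_abs, sq_abs]
      calc _ ≤ A * (η ^ 2 * W + M * η ^ 2) := by gcongr
        _ = _ := by ring
    have h4 : ∀ x : ℝ, q n (x - γ) * 𝓕⁻ Φ x =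
        (η⁻¹ : ℝ) * 𝓕⁻ (fun ξ => c * Φ (ξ - η) - Φ ξ) x := fun x => by
      have h5 : 𝓕⁻ (fun ξ => c * Φ (ξ - η) - Φ ξ) x =
          c * 𝓕⁻ (fun ξ => Φ (ξ - η)) x - 𝓕⁻ Φ x :=
        fourierInv_const_mul_sub ((hΦ.comp_sub η).integrable hk2) (hΦ.integrable hk2) c x
      rw [h5, fourierInv_comp_sub, ← mul_assoc c, hmod, ← sub_one_mul, ← mul_assoc]
      simp only [q, hη, one_div, inv_inv]
    simp only [h4, enorm_mul, mul_pow]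
    rw [lintegral_const_mul' _ _ (by finiteness),
      lintegral_enorm_sq_fourierInv (hΨ.integrable hk2) hΨ.memLp,
      ← ofReal_integral_norm_sq hΨ.memLp,
      ← ofReal_norm, ← ENNReal.ofReal_pow (norm_nonneg _), ← ENNReal.ofReal_mul (by positivity)]
    refine ENNReal.ofReal_le_ofReal ?_
    rw [Complex.norm_real, Real.norm_of_nonneg (by positivity), inv_pow, inv_mul_le_iff₀
      (by positivity)]
    exact h3
  have hcont : Continuous (𝓕⁻ Φ) := continuous_fourierInv (hΦ.integrable hk2)
  have hlim : ∀ x : ℝ, Tendsto (fun n => ‖q n (x - γ) * 𝓕⁻ Φ x‖ₑ ^ 2) atTop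
      (𝓝 (‖(((2 * Real.pi * (x - γ) : ℝ) : ℂ) * Complex.I) * 𝓕⁻ Φ x‖ₑ ^ 2)) := fun x =>
    ENNReal.Tendsto.pow ((tendsto_modulation_slope (x - γ)).mul_const _).enorm
  calc ∫⁻ x : ℝ, ‖((x - γ : ℝ) : ℂ) * 𝓕⁻ Φ x‖ₑ ^ 2
      ≤ ∫⁻ x : ℝ, ‖(((2 * Real.pi * (x - γ) : ℝ) : ℂ) * Complex.I) * 𝓕⁻ Φ x‖ₑ ^ 2 := by
        refine lintegral_mono fun x => ?_
        gcongr
        rw [enorm_le_iff_norm_le, norm_mul, norm_mul, norm_mul, Complex.norm_I, mul_one,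
          Complex.norm_real, Complex.norm_real, norm_mul, Real.norm_of_nonneg
          (show 0 ≤ 2 * Real.pi by positivity)]
        gcongr
        exact le_mul_of_one_le_left (norm_nonneg _) (by linarith [Real.pi_gt_three])
    _ = ∫⁻ x : ℝ, liminf (fun n => ‖q n (x - γ) * 𝓕⁻ Φ x‖ₑ ^ 2) atTop :=
        lintegral_congr fun x => (hlim x).liminf_eq.symm
    _ ≤ liminf (fun n => ∫⁻ x : ℝ, ‖q n (x - γ) * 𝓕⁻ Φ x‖ₑ ^ 2) atTop :=
        lintegral_liminf_le fun n => by
          refine (Continuous.measurable ?_).enorm.pow_const 2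
          simp only [q]
          fun_prop
    _ ≤ _ := liminf_le_of_le (h := fun b hb => by
        obtain ⟨n, hn⟩ := hb.exists
        exact hn.trans (hbound n))

end Moments

/-! ### Splines on the line -/

section Line

/-- A weighted Cauchy–Schwarz inequality; the weight is `(r⁴ + x²) / r`. -/
theorem integral_norm_le_of_moment {f : ℝ → ℂ} (hf : AEStronglyMeasurable f)
    (h1 : Integrable fun x => ‖f x‖ ^ 2) (h2 : Integrable fun x => x ^ 2 * ‖f x‖ ^ 2) {r : ℝ}
    (hr : 0 < r) : Integrable f ∧
      ∫ x, ‖f x‖ ≤ Real.pi / r + r ^ 3 * (∫ x, ‖f x‖ ^ 2) + r⁻¹ * ∫ x, x ^ 2 * ‖f x‖ ^ 2 := by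
  let p : ℝ → ℝ := fun x => (r ^ 3)⁻¹ * (1 + (x / r ^ 2) ^ 2)⁻¹
  have hp : Integrable p := (integrable_inv_one_add_sq.comp_div (by positivity)).const_mul _
  have hpi : ∫ x, p x = Real.pi / r := by
    simp only [p]
    rw [integral_const_mul, Measure.integral_comp_div (fun x => (1 + x ^ 2)⁻¹),
      integral_univ_inv_one_add_sq, abs_of_pos (by positivity), smul_eq_mul]
    field_simp
  have hq1 : Integrable fun x => p x + r ^ 3 * ‖f x‖ ^ 2 := hp.add (h1.const_mul _)
  have hq := hq1.add (h2.const_mul r⁻¹)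
  have hle : ∀ x, ‖f x‖ ≤ p x + r ^ 3 * ‖f x‖ ^ 2 + r⁻¹ * (x ^ 2 * ‖f x‖ ^ 2) := fun x => by
    have e1 : 0 < r ^ 4 + x ^ 2 := by positivity
    have e2 : p x = r / (r ^ 4 + x ^ 2) := by
      simp only [p]
      field_simp
    have e3 : p x + r ^ 3 * ‖f x‖ ^ 2 + r⁻¹ * (x ^ 2 * ‖f x‖ ^ 2) - ‖f x‖ =
        ((r ^ 4 + x ^ 2) * ‖f x‖ - r / 2) ^ 2 / (r * (r ^ 4 + x ^ 2)) +
          3 / 4 * (r / (r ^ 4 + x ^ 2)) := by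
      rw [e2]
      field_simp
      ring
    have e4 : 0 ≤ ((r ^ 4 + x ^ 2) * ‖f x‖ - r / 2) ^ 2 / (r * (r ^ 4 + x ^ 2)) +
          3 / 4 * (r / (r ^ 4 + x ^ 2)) := by positivity
    linarith
  refine ⟨hq.mono' hf (Eventually.of_forall hle), ?_⟩
  have h3 := integral_mono (hq.mono' hf (Eventually.of_forall hle)).norm hq hle
  refine h3.trans (le_of_eq ?_)
  rw [integral_add' hq1 (h2.const_mul _), integral_add hp (h1.const_mul _), hpi,
    integral_const_mul, integral_const_mul]

/-- The Fourier transform of a Schwartz function is Lipschitz in the mean square. -/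
theorem exists_integral_fourier_sub_sq_le (θ : 𝓢(ℝ, ℂ)) :
    ∃ M, 0 ≤ M ∧ ∀ η : ℝ, ∫ ξ, ‖𝓕 θ (ξ - η) - 𝓕 θ ξ‖ ^ 2 ≤ M * η ^ 2 := by
  let θ₁ : 𝓢(ℝ, ℂ) := SchwartzMap.smulLeftCLM ℂ (fun x : ℝ => x) θ
  have hθ₁ : ∀ x, ‖θ₁ x‖ ^ 2 = x ^ 2 * ‖θ x‖ ^ 2 := fun x => by
    rw [SchwartzMap.smulLeftCLM_apply_apply (by fun_prop), norm_smul, mul_pow, Real.norm_eq_abs,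
      sq_abs]
  have hi : Integrable fun x => x ^ 2 * ‖θ x‖ ^ 2 := by
    simp only [← hθ₁]
    exact (memLp_two_iff_integrable_sq_norm θ₁.continuous.aestronglyMeasurable).1 (θ₁.memLp 2)
  refine ⟨(2 * Real.pi) ^ 2 * ∫ x, x ^ 2 * ‖θ x‖ ^ 2, mul_nonneg (by positivity)
    (integral_nonneg fun x => by positivity), fun η => ?_⟩
  let Θ : 𝓢(ℝ, ℂ) := (𝓕 θ).compSubConstCLM ℂ η - 𝓕 θ
  have hΘ : ∀ ξ, Θ ξ = 𝓕 θ (ξ - η) - 𝓕 θ ξ := fun ξ => rfl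
  have hval : ∀ x, 𝓕⁻ Θ x =
      (Complex.exp (((2 * Real.pi * ⟪η, x⟫ : ℝ) : ℂ) * Complex.I) - 1) * θ x := fun x => by
    have h1 := fourierInv_const_mul_sub ((𝓕 θ).integrable.comp_sub_right η) (𝓕 θ).integrable 1 x
    rw [fourierInv_comp_sub, ← SchwartzMap.fourierInv_coe, FourierTransform.fourierInv_fourier_eq]
      at h1
    rw [SchwartzMap.fourierInv_coe, show (Θ : ℝ → ℂ) = fun ξ => 1 * 𝓕 θ (ξ - η) - 𝓕 θ ξ by
      ext ξ; rw [hΘ, one_mul], h1]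
    ring
  have h2 : ∫ ξ, ‖Θ ξ‖ ^ 2 = ∫ x, ‖𝓕⁻ Θ x‖ ^ 2 := by
    have := SchwartzMap.integral_norm_sq_fourier (𝓕⁻ Θ)
    rwa [FourierTransform.fourier_fourierInv_eq] at this
  simp only [← hΘ]
  rw [h2, mul_right_comm, ← integral_const_mul]
  refine integral_mono ((memLp_two_iff_integrable_sq_norm
    (𝓕⁻ Θ).continuous.aestronglyMeasurable).1 ((𝓕⁻ Θ).memLp 2))
    (hi.const_mul _) fun x => ?_
  simp only
  rw [hval, norm_mul, mul_pow]
  have e : ‖Complex.exp (((2 * Real.pi * ⟪η, x⟫ : ℝ) : ℂ) * Complex.I) - 1‖ ≤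
      2 * Real.pi * (|η| * |x|) := by
    rw [mul_comm _ Complex.I]
    refine (Real.norm_exp_I_mul_ofReal_sub_one_le).trans (le_of_eq ?_)
    rw [Real.norm_eq_abs, abs_mul, abs_of_pos (show 0 < 2 * Real.pi by positivity)]
    simp [abs_mul, mul_comm]
  calc _ ≤ (2 * Real.pi * (|η| * |x|)) ^ 2 * ‖θ x‖ ^ 2 := by gcongr
    _ = _ := by
      simp only [mul_pow, sq_abs]
      ring

theorem IsKnotSet.finite_inter_closedBall {lam : ℝ} {Y : Set ℝ} (hY : IsKnotSet lam Y) (σ : ℝ) :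
    (Y ∩ Metric.closedBall 0 σ).Finite := by
  obtain ⟨δ, hδ, hsep⟩ := hY.separated
  by_contra hinf
  obtain ⟨x, -, hx⟩ := Set.Infinite.exists_accPt_of_subset_isCompact hinf
    (isCompact_closedBall (0 : ℝ) σ) inter_subset_right
  rw [accPt_iff_nhds] at hx
  obtain ⟨y, ⟨hy1, hy2⟩, hyx⟩ := hx _ (Metric.ball_mem_nhds x (half_pos hδ))
  obtain ⟨z, ⟨hz1, hz2⟩, hzx⟩ := hx _ (Metric.ball_mem_nhds x (dist_pos.2 hyx))
  rw [Metric.mem_ball] at hy1 hz1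
  have hne : y ≠ z := fun h => by
    rw [h] at hz1
    exact lt_irrefl _ hz1
  have h1 := hsep y hy2.1 z hz2.1 hne
  have h2 := dist_triangle_right y z x
  linarith

variable {k : ℕ} {ε : ℝ} {Y : Set ℝ} {hk' : Module.finrank ℝ ℝ < 2 * k}
  {S : Lp ℂ 2 (volume : Measure ℝ) →L[ℂ] lp (fun _ : Y => ℂ) 2}
  {I : lp (fun _ : Y => ℂ) 2 →L[ℂ] Lp ℂ 2 (volume : Measure ℝ)}

theorem inner_energyOp_toLp {f : Lp ℂ 2 (volume : Measure ℝ)} (hε : 0 ≤ ε) {Ψ : ℝ → ℂ}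
    (hΨ : MemFourierSobolev k Ψ) :
    inner ℂ (energyOp k hε f) (MemLp.toLp _ hΨ) =
      ∫ ξ, starRingEnd ℂ (((symbol ε ξ ^ k : ℝ) : ℂ) * sobolevRep k f ξ) * Ψ ξ := by
  rw [inner_energyOp]
  refine integral_congr_ae ?_
  filter_upwards [sobolevRep_toLp_ae k hΨ] with ξ h
  rw [h]

theorem sampling_toLp_eq_zero (hS : ∀ g (x : Y), S g x = inner ℂ (evalVec k hk' (x : ℝ)) g)
    {Ψ : ℝ → ℂ} (hΨ : MemFourierSobolev k Ψ) (h : ∀ y ∈ Y, 𝓕⁻ Ψ y = 0) :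
    S (MemLp.toLp _ hΨ) = 0 := by
  ext y
  rw [hS, inner_evalVec, Real.fourierInv_congr_ae (sobolevRep_toLp_ae k hΨ), h y y.2]
  rfl

theorem memLp_two_of_lintegral_le {f : ℝ → ℂ} (hf : AEStronglyMeasurable f) {B : ℝ} (hB : 0 ≤ B)
    (h : ∫⁻ x, ‖f x‖ₑ ^ 2 ≤ ENNReal.ofReal B) : MemLp f 2 ∧ ∫ x, ‖f x‖ ^ 2 ≤ B := by
  have hm : MemLp f 2 := by
    refine ⟨hf, lt_of_not_ge fun ht => ?_⟩
    rw [lintegral_enorm_sq_eq, top_le_iff.1 ht] at h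
    exact absurd (h.trans_lt ENNReal.ofReal_lt_top) (by simp)
  refine ⟨hm, ?_⟩
  rwa [← ofReal_integral_norm_sq hm, ENNReal.ofReal_le_ofReal_iff hB] at h

/-- A spline on the line which vanishes at all the knots except possibly `γ` is integrable, since
its first moment is square integrable. -/
theorem integrable_lagrangeSpline (hk : 1 ≤ k) (hε : 0 ≤ ε) {lam : ℝ} (hlam : 0 < lam)
    (hY : IsKnotSet lam Y) (hS : ∀ g (x : Y), S g x = inner ℂ (evalVec k hk' (x : ℝ)) g)
    {g : Lp ℂ 2 (volume : Measure ℝ)} {b : lp (fun _ : Y => ℂ) 2}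
    (hb : energyOp k hε g = ContinuousLinearMap.adjoint S b) (γ : ℝ)
    (hγ : ∀ y : Y, (y : ℝ) ≠ γ → S g y = 0) : Integrable (𝓕⁻ (sobolevRep k g)) := by
  obtain ⟨A, hA, H⟩ := exists_moment_bound hk hε hlam
  have hΦ := memFourierSobolev_lp k g
  set u := 𝓕⁻ (sobolevRep k g) with hu
  have hcont : Continuous u := continuous_fourierInv (hΦ.integrable hk')
  have h1 := H Y (fun a => hY.exists_dist_le a) (sobolevRep k g) 0 hΦ MemLp.zero
    (fun Ψ hΨ hv => by
      rw [← inner_energyOp_toLp hε hΨ, hb, ContinuousLinearMap.adjoint_inner_left,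
        sampling_toLp_eq_zero hS hΨ hv, inner_zero_right]
      simp) γ 0 le_rfl (fun η _ => by simp) fun y hy hne => by
        rw [← inner_evalVec k hk', ← hS g ⟨y, hy⟩]
        exact hγ ⟨y, hy⟩ hne
  have hu2 : MemLp u 2 := memLp_fourierInv (hΦ.integrable hk') hΦ.memLp
  have hcont' : Continuous fun x : ℝ => ((x - γ : ℝ) : ℂ) * u x := by fun_prop
  have h2 : MemLp (fun x : ℝ => ((x - γ : ℝ) : ℂ) * u x) 2 := by
    refine (memLp_two_of_lintegral_le hcont'.aestronglyMeasurable ?_ h1).1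
    rw [integral_symbol_mul_sobolevRep]
    positivity
  have h3 : MemLp (fun x : ℝ => (x : ℂ) * u x) 2 := by
    refine (h2.add (hu2.const_mul (γ : ℂ))).congr_norm (Continuous.aestronglyMeasurable
      (by fun_prop)) (Eventually.of_forall fun x => ?_)
    simp only [Pi.add_apply]
    congr 1
    push_cast
    ring
  have h4 := (memLp_two_iff_integrable_sq_norm h3.1).1 h3
  simp only [norm_mul, Complex.norm_real, mul_pow, Real.norm_eq_abs, sq_abs] at h4
  exact (integral_norm_le_of_moment hcont.aestronglyMeasurable
    ((memLp_two_iff_integrable_sq_norm hu2.1).1 hu2) h4 zero_lt_one).1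

/-- The interpolation error of a Schwartz function is small in `L¹`: it is small in `L²`, and its
first moment is bounded in `L²`. -/
theorem exists_integral_interpolation_error_le (hk : 1 ≤ k) (hk' : Module.finrank ℝ ℝ < 2 * k)
    (hε : 0 ≤ ε) (ψ : 𝓢(ℝ, ℂ)) :
    ∃ N, 0 ≤ N ∧ ∀ (Y : Set ℝ) (h : ℝ), 0 < h → h ≤ 1 → IsKnotSet h Y →
      ∀ (S : Lp ℂ 2 (volume : Measure ℝ) →L[ℂ] lp (fun _ : Y => ℂ) 2)
        (I : lp (fun _ : Y => ℂ) 2 →L[ℂ] Lp ℂ 2 (volume : Measure ℝ)),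
      (∀ g (x : Y), S g x = inner ℂ (evalVec k hk' (x : ℝ)) g) → (∀ α, S (I α) = α) →
      (∀ α, ∃ b, energyOp k hε (I α) = ContinuousLinearMap.adjoint S b) →
      ∃ α, (∀ y : Y, α y = ψ y) ∧ Integrable (fun x => 𝓕⁻ (sobolevRep k (I α)) x - ψ x) ∧
        ∫ x, ‖𝓕⁻ (sobolevRep k (I α)) x - ψ x‖ ≤ N * √h := by
  have hk1 : Module.finrank ℝ ℝ / 2 + 1 ≤ k := by simpa using hk
  obtain ⟨C, hC, hP⟩ := exists_poincare ℝ
  obtain ⟨A₁, hA₁, hcoer⟩ := exists_sobolev_norm_le (E := ℝ) hk1 hε zero_lt_one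
  obtain ⟨A₂, hA₂, hmom⟩ := exists_moment_bound hk hε zero_lt_one
  let θ : 𝓢(ℝ, ℂ) := (dOp ε)^[k] ψ
  obtain ⟨M, hM, hθM⟩ := exists_integral_fourier_sub_sq_le θ
  have ha := memFourierSobolev_schwartz hk' (𝓕 ψ)
  let a : Lp ℂ 2 (volume : Measure ℝ) := MemLp.toLp _ ha
  have hrep : sobolevRep k a =ᵐ[volume] ((𝓕 ψ : 𝓢(ℝ, ℂ)) : ℝ → ℂ) := sobolevRep_toLp_ae k ha
  have haval : ∀ x, inner ℂ (evalVec k hk' x) a = ψ x := fun x => by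
    rw [inner_evalVec, Real.fourierInv_congr_ae hrep, ← SchwartzMap.fourierInv_coe,
      FourierTransform.fourierInv_fourier_eq]
  let Q := A₁ * ‖energyOp k hε a‖
  let B₁ := C ^ (2 * k) * Q ^ 2
  let B₂ := A₂ * (Q ^ 2 + M)
  have hB₁ : 0 ≤ B₁ := by positivity
  have hB₂ : 0 ≤ B₂ := by positivity
  refine ⟨Real.pi + B₁ + B₂, by positivity, fun Y h hh hh1 hY S I hS hSI hI =>
    ⟨S a, fun y => by rw [hS, haval], ?_⟩⟩
  set f := I (S a) - a with hf
  have hSf : S f = 0 := by rw [hf, map_sub, hSI, sub_self]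
  have hΦ := memFourierSobolev_lp k f
  have he : ∀ x, 𝓕⁻ (sobolevRep k (I (S a))) x - ψ x = 𝓕⁻ (sobolevRep k f) x := fun x => by
    rw [← inner_evalVec k hk', ← inner_evalVec k hk', ← haval, ← inner_sub_right]
  simp only [he]
  have hvan : ∀ y ∈ Y, 𝓕⁻ (sobolevRep k f) y = 0 := fun y hy => by
    rw [← inner_evalVec k hk', ← hS f ⟨y, hy⟩, hSf]
    rfl
  have horth : ∀ v, S v = 0 → inner ℂ (energyOp k hε f) v = -inner ℂ (energyOp k hε a) v := by
    intro v hv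
    obtain ⟨b, hb⟩ := hI (S a)
    rw [hf, map_sub, inner_sub_left, hb, ContinuousLinearMap.adjoint_inner_left, hv,
      inner_zero_right, zero_sub]
  have hfQ : ‖f‖ ≤ Q := by
    have h1 := hcoer _ hΦ fun a => by
      obtain ⟨z, hz, hd⟩ := hY.exists_dist_le a
      exact ⟨z, hd.trans hh1, hvan z hz⟩
    rw [integral_symbol_mul_sobolevRep] at h1
    have h2 : ∫ ξ, symbol ε ξ ^ k * ‖sobolevRep k f ξ‖ ^ 2 ≤ ‖energyOp k hε a‖ * ‖f‖ := by
      refine (Real.le_norm_self _).trans ?_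
      rw [← Complex.norm_real, ← inner_energyOp_self k hε, horth f hSf, norm_neg]
      exact norm_inner_le_norm _ _
    have h3 : ‖f‖ * ‖f‖ ≤ Q * ‖f‖ := by
      rw [← pow_two]
      refine h1.trans ((mul_le_mul_of_nonneg_left h2 hA₁.le).trans (le_of_eq ?_))
      simp only [Q]
      ring
    rcases (norm_nonneg f).eq_or_lt with h0 | h0
    · rw [← h0]
      positivity
    · exact le_of_mul_le_mul_right h3 h0
  have hL2 : ∫⁻ x, ‖𝓕⁻ (sobolevRep k f) x‖ₑ ^ 2 ≤ ENNReal.ofReal (B₁ * h ^ 2) := by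
    rw [lintegral_enorm_sq_fourierInv (hΦ.integrable hk') hΦ.memLp,
      ← ofReal_integral_norm_sq hΦ.memLp]
    refine ENNReal.ofReal_le_ofReal ?_
    have h1 := hP k hk1 h hh _ hΦ fun a => by
      obtain ⟨z, hz, hd⟩ := hY.exists_dist_le a
      exact ⟨z, hd, hvan z hz⟩
    have h2 := integral_pow_mul_le_integral_symbol hΦ zero_le_one
    rw [integral_symbol_mul_sobolevRep] at h2
    calc _ ≤ _ := h1
      _ ≤ (C * h) ^ (2 * k) * Q ^ 2 := by
        gcongr
        exact h2.trans (by gcongr)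
      _ = B₁ * h ^ (2 * k) := by
        simp only [B₁]
        rw [mul_pow]
        ring
      _ ≤ B₁ * h ^ 2 := by
        gcongr ?_ * ?_
        exact pow_le_pow_of_le_one hh.le hh1 (by omega)
  have hθ : ∀ ξ, ((symbol ε ξ ^ k : ℝ) : ℂ) * 𝓕 ψ ξ = 𝓕 θ ξ := fun ξ => by
    rw [fourier_dOp_iterate]
  have hmoment := hmom Y (fun a => by
      obtain ⟨z, hz, hd⟩ := hY.exists_dist_le a
      exact ⟨z, hz, hd.trans hh1⟩) (sobolevRep k f) (fun ξ => -𝓕 θ ξ) hΦ ((𝓕 θ).memLp 2).neg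
    (fun Ψ hΨ hv => by
      rw [← inner_energyOp_toLp hε hΨ, horth _ (sampling_toLp_eq_zero hS hΨ hv),
        inner_energyOp_toLp hε hΨ, ← integral_neg]
      refine integral_congr_ae ?_
      filter_upwards [hrep] with ξ hξ
      rw [hξ, hθ, map_neg, neg_mul]) 0 M hM (fun η _ => by
        refine (le_of_eq ?_).trans (hθM η)
        refine integral_congr_ae (Eventually.of_forall fun ξ => ?_)
        simp only [zero_mul, mul_zero, neg_zero, Complex.ofReal_zero, Complex.exp_zero, one_mul]
        rw [← norm_neg]
        congr 2
        ring) fun y hy _ => hvan y hy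
  have hcont : Continuous (𝓕⁻ (sobolevRep k f)) := continuous_fourierInv (hΦ.integrable hk')
  have hmoment' : ∫⁻ x : ℝ, ‖(x : ℂ) * 𝓕⁻ (sobolevRep k f) x‖ₑ ^ 2 ≤ ENNReal.ofReal B₂ := by
    simp only [sub_zero] at hmoment
    refine hmoment.trans (ENNReal.ofReal_le_ofReal ?_)
    rw [integral_symbol_mul_sobolevRep]
    simp only [B₂]
    gcongr
  obtain ⟨m1, i1⟩ := memLp_two_of_lintegral_le hcont.aestronglyMeasurable (by positivity) hL2
  obtain ⟨m2, i2⟩ := memLp_two_of_lintegral_le (Continuous.aestronglyMeasurable (by fun_prop))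
    hB₂ hmoment'
  have j2 := (memLp_two_iff_integrable_sq_norm m2.1).1 m2
  simp only [norm_mul, Complex.norm_real, mul_pow, Real.norm_eq_abs, sq_abs] at i2 j2
  -- the choice of the radius balances the three terms
  have hsq := Real.sqrt_pos.2 hh
  obtain ⟨k1, k2⟩ := integral_norm_le_of_moment hcont.aestronglyMeasurable
    ((memLp_two_iff_integrable_sq_norm m1.1).1 m1) j2 (inv_pos.2 hsq)
  refine ⟨k1, k2.trans ?_⟩
  have e1 : (√h)⁻¹ ^ 3 * h ^ 2 = √h := by
    rw [inv_pow]
    have : h ^ 2 = √h ^ 4 := by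
      rw [show 4 = 2 * 2 from rfl, pow_mul, Real.sq_sqrt hh.le]
    rw [this]
    field_simp
  calc _ ≤ Real.pi / (√h)⁻¹ + (√h)⁻¹ ^ 3 * (B₁ * h ^ 2) + ((√h)⁻¹)⁻¹ * B₂ := by
        gcongr
    _ = Real.pi * √h + B₁ * ((√h)⁻¹ ^ 3 * h ^ 2) + √h * B₂ := by
      rw [div_inv_eq_mul, inv_inv]
      ring
    _ = _ := by
      rw [e1]
      ring

theorem integrable_mul_exp_line {g : ℝ → ℂ} (hg : Integrable g) (τ : ℝ) :
    Integrable fun s => g s * Complex.exp (-Complex.I * ((s * τ : ℝ) : ℂ)) := by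
  refine hg.mul_bdd (c := 1) (Continuous.aestronglyMeasurable (by fun_prop))
    (Eventually.of_forall fun s => ?_)
  rw [show -Complex.I * ((s * τ : ℝ) : ℂ) = ((-(s * τ) : ℝ) : ℂ) * Complex.I by
    push_cast; ring, Complex.norm_exp_ofReal_mul_I]

theorem fourierLine_sub {f g : ℝ → ℂ} (hf : Integrable f) (hg : Integrable g) (τ : ℝ) :
    fourierLine (fun s => f s - g s) τ = fourierLine f τ - fourierLine g τ := by
  simp only [fourierLine, sub_mul]
  rw [integral_sub (integrable_mul_exp_line hf τ) (integrable_mul_exp_line hg τ), mul_sub]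

theorem fourierLine_finset_sum {ι : Type*} (F : Finset ι) (c : ι → ℂ) {f : ι → ℝ → ℂ}
    (hf : ∀ i, Integrable (f i)) (τ : ℝ) :
    fourierLine (fun s => ∑ i ∈ F, c i * f i s) τ = ∑ i ∈ F, c i * fourierLine (f i) τ := by
  simp only [fourierLine, Finset.sum_mul]
  rw [integral_finsetSum F fun i _ => integrable_mul_exp_line ((hf i).const_mul (c i)) τ,
    Finset.mul_sum]
  refine Finset.sum_congr rfl fun i _ => ?_
  simp only [mul_assoc]
  rw [integral_const_mul]
  ring

theorem norm_fourierLine_le (g : ℝ → ℂ) (τ : ℝ) : ‖fourierLine g τ‖ ≤ ∫ s, ‖g s‖ := by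
  rw [fourierLine, norm_mul, Complex.norm_real, Real.norm_of_nonneg (by positivity)]
  have h1 : (2 * Real.pi) ^ (-(1 : ℝ) / 2) ≤ 1 :=
    Real.rpow_le_one_of_one_le_of_nonpos (by linarith [Real.pi_gt_three]) (by norm_num)
  have h2 : ‖∫ s, g s * Complex.exp (-Complex.I * ((s * τ : ℝ) : ℂ))‖ ≤ ∫ s, ‖g s‖ := by
    refine (norm_integral_le_integral_norm _).trans (le_of_eq ?_)
    refine integral_congr_ae (Eventually.of_forall fun s => ?_)
    simp only
    rw [norm_mul, show -Complex.I * ((s * τ : ℝ) : ℂ) = ((-(s * τ) : ℝ) : ℂ) * Complex.I by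
      push_cast; ring, Complex.norm_exp_ofReal_mul_I, mul_one]
  exact (mul_le_of_le_one_left (norm_nonneg _) h1).trans h2

/-- The Fourier transform of a test function on the line, from its samples. -/
theorem tendsto_tsum_fourierLine (hk : 1 ≤ k) (hε : 0 ≤ ε) (ψ : 𝓢(ℝ, ℂ)) {σ : ℝ}
    (hψ : ∀ s, σ < |s| → ψ s = 0) {mesh : ℕ → ℝ} {Y : ℕ → Set ℝ} (hmesh : ∀ j, 0 < mesh j)
    (hlim : Tendsto mesh atTop (𝓝 0)) (hY : ∀ j, IsKnotSet (mesh j) (Y j))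
    {U : (j : ℕ) → Y j → ℝ → ℂ} (hU : ∀ j γ, IsLagrangeSpline ε k (Y j) γ (U j γ)) :
    (∀ j γ, Integrable (U j γ)) ∧ ∀ τ, Tendsto
      (fun j => ∑' γ : Y j, ψ γ * fourierLine (U j γ) τ) atTop (𝓝 (fourierLine ψ τ)) := by
  classical
  have hk1 : Module.finrank ℝ ℝ / 2 + 1 ≤ k := by simpa using hk
  have hk2 : Module.finrank ℝ ℝ < 2 * k := by
    rw [Module.finrank_self]
    omega
  choose S hS using fun j => exists_sampling hk2 (hY j)
  choose I hSI hI using fun j =>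
    exists_spline_interpolation hk1 hk2 hε (hmesh j) (hY j) (hS j)
  have hU' : ∀ j γ, U j γ = 𝓕⁻ (sobolevRep k (I j (lp.single 2 γ 1))) := fun j γ =>
    (isLagrangeSpline_iff hk1 hk2 hε (hmesh j) (hY j) (hS j) (hSI j) (hI j) γ _).1 (hU j γ)
  have hint : ∀ j γ, Integrable (U j γ) := fun j γ => by
    obtain ⟨b, hb⟩ := hI j (lp.single 2 γ 1)
    rw [hU']
    refine integrable_lagrangeSpline hk hε (hmesh j) (hY j) (hS j) hb γ fun y hy => ?_
    rw [hSI]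
    have : y ≠ γ := fun h => hy (congrArg _ h)
    simp [this]
  refine ⟨hint, fun τ => ?_⟩
  obtain ⟨N, hN, H⟩ := exists_integral_interpolation_error_le hk hk2 hε ψ
  have hmain : ∀ᶠ j in atTop, ‖(∑' γ : Y j, ψ γ * fourierLine (U j γ) τ) - fourierLine ψ τ‖ ≤
      N * √(mesh j) := by
    filter_upwards [hlim.eventually (eventually_le_nhds zero_lt_one)] with j hj
    obtain ⟨α, hα, he, hle⟩ := H (Y j) (mesh j) (hmesh j) hj (hY j) (S j) (I j) (hS j) (hSI j)
      (hI j)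
    -- only finitely many samples are not zero
    have hfin : {γ : Y j | |(γ : ℝ)| ≤ σ}.Finite := by
      refine Set.Finite.of_finite_image (f := Subtype.val)
        (((hY j).finite_inter_closedBall σ).subset ?_) Subtype.val_injective.injOn
      rintro _ ⟨γ, hγ, rfl⟩
      exact ⟨γ.2, by simpa using hγ⟩
    have hF : ∀ γ ∉ hfin.toFinset, ψ (γ : ℝ) = 0 := fun γ hγ =>
      hψ _ (not_le.1 (by simpa using hγ))
    have hαsum : α = ∑ γ ∈ hfin.toFinset, ψ (γ : ℝ) • lp.single 2 γ (1 : ℂ) := by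
      ext y
      rw [hα, lp.coeFn_sum, Finset.sum_apply]
      simp only [lp.coeFn_smul, Pi.smul_apply, lp.single_apply, smul_eq_mul, Pi.single_apply,
        mul_ite, mul_one, mul_zero]
      rw [Finset.sum_ite_eq]
      split_ifs with h
      · rfl
      · exact hF y h
    have hsum : 𝓕⁻ (sobolevRep k (I j α)) =
        fun s => ∑ γ ∈ hfin.toFinset, ψ (γ : ℝ) * U j γ s := by
      ext s
      rw [← inner_evalVec k hk2, hαsum, map_sum, inner_sum]
      refine Finset.sum_congr rfl fun γ _ => ?_
      rw [map_smul, inner_smul_right, inner_evalVec, hU']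
    have hsi : Integrable (𝓕⁻ (sobolevRep k (I j α))) := by
      rw [hsum]
      exact integrable_finsetSum _ fun γ _ => (hint j γ).const_mul _
    rw [tsum_eq_sum (s := hfin.toFinset) fun γ hγ => by rw [hF γ hγ, zero_mul],
      ← fourierLine_finset_sum _ (fun γ : Y j => ψ (γ : ℝ)) (hint j), ← hsum,
      ← fourierLine_sub hsi ψ.integrable]
    exact (norm_fourierLine_le _ τ).trans hle
  rw [tendsto_iff_norm_sub_tendsto_zero]
  refine squeeze_zero' (Eventually.of_forall fun j => norm_nonneg _) hmain ?_
  have := ((Real.continuous_sqrt.tendsto 0).comp hlim).const_mul N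
  simpa using this

end Line

/-! ### Reconstruction of test functions -/

section TestFunctions

variable {E : Type*} [NormedAddCommGroup E] [InnerProductSpace ℝ E] [FiniteDimensional ℝ E]
  [MeasurableSpace E] [BorelSpace E]

theorem existsUnique_lagrangeSpline {k : ℕ} (hk : Module.finrank ℝ E / 2 + 1 ≤ k) {ε : ℝ}
    (hε : 0 ≤ ε) {lam : ℝ} (hlam : 0 < lam) {X : Set E} (hX : IsKnotSet lam X) (x : X) :
    ∃! u, IsLagrangeSpline ε k X x u := by
  classical
  have hk' : Module.finrank ℝ E < 2 * k := by omega
  obtain ⟨S, hS⟩ := exists_sampling hk' hX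
  obtain ⟨I, hSI, hI⟩ := exists_spline_interpolation hk hk' hε hlam hX hS
  have h := isLagrangeSpline_iff hk hk' hε hlam hX hS hSI hI x
  exact ⟨_, (h _).2 rfl, fun u hu => (h u).1 hu⟩

theorem IsLagrangeSpline.hasExpForm {k : ℕ} (hk : Module.finrank ℝ E / 2 + 1 ≤ k) {ε : ℝ}
    (hε : 0 ≤ ε) {lam : ℝ} {X : Set E} (hX : IsKnotSet lam X) {x : X} {u : E → ℂ}
    (hu : IsLagrangeSpline ε k X x u) : HasExpForm ε k X (invFourierL2 u) := by
  classical
  have hk' : Module.finrank ℝ E < 2 * k := by omega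
  obtain ⟨S, hS⟩ := exists_sampling hk' hX
  obtain ⟨g, b, hg, hb⟩ := hu.1.exists_energyOp_eq hk' hε hS
  rw [hg]
  exact hasExpForm_of_energyOp_eq hk' hε hS hb

/-- Reconstruction of a test function from the values of its Fourier transform on a knot set. -/
theorem exists_hasL2Sum_lagrange [Nontrivial E] {k : ℕ} (hk : Module.finrank ℝ E / 2 + 1 ≤ k)
    {ε : ℝ} (hε : 0 ≤ ε) {C : ℝ} (hC : 0 < C)
    (hP : ∀ h : ℝ, 0 < h → ∀ Φ : E → ℂ, MemFourierSobolev k Φ →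
      (∀ a, ∃ z, dist a z ≤ h ∧ 𝓕⁻ Φ z = 0) →
      ∫ ξ, ‖Φ ξ‖ ^ 2 ≤ (C * h) ^ (2 * k) * ∫ ξ, (2 * Real.pi * ‖ξ‖) ^ (2 * k) * ‖Φ ξ‖ ^ 2)
    {lam : ℝ} (hlam : 0 < lam) {X : Set E} (hX : IsKnotSet lam X) {φ : E → ℂ}
    (hφ : ContDiff ℝ (⊤ : ℕ∞) φ) {σ : ℝ} (hs : Function.support φ ⊆ Metric.closedBall 0 σ)
    {L : X → E → ℂ} (hL : ∀ x, IsLagrangeSpline ε k X x (L x)) :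
    ∃ T : E → ℂ, HasL2Sum (fun (x : X) y => 𝓕⁻ (unflipScale φ) (x : E) * invFourierL2 (L x) y) T ∧
      eLpNorm (fun x => φ x - T x) 2 volume ≤
        ENNReal.ofReal ((C * lam) ^ (2 * k) * (σ ^ 2 + ε) ^ k) * radonNorm φ := by
  classical
  have hk' : Module.finrank ℝ E < 2 * k := by omega
  obtain ⟨S, hS⟩ := exists_sampling hk' hX
  obtain ⟨I, hSI, hI⟩ := exists_spline_interpolation hk hk' hε hlam hX hS
  obtain ⟨ψ, hψ⟩ := exists_schwartz_unflipScale hφ hs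
  have ha := memFourierSobolev_schwartz hk' ψ
  let a : Lp ℂ 2 (volume : Measure E) := MemLp.toLp _ ha
  have hrep : sobolevRep k a =ᵐ[volume] unflipScale φ := hψ ▸ sobolevRep_toLp_ae k ha
  have hval : ∀ x : X, S a x = 𝓕⁻ (unflipScale φ) (x : E) := fun x => by
    rw [hS, inner_evalVec, Real.fourierInv_congr_ae hrep]
  refine ⟨flipScale (sobolevRep k (I (S a))), ?_, ?_⟩
  · simp only [← hval]
    exact hasL2Sum_interpolation hk'
      (fun x => (isLagrangeSpline_iff hk hk' hε hlam hX hS hSI hI x _).1 (hL x)) (S a)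
  · have h1 := eLpNorm_interpolation_error_le hC hP hk' hε hlam hX hS hSI hI (σ := σ) a (by
      filter_upwards [hrep] with ξ hξ h0
      rw [hξ] at h0
      exact two_pi_norm_le_of_unflipScale_ne_zero hs h0)
    have h2 : (fun x => φ x - flipScale (sobolevRep k (I (S a))) x) =ᵐ[volume]
        flipScale (sobolevRep k (a - I (S a) : Lp ℂ 2 (volume : Measure E))) := by
      have h3 : (fun ξ => unflipScale φ ξ - sobolevRep k (I (S a)) ξ) =ᵐ[volume]
          sobolevRep k (a - I (S a) : Lp ℂ 2 (volume : Measure E)) := by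
        filter_upwards [hrep, sobolevRep_sub_ae k a (I (S a))] with ξ h4 h5
        rw [h5, h4]
      filter_upwards [flipScale_ae_congr h3] with x hx
      rw [← hx, ← flipScale_sub, flipScale_unflipScale]
    have h4 : eLpNorm (sobolevRep k a) 2 volume = eLpNorm φ 2 volume := by
      rw [eLpNorm_congr_ae hrep]
      conv_rhs => rw [← flipScale_unflipScale φ]
      rw [eLpNorm_flipScale (hψ ▸ ψ.memLp 2)]
    rw [eLpNorm_congr_ae h2, eLpNorm_flipScale (memFourierSobolev_lp k _).memLp]
    refine h1.trans ?_
    rw [h4]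
    gcongr
    exact eLpNorm_le_radonNorm hφ hs

/-- The bound for the symbol on the ball of radius `σ`, as a square in `σ + ε`. For `ε = 0` it reads
`σ² ≤ σ²`, as `0⁻¹ = 0`. -/
theorem sq_add_le_of_bandlimit {σ ε : ℝ} (hσ : 0 < σ) (hε : 0 ≤ ε) :
    σ ^ 2 + ε ≤ ((1 + ε⁻¹) * (σ + ε)) ^ 2 := by
  rcases hε.eq_or_lt with rfl | h
  · simp
  · have h1 : (1 + ε⁻¹) * (σ + ε) = σ + 1 + (ε + ε⁻¹ * σ) := by
      field_simp
      ring
    have h2 : 0 < ε⁻¹ * σ := by positivity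
    rw [h1]
    nlinarith

end TestFunctions

theorem theorem3p4 (d : ℕ) (hd : 1 ≤ d) (ε : ℝ) (hε : 0 ≤ ε) :
    ∃ c : ℝ, 0 < c ∧
      ∀ (σ : ℝ), 0 < σ → ∀ (r : ℕ), d / 2 + 1 ≤ r →
      ∀ (lam : ℝ), 0 < lam → lam < (c * (σ + ε))⁻¹ →
      ∀ (Ξ : Set (EuclideanSpace ℝ (Fin d))), IsKnotSet lam Ξ →
      -- polar coordinates of the knots
      ∀ (θ : Ξ → EuclideanSpace ℝ (Fin d)) (τ : Ξ → ℝ),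
        (∀ ξ, ‖θ ξ‖ = 1) → (∀ ξ, 0 ≤ τ ξ) →
        (∀ ξ : Ξ, (ξ : EuclideanSpace ℝ (Fin d)) = τ ξ • θ ξ) →
      -- the Lagrangian splines exist and are unique
      (∀ (l : ℕ) (ξ : Ξ), ∃! u, IsLagrangeSpline ε (2 ^ l * r) Ξ ξ u) ∧
      ∀ L : ℕ → Ξ → EuclideanSpace ℝ (Fin d) → ℂ,
        (∀ l ξ, IsLagrangeSpline ε (2 ^ l * r) Ξ ξ (L l ξ)) →
        (∀ l ξ, HasExpForm ε (2 ^ l * r) Ξ (invFourierL2 (L l ξ))) ∧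
        ∀ φ : EuclideanSpace ℝ (Fin d) → ℂ, ContDiff ℝ ∞ φ →
          Function.support φ ⊆ Metric.closedBall 0 σ →
          -- reconstruction of `φ`, with the error estimate
          (∃ S : ℕ → EuclideanSpace ℝ (Fin d) → ℂ,
            (∀ l, HasL2Sum
              (fun (ξ : Ξ) x => (((2 * Real.pi) ^ ((1 - (d : ℝ)) / 2) : ℝ) : ℂ) *
                (radonHat φ (θ ξ) (τ ξ) * invFourierL2 (L l ξ) x)) (S l)) ∧
            Tendsto (fun l => eLpNorm (fun x => φ x - S l x) 2 volume) atTop (𝓝 0) ∧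
            ∀ l, eLpNorm (fun x => φ x - S l x) 2 volume ≤
              ENNReal.ofReal (2 * (c * lam * (σ + ε)) ^ (2 ^ (l + 1) * r)) * radonNorm φ) ∧
          -- the values of the transformed Radon transform from one-dimensional samples
          ∀ (ε₁ : ℝ), 0 ≤ ε₁ → ∀ (m : ℕ) (mesh : ℕ → ℝ) (Y : ℕ → Set ℝ),
            (∀ j, 0 < mesh j) → Tendsto mesh atTop (𝓝 0) → (∀ j, IsKnotSet (mesh j) (Y j)) →
            (∀ (j : ℕ) (γ : Y j), ∃! u, IsLagrangeSpline ε₁ (2 ^ m) (Y j) γ u) ∧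
            ∀ U : (j : ℕ) → Y j → ℝ → ℂ,
              (∀ j γ, IsLagrangeSpline ε₁ (2 ^ m) (Y j) γ (U j γ)) →
              (∀ j γ, Integrable (U j γ) volume) ∧
              ∀ ξ : Ξ, Tendsto
                (fun j => ∑' γ : Y j, radon φ (θ ξ) γ * fourierLine (U j γ) (τ ξ))
                atTop (𝓝 (radonHat φ (θ ξ) (τ ξ))) := by
  let E := EuclideanSpace ℝ (Fin d)
  have hfin : Module.finrank ℝ E = d := finrank_euclideanSpace_fin
  have : Nontrivial E := Module.nontrivial_of_finrank_pos (R := ℝ) (by omega)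
  obtain ⟨C, hC, hP⟩ := exists_poincare E
  -- the factor `1 + ε⁻¹` bounds `σ² + ε` by a multiple of `(σ + ε)²`; it is `1` for `ε = 0`
  have hc : 0 < C * (1 + ε⁻¹) := by positivity
  refine ⟨C * (1 + ε⁻¹), hc, fun σ hσ r hr lam hlam hlam' Ξ hΞ θ τ hθ _ hpolar => ?_⟩
  have hk : ∀ l, Module.finrank ℝ E / 2 + 1 ≤ 2 ^ l * r := fun l => by
    rw [hfin]
    exact hr.trans (Nat.le_mul_of_pos_left r (by positivity))
  refine ⟨fun l ξ => existsUnique_lagrangeSpline (hk l) hε hlam hΞ ξ, fun L hL =>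
    ⟨fun l ξ => (hL l ξ).hasExpForm (hk l) hε hΞ, fun φ hφ hs => ⟨?_, ?_⟩⟩⟩
  · choose S hS hle using fun l =>
      exists_hasL2Sum_lagrange (hk l) hε hC (hP _ (hk l)) hlam hΞ hφ hs (hL l)
    let q := C * (1 + ε⁻¹) * lam * (σ + ε)
    have hq0 : 0 ≤ q := by positivity
    have hq1 : q < 1 := by
      have h : 0 < C * (1 + ε⁻¹) * (σ + ε) := by positivity
      calc q = lam * (C * (1 + ε⁻¹) * (σ + ε)) := by ring
        _ < (C * (1 + ε⁻¹) * (σ + ε))⁻¹ * (C * (1 + ε⁻¹) * (σ + ε)) :=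
          mul_lt_mul_of_pos_right hlam' h
        _ = 1 := inv_mul_cancel₀ h.ne'
    have hbound : ∀ l, eLpNorm (fun x => φ x - S l x) 2 volume ≤
        ENNReal.ofReal (2 * q ^ (2 ^ (l + 1) * r)) * radonNorm φ := fun l => by
      refine (hle l).trans ?_
      gcongr ENNReal.ofReal ?_ * _
      have e : (C * lam) ^ (2 * (2 ^ l * r)) * (σ ^ 2 + ε) ^ (2 ^ l * r) ≤
          q ^ (2 ^ (l + 1) * r) := by
        calc _ ≤ (C * lam) ^ (2 * (2 ^ l * r)) * (((1 + ε⁻¹) * (σ + ε)) ^ 2) ^ (2 ^ l * r) := by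
              gcongr
              exact sq_add_le_of_bandlimit hσ hε
          _ = q ^ (2 ^ (l + 1) * r) := by
            rw [← pow_mul, ← mul_pow, ← mul_assoc 2, ← pow_succ']
            congr 1
            ring
      -- the interpolation error satisfies the bound without the factor `2`
      linarith [pow_nonneg hq0 (2 ^ (l + 1) * r)]
    refine ⟨S, fun l => ?_, ?_, hbound⟩
    · convert hS l using 3 with ξ x
      rw [← mul_assoc]
      congr 1
      have hi : Integrable φ := hφ.continuous.integrable_of_hasCompactSupport
        (hasCompactSupport_of_support_subset hs)
      have := fourierInv_unflipScale hi (hθ ξ) (τ ξ)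
      rw [hpolar ξ, this, hfin]
    · have hpow : Tendsto (fun l => 2 * q ^ (2 ^ (l + 1) * r)) atTop (𝓝 (2 * 0)) := by
        refine ((tendsto_pow_atTop_nhds_zero_of_lt_one hq0 hq1).comp
          (tendsto_atTop_mono (fun l => ?_) tendsto_id)).const_mul 2
        have h1 : l < 2 ^ l := Nat.lt_two_pow_self
        have h2 : 0 < r := by omega
        have h3 : 2 ^ (l + 1) = 2 ^ l + 2 ^ l := by ring
        simp only [id]
        nlinarith
      have hlim := ENNReal.Tendsto.mul_const (ENNReal.tendsto_ofReal hpow)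
        (b := radonNorm φ) (Or.inr (radonNorm_ne_top hφ hs))
      rw [mul_zero, ENNReal.ofReal_zero, zero_mul] at hlim
      exact tendsto_of_tendsto_of_tendsto_of_le_of_le tendsto_const_nhds hlim
        (fun l => zero_le) hbound
  · intro ε₁ hε₁ m mesh Y hmesh hlim hY
    have hm : Module.finrank ℝ ℝ / 2 + 1 ≤ 2 ^ m := by
      rw [Module.finrank_self]
      exact Nat.one_le_two_pow
    refine ⟨fun j γ => existsUnique_lagrangeSpline hm hε₁ (hmesh j) (hY j) γ, fun U hU => ?_⟩
    have hsample := fun (ψ : 𝓢(ℝ, ℂ)) (hψ : ∀ s, σ < |s| → ψ s = 0) =>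
      tendsto_tsum_fourierLine Nat.one_le_two_pow hε₁ ψ hψ hmesh hlim hY hU
    refine ⟨(hsample 0 fun s _ => rfl).1, fun ξ => ?_⟩
    obtain ⟨ψ, hψ⟩ := exists_schwartz_radon hφ hs (hθ ξ)
    have := (hsample ψ fun s h => by rw [hψ, radon_eq_zero hs (hθ ξ) h]).2 (τ ξ)
    rw [hψ] at this
    exact this
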